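/- There is an absolute constant $C>0$ with the following property. Let $d\ge 1$ and $m\ge 0$ be integers, equip $\mathbb Z^d$ with the distance $|i-j|=\max_{1\le k\le d}|i_k-j_k|$, and put $\rho(A,B)=\inf\{|i-j|:i\in A,\ j\in B\}$ for $A,B\subset\mathbb Z^d$ (with $\inf\emptyset=\infty$). Let $\mathcal J\subset\mathbb Z^d$ be finite and let $\{X_i,\ i\in\mathcal J\}$ be real random variables on a probability space with $E X_i=0$ and $E|X_i|^3<\infty$ for all $i\in\mathcal J$. Suppose that the field is $m$-dependent: $\{X_i, i\in A\}$ and $\{X_j, j\in B\}$ are independent whenever $A,B\subset\mathcal J$ and $\rho(A,B)>m$. For $i\in\mathcal J$ let $$A_i=\{j\in\mathcal J:|i-j|\le m\},\qquad Y_i=\sum_{j\in A_i}X_j,$$ and assume that $\sigma^2:=\sum_{i\in\mathcal J}E\{X_iY_i\}>0$, $\sigma>0$. Put $$\bar X=\frac1{|\mathcal J|}\sum_{i\in\mathcal J}X_i,\quad \bar Y=\frac1{|\mathcal J|}\sum_{i\in\mathcal J}Y_i,\quad S=\sum_{i\in\mathcal J}X_i,\quad V=\Bigl(\max\Bigl\{\sum_{i\in\mathcal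 J}(X_iY_i-\bar X\bar Y),\,0\Bigr\}\Bigr)^{1/2},\quad W=S/V,$$ with $W=0$ where $V=0$. Then $$\sup_{z\in\mathbb R}\bigl|P(W\le z)-\Phi(z)\bigr|\le C^d(m+1)^{3d}\bigl(1+(m+1)^d|\mathcal J|^{1/3}\gamma^{2/3}\bigr)\bigl(\gamma+|\mathcal J|^{-1/2}\bigr),$$ where $\gamma=\sum_{i\in\mathcal J}E|X_i|^3/\sigma^3$, $|\mathcal J|$ is the number of elements of $\mathcal J$ and $\Phi$ is the standard normal distribution function. -/

import Mathlib

open MeasureTheory ProbabilityTheory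

noncomputable section

/-- The points of the lattice `ℤ^d`. -/
abbrev IntLattice (d : ℕ) : Type := Fin d → ℤ

/-- The distance `|i - j| = max_k |i_k - j_k|` on `ℤ^d`. -/
def latticeDist {d : ℕ} (i j : IntLattice d) : ℕ :=
  Finset.univ.sup fun k => (i k - j k).natAbs

/-- The distance `ρ(A, B) = inf {|i - j| : i ∈ A, j ∈ B}` of two subsets of `ℤ^d`; it is `⊤` if
one of them is empty. -/
def latticeSetDist {d : ℕ} (A B : Finset (IntLattice d)) : ℕ∞ :=
  ⨅ i ∈ A, ⨅ j ∈ B, (latticeDist i j : ℕ∞)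

/-- The field `{X_i : i ∈ J}` is `m`-dependent: `{X_i : i ∈ A}` and `{X_j : j ∈ B}` are
independent whenever `A, B ⊆ J` and `ρ(A, B) > m`. -/
def IsMDependentField {d : ℕ} {Ω : Type*} [MeasurableSpace Ω] (μ : Measure Ω)
    (J : Finset (IntLattice d)) (X : IntLattice d → Ω → ℝ) (m : ℕ) : Prop :=
  ∀ A B : Finset (IntLattice d), A ⊆ J → B ⊆ J → (m : ℕ∞) < latticeSetDist A B →
    IndepFun (fun ω (i : A) => X i ω) (fun ω (j : B) => X j ω) μ

section Statistic

variable {d : ℕ} {Ω : Type*} (J : Finset (IntLattice d)) (X : IntLattice d → Ω → ℝ) (m : ℕ)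

/-- The neighbourhood `A_i = {j ∈ J : |i - j| ≤ m}`. -/
def nbhd (i : IntLattice d) : Finset (IntLattice d) :=
  J.filter fun j => latticeDist i j ≤ m

/-- The local sum `Y_i = ∑_{j ∈ A_i} X_j`. -/
def localSum (i : IntLattice d) (ω : Ω) : ℝ :=
  ∑ j ∈ nbhd J m i, X j ω

/-- The average `(∑_{i ∈ J} Z_i) / |J|` of a field over `J`. -/
def fieldMean (Z : IntLattice d → Ω → ℝ) (ω : Ω) : ℝ :=
  (∑ i ∈ J, Z i ω) / (J.card : ℝ)

/-- The sum `S = ∑_{i ∈ J} X_i`. -/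
def fieldSum (ω : Ω) : ℝ :=
  ∑ i ∈ J, X i ω

/-- The self-normalizer `V`, the square root of the positive part of
`∑_{i ∈ J} (X_i Y_i - X̄ Ȳ)`. -/
def selfNormalizer (ω : Ω) : ℝ :=
  Real.sqrt (max (∑ i ∈ J, (X i ω * localSum J X m i ω
    - fieldMean J X ω * fieldMean J (localSum J X m) ω)) 0)

/-- The self-normalized sum `W = S / V`, with the value `0` where `V = 0`. -/
def selfNormalizedSum (ω : Ω) : ℝ :=
  fieldSum J X ω / selfNormalizer J X m ω

variable [MeasurableSpace Ω] (μ : Measure Ω)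

/-- `σ² = ∑_{i ∈ J} E (X_i Y_i)`. -/
def sigmaSq : ℝ :=
  ∑ i ∈ J, ∫ ω, X i ω * localSum J X m i ω ∂μ

/-- `γ = ∑_{i ∈ J} E |X_i|³ / σ³`. -/
def gammaRatio : ℝ :=
  ∑ i ∈ J, (∫ ω, |X i ω| ^ 3 ∂μ) / Real.sqrt (sigmaSq J X m μ) ^ 3

end Statistic

end

set_option linter.unusedSectionVars false

/-! The proof is Stein's method combined with a conditional concentration inequality. Divide the
field by `σ` and truncate it at `D⁻¹`, where `D = (10 (m + 1)) ^ d` bounds the number of points in a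
ball of radius `5 m`; the truncated field `x` has sum `S` and quadratic form `Q = ∑ x_i y_i`, where
`y_i` sums `x` over the `m`-ball of `i`. The normalizer becomes `g = invRoot c Q`, a bounded
Lipschitz function of `Q`, and `W = S g`.

Deleting from `S` and `Q` all coordinates within `m` of `i` gives quantities `g_i`, `W_i`
independent of `x_i`, so `E x_i g_i f(W_i)` factors and is small: only the truncation spoils `E x_i
= 0`. Expanding `g f(W)` around `g_i f(W_i)` (`LocalField.abs_expansion_le`) gives `E W f(W) ≈ E Q
g² f'(W)`, and `Q g² ≈ 1`. If `f` solves Stein's equation for `z`, then `f'` jumps at `z`, and the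
remainder contains the probability, weighted by `|x_i| T_i`, that `W` lies within `2 T_i` of `z`.
Here `T_i` sums the absolute values of the coordinates within `2 m` of `i`.

Such windows are controlled by `ConcBound`: `E ζ 1(Z ≤ W ≤ Z + R) ≤ k E ζ (R + η)`, where `ζ`, `Z`,
`R` depend only on the coordinates near a finite set `I`. The same expansion, with an `f` whose
derivative is a trapezoid above the window, proves it up to remainders that are again windows, now
depending on the coordinates near `I ∪ {j}`. Thus a constant `k` for the sets `I ∪ {j}` yields `200
(|I| + 2)² + k / 16` for `I` (`LocalField.concBound_step`). Starting from the trivial `k = 1 / η =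
θ⁻³` at sets of about `1 / θ` points, whose neighbourhoods still carry only a small part of the
variance, the geometric decay leaves an absolute constant for singletons
(`LocalField.concBound_singleton`). This yields `LocalField.stein_bound`; its factor `1 + D
|J|^(1/3) γ^(2/3)` comes from multiplying `η ≈ D³ γ` by `∑ E |x_i| T_i ≤ D ∑ E x_i²`.

The centering term `X̄ Ȳ` is typically below `δ = |J|^(-1/2)` after rescaling. It is replaced by the
constant shifts `c = ±δ`, between which the statistic is squeezed (`LocalField.student_bound`).
Undoing the truncation costs powers of `D` times `γ` (`studentSum_normal_approx`). -/

/-- The indicator function of the interval `[a, b]`. -/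
noncomputable def window (a b w : ℝ) : ℝ := if a ≤ w ∧ w ≤ b then 1 else 0

lemma window_nonneg (a b w : ℝ) : 0 ≤ window a b w := by
  unfold window
  split_ifs <;> norm_num

lemma window_le_one (a b w : ℝ) : window a b w ≤ 1 := by
  unfold window
  split_ifs <;> norm_num

/-! ### Tail bounds for the standard normal law -/

/-- The standard normal distribution function. -/
noncomputable def stdCdf (w : ℝ) : ℝ := cdf (gaussianReal 0 1) w

/-- The standard normal density. -/
noncomputable def stdPdf (w : ℝ) : ℝ := gaussianPDFReal 0 1 w

lemma stdPdf_eq (w : ℝ) : stdPdf w = (Real.sqrt (2 * Real.pi))⁻¹ * Real.exp (-(w ^ 2 / 2)) := by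
  simp only [stdPdf, gaussianPDFReal, NNReal.coe_one, mul_one, sub_zero, neg_div]

lemma stdPdf_pos (w : ℝ) : 0 < stdPdf w := by
  rw [stdPdf_eq]
  positivity

lemma hasDerivAt_stdPdf (w : ℝ) : HasDerivAt stdPdf (-w * stdPdf w) w := by
  have h : stdPdf = fun w => (Real.sqrt (2 * Real.pi))⁻¹ * Real.exp (-(w ^ 2 / 2)) :=
    funext stdPdf_eq
  rw [h]
  have h1 : HasDerivAt (fun w : ℝ => -(w ^ 2 / 2)) (-w) w := by
    have := ((hasDerivAt_pow 2 w).div_const 2).neg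
    refine this.congr_deriv ?_
    simp
  refine (h1.exp.const_mul ((Real.sqrt (2 * Real.pi))⁻¹)).congr_deriv ?_
  ring

lemma stdPdf_le_of_abs_le {v w : ℝ} (h : |v| ≤ |w|) : stdPdf w ≤ stdPdf v := by
  rw [stdPdf_eq, stdPdf_eq]
  have := sq_le_sq.mpr h
  gcongr

lemma stdPdf_le_one (w : ℝ) : stdPdf w ≤ 1 := by
  refine (stdPdf_le_of_abs_le (v := 0) (by simp)).trans ?_
  rw [stdPdf_eq]
  simp only [ne_eq, OfNat.ofNat_ne_zero, not_false_eq_true, zero_pow, zero_div, neg_zero,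
    Real.exp_zero, mul_one]
  apply inv_le_one_of_one_le₀
  rw [Real.one_le_sqrt]
  linarith [Real.pi_gt_three]

lemma one_fifth_le_stdPdf {w : ℝ} (h : |w| ≤ 1) : 1 / 5 ≤ stdPdf w := by
  refine le_trans ?_ (stdPdf_le_of_abs_le (v := w) (w := 1) (by simpa using h))
  rw [stdPdf_eq, Real.exp_neg, ← mul_inv, one_div]
  apply inv_anti₀ (by positivity)
  have h1 : Real.sqrt (2 * Real.pi) ≤ 2.6 := by
    rw [Real.sqrt_le_left (by norm_num)]
    linarith [Real.pi_lt_d2]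
  have h2 : Real.exp (1 ^ 2 / 2) ≤ 1.9 := by
    have : Real.exp (1 ^ 2 / 2) ^ 2 ≤ 1.9 ^ 2 := by
      rw [← Real.exp_nat_mul]
      norm_num
      linarith [Real.exp_one_lt_d9]
    exact le_of_sq_le_sq this (by norm_num)
  calc _ ≤ 2.6 * (1.9 : ℝ) := by gcongr
    _ ≤ 5 := by norm_num

lemma stdCdf_nonneg (w : ℝ) : 0 ≤ stdCdf w := cdf_nonneg _ _

lemma stdCdf_le_one (w : ℝ) : stdCdf w ≤ 1 := cdf_le_one _ _

lemma stdCdf_eq_integral (w : ℝ) : stdCdf w = ∫ t in Set.Iic w, stdPdf t := by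
  rw [stdCdf, cdf_eq_real, measureReal_def, gaussianReal_apply_eq_integral _ one_ne_zero,
    ENNReal.toReal_ofReal]
  · rfl
  · exact integral_nonneg fun t => gaussianPDFReal_nonneg _ _ _

lemma hasDerivAt_stdCdf (w : ℝ) : HasDerivAt stdCdf (stdPdf w) w := by
  have hc : Continuous stdPdf := by
    rw [show stdPdf = fun w => (Real.sqrt (2 * Real.pi))⁻¹ * Real.exp (-(w ^ 2 / 2)) from
      funext stdPdf_eq]
    fun_prop
  have hi : Integrable stdPdf := integrable_gaussianPDFReal 0 1
  have h : stdCdf = fun v => stdCdf 0 + ∫ t in (0 : ℝ)..v, stdPdf t := by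
    funext v
    rw [← intervalIntegral.integral_Iic_sub_Iic hi.integrableOn hi.integrableOn,
      stdCdf_eq_integral, stdCdf_eq_integral]
    ring
  rw [h]
  exact (intervalIntegral.integral_hasDerivAt_right (hc.intervalIntegrable _ _)
    hc.stronglyMeasurable.stronglyMeasurableAtFilter hc.continuousAt).const_add _

/-- Mills' ratio: `φ(u) / u - (1 - Φ(u))` has derivative `-φ(u) / u²`, so it decreases to its limit
`0` and is nonnegative. -/
lemma mul_one_sub_stdCdf_le {w : ℝ} (hw : 0 ≤ w) : w * (1 - stdCdf w) ≤ stdPdf w := by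
  rcases hw.eq_or_lt with rfl | hw
  · simpa using (stdPdf_pos 0).le
  have hd : ∀ u ∈ Set.Ioi (0 : ℝ), HasDerivAt (fun u => stdPdf u / u - (1 - stdCdf u))
      (-(stdPdf u / u ^ 2)) u := by
    intro u hu
    have hu' : u ≠ 0 := (Set.mem_Ioi.mp hu).ne'
    refine (((hasDerivAt_stdPdf u).div (hasDerivAt_id u) hu').sub
      ((hasDerivAt_stdCdf u).const_sub 1)).congr_deriv ?_
    simp only [id]
    field_simp
    ring
  have hanti : AntitoneOn (fun u => stdPdf u / u - (1 - stdCdf u)) (Set.Ioi 0) := by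
    apply antitoneOn_of_deriv_nonpos (convex_Ioi 0)
    · exact fun u hu => (hd u hu).continuousAt.continuousWithinAt
    · exact fun u hu => (hd u (interior_subset hu)).differentiableAt.differentiableWithinAt
    · intro u hu
      rw [(hd u (interior_subset hu)).deriv]
      have := stdPdf_pos u
      have : 0 ≤ stdPdf u / u ^ 2 := by positivity
      linarith
  have hlim : Filter.Tendsto (fun u => stdPdf u / u - (1 - stdCdf u)) Filter.atTop (nhds 0) := by
    have h1 : Filter.Tendsto (fun u => stdPdf u / u) Filter.atTop (nhds 0) := by
      refine squeeze_zero' ?_ ?_ tendsto_inv_atTop_zero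
      · filter_upwards [Filter.eventually_gt_atTop 0] with u hu
        exact div_nonneg (stdPdf_pos u).le hu.le
      · filter_upwards [Filter.eventually_gt_atTop 0] with u hu
        rw [div_eq_mul_inv]
        exact mul_le_of_le_one_left (by positivity) (stdPdf_le_one u)
    have h2 : Filter.Tendsto stdCdf Filter.atTop (nhds 1) := tendsto_cdf_atTop _
    simpa using h1.sub (h2.const_sub 1)
  have h0 : 0 ≤ stdPdf w / w - (1 - stdCdf w) := by
    refine le_of_tendsto hlim ?_
    filter_upwards [Filter.eventually_ge_atTop w] with u hu
    exact hanti (Set.mem_Ioi.mpr hw) (Set.mem_Ioi.mpr (hw.trans_le hu)) hu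
  have h1 : 1 - stdCdf w ≤ stdPdf w / w := by linarith
  rw [le_div_iff₀ hw] at h1
  linarith

lemma stdCdf_neg (w : ℝ) : stdCdf (-w) = 1 - stdCdf w := by
  have hd : ∀ u, HasDerivAt (fun u => stdCdf (-u) + stdCdf u) 0 u := by
    intro u
    have h1 : HasDerivAt (fun u => stdCdf (-u)) (stdPdf (-u) * (-1)) u :=
      (hasDerivAt_stdCdf (-u)).comp u (hasDerivAt_neg u)
    refine (h1.add (hasDerivAt_stdCdf u)).congr_deriv ?_
    rw [stdPdf_eq, stdPdf_eq]
    simp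
  have hconst : ∀ u v, stdCdf (-u) + stdCdf u = stdCdf (-v) + stdCdf v :=
    is_const_of_deriv_eq_zero (fun u => (hd u).differentiableAt) fun u => (hd u).deriv
  have hlim : Filter.Tendsto (fun u => stdCdf (-u) + stdCdf u) Filter.atTop (nhds (0 + 1)) :=
    ((tendsto_cdf_atBot _).comp Filter.tendsto_neg_atTop_atBot).add (tendsto_cdf_atTop _)
  have hc : Filter.Tendsto (fun u => stdCdf (-u) + stdCdf u) Filter.atTop
      (nhds (stdCdf (-w) + stdCdf w)) := by
    rw [show (fun u => stdCdf (-u) + stdCdf u) = fun _ => stdCdf (-w) + stdCdf w from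
      funext fun u => hconst u w]
    exact tendsto_const_nhds
  have := tendsto_nhds_unique hlim hc
  linarith

lemma neg_mul_stdCdf_le {w : ℝ} (hw : w ≤ 0) : -w * stdCdf w ≤ stdPdf w := by
  have h := mul_one_sub_stdCdf_le (w := -w) (by linarith)
  rw [stdCdf_neg] at h
  have : stdPdf (-w) = stdPdf w := by rw [stdPdf_eq, stdPdf_eq]; simp
  rw [this] at h
  linarith

lemma one_sub_stdCdf_le {w : ℝ} (hw : 0 ≤ w) : 1 - stdCdf w ≤ 5 * stdPdf w := by
  have hp := stdPdf_pos w
  have h0 := stdCdf_nonneg w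
  have h1 := stdCdf_le_one w
  rcases le_total w 1 with h | h
  · have := one_fifth_le_stdPdf (w := w) (by rw [abs_of_nonneg hw]; exact h)
    linarith
  · have := mul_one_sub_stdCdf_le hw
    nlinarith

lemma stdCdf_le {w : ℝ} (hw : w ≤ 0) : stdCdf w ≤ 5 * stdPdf w := by
  have h := one_sub_stdCdf_le (w := -w) (by linarith)
  rw [stdCdf_neg] at h
  have : stdPdf (-w) = stdPdf w := by rw [stdPdf_eq, stdPdf_eq]; simp
  rw [this] at h
  linarith

/-! ### Stein's equation -/

/-- The solution of Stein's equation `f'(w) - w f(w) = 1(w ≤ z) - Φ(z)`. -/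
noncomputable def steinSol (z w : ℝ) : ℝ :=
  if w ≤ z then stdCdf w / stdPdf w * (1 - stdCdf z) else (1 - stdCdf w) / stdPdf w * stdCdf z

/-- The derivative of `steinSol z`, extended to the jump by Stein's equation. -/
noncomputable def steinDeriv (z w : ℝ) : ℝ :=
  w * steinSol z w + ((if w ≤ z then 1 else 0) - stdCdf z)

lemma steinSol_of_ge {z w : ℝ} (h : z ≤ w) :
    steinSol z w = (1 - stdCdf w) / stdPdf w * stdCdf z := by
  unfold steinSol
  split_ifs with h1
  · obtain rfl := le_antisymm h1 h
    ring
  · rfl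

lemma steinSol_nonneg (z w : ℝ) : 0 ≤ steinSol z w := by
  have hp := stdPdf_pos w
  have h1 := stdCdf_nonneg w
  have h2 : 0 ≤ 1 - stdCdf w := by linarith [stdCdf_le_one w]
  have h3 := stdCdf_nonneg z
  have h4 : 0 ≤ 1 - stdCdf z := by linarith [stdCdf_le_one z]
  unfold steinSol
  split_ifs <;> positivity

/-- The solution is a product of two tail probabilities over `φ(w)`. Bounding one factor by `1`
suffices, provided the tail that is kept does not contain the origin: it is then small against the
density at its endpoint, and that density is at most `φ(w)`. -/
lemma steinSol_bounds (z w : ℝ) : steinSol z w ≤ 5 ∧ |w * steinSol z w| ≤ 1 := by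
  have hp := stdPdf_pos w
  have hpz := stdPdf_pos z
  have h1 := stdCdf_nonneg w
  have h2 := stdCdf_le_one w
  have h3 := stdCdf_nonneg z
  have h4 := stdCdf_le_one z
  have hn := steinSol_nonneg z w
  rw [abs_mul, abs_of_nonneg hn]
  suffices H : ∃ b, steinSol z w ≤ b / stdPdf w ∧ b ≤ 5 * stdPdf w ∧ |w| * b ≤ stdPdf w by
    obtain ⟨b, hb, hb1, hb2⟩ := H
    constructor
    · exact hb.trans ((div_le_iff₀ hp).mpr hb1)
    · calc |w| * steinSol z w ≤ |w| * (b / stdPdf w) := by gcongr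
        _ = |w| * b / stdPdf w := by ring
        _ ≤ 1 := (div_le_one hp).mpr hb2
  rcases le_total w z with h | h
  · have hs : steinSol z w = stdCdf w * (1 - stdCdf z) / stdPdf w := by
      unfold steinSol
      rw [if_pos h]
      ring
    rcases le_total w 0 with hw | hw
    · refine ⟨stdCdf w, ?_, stdCdf_le hw, ?_⟩
      · rw [hs]
        gcongr
        nlinarith
      · rw [abs_of_nonpos hw]
        exact neg_mul_stdCdf_le hw
    · have hz : 0 ≤ z := hw.trans h
      have hpp : stdPdf z ≤ stdPdf w := stdPdf_le_of_abs_le (by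
        rw [abs_of_nonneg hw, abs_of_nonneg hz]; exact h)
      refine ⟨1 - stdCdf z, ?_, (one_sub_stdCdf_le hz).trans (by linarith), ?_⟩
      · rw [hs]
        gcongr
        nlinarith
      · rw [abs_of_nonneg hw]
        have := mul_one_sub_stdCdf_le hz
        nlinarith
  · have hs : steinSol z w = (1 - stdCdf w) * stdCdf z / stdPdf w := by
      rw [steinSol_of_ge h]
      ring
    rcases le_total 0 w with hw | hw
    · refine ⟨1 - stdCdf w, ?_, one_sub_stdCdf_le hw, ?_⟩
      · rw [hs]
        gcongr
        nlinarith
      · rw [abs_of_nonneg hw]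
        exact mul_one_sub_stdCdf_le hw
    · have hz : z ≤ 0 := h.trans hw
      have hpp : stdPdf z ≤ stdPdf w := stdPdf_le_of_abs_le (by
        rw [abs_of_nonpos hw, abs_of_nonpos hz]; linarith)
      refine ⟨stdCdf z, ?_, (stdCdf_le hz).trans (by linarith), ?_⟩
      · rw [hs]
        gcongr
        nlinarith
      · rw [abs_of_nonpos hw]
        have := neg_mul_stdCdf_le hz
        nlinarith

lemma abs_steinSol_le (z w : ℝ) : |steinSol z w| ≤ 5 := by
  rw [abs_of_nonneg (steinSol_nonneg z w)]
  exact (steinSol_bounds z w).1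

lemma abs_steinDeriv_le (z w : ℝ) : |steinDeriv z w| ≤ 2 := by
  have h := (steinSol_bounds z w).2
  have h3 := stdCdf_nonneg z
  have h4 := stdCdf_le_one z
  rw [abs_le] at h ⊢
  unfold steinDeriv
  split_ifs <;> constructor <;> linarith [h.1, h.2]

lemma hasDerivAt_steinSol_left (z w : ℝ) :
    HasDerivAt (fun w => stdCdf w / stdPdf w * (1 - stdCdf z))
      (w * (stdCdf w / stdPdf w * (1 - stdCdf z)) + (1 - stdCdf z)) w := by
  have hp := (stdPdf_pos w).ne'
  refine (((hasDerivAt_stdCdf w).div (hasDerivAt_stdPdf w) hp).mul_const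
    (1 - stdCdf z)).congr_deriv ?_
  field_simp
  ring

lemma hasDerivAt_steinSol_right (z w : ℝ) :
    HasDerivAt (fun w => (1 - stdCdf w) / stdPdf w * stdCdf z)
      (w * ((1 - stdCdf w) / stdPdf w * stdCdf z) - stdCdf z) w := by
  have hp := (stdPdf_pos w).ne'
  refine ((((hasDerivAt_stdCdf w).const_sub 1).div (hasDerivAt_stdPdf w) hp).mul_const
    (stdCdf z)).congr_deriv ?_
  field_simp
  ring

lemma hasDerivAt_steinSol {z w : ℝ} (h : w ≠ z) :
    HasDerivAt (steinSol z) (steinDeriv z w) w := by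
  rcases lt_or_gt_of_ne h with h | h
  · have := hasDerivAt_steinSol_left z w
    have he : steinSol z =ᶠ[nhds w] fun w => stdCdf w / stdPdf w * (1 - stdCdf z) := by
      filter_upwards [Iio_mem_nhds h] with u hu
      exact if_pos (le_of_lt hu)
    refine (this.congr_of_eventuallyEq he).congr_deriv ?_
    simp [steinDeriv, steinSol, h.le]
  · have := hasDerivAt_steinSol_right z w
    have he : steinSol z =ᶠ[nhds w] fun w => (1 - stdCdf w) / stdPdf w * stdCdf z := by
      filter_upwards [Ioi_mem_nhds h] with u hu
      exact if_neg (not_le.mpr hu)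
    refine (this.congr_of_eventuallyEq he).congr_deriv ?_
    simp only [steinDeriv, steinSol, not_le.mpr h, if_false]
    ring

lemma continuous_steinSol (z : ℝ) : Continuous (steinSol z) := by
  have h1 : Continuous fun w => stdCdf w / stdPdf w * (1 - stdCdf z) :=
    continuous_iff_continuousAt.mpr fun w => (hasDerivAt_steinSol_left z w).continuousAt
  have h2 : Continuous fun w => (1 - stdCdf w) / stdPdf w * stdCdf z :=
    continuous_iff_continuousAt.mpr fun w => (hasDerivAt_steinSol_right z w).continuousAt
  unfold steinSol
  refine Continuous.if_le h1 h2 continuous_id continuous_const ?_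
  rintro w rfl
  ring

lemma measurable_steinDeriv (z : ℝ) : Measurable (steinDeriv z) := by
  unfold steinDeriv
  refine (measurable_id.mul (continuous_steinSol z).measurable).add (Measurable.sub_const ?_ _)
  exact Measurable.ite measurableSet_Iic measurable_const measurable_const

/-- Off the jump, the mean value theorem holds for `steinSol z`. -/
lemma steinSol_mean_value {z v w : ℝ} (hvw : v < w) (h : z ≤ v ∨ w ≤ z) :
    ∃ ξ ∈ Set.Ioo v w, steinSol z w - steinSol z v = (w - v) * steinDeriv z ξ := by
  obtain ⟨ξ, hξ, he⟩ := exists_hasDerivAt_eq_slope (steinSol z) (steinDeriv z) hvw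
    (continuous_steinSol z).continuousOn (fun u hu => hasDerivAt_steinSol (by
      rcases h with h | h
      · exact (h.trans_lt hu.1).ne'
      · exact (hu.2.trans_le h).ne))
  refine ⟨ξ, hξ, ?_⟩
  rw [he]
  rw [mul_div_cancel₀ _ (sub_ne_zero.mpr hvw.ne')]

lemma abs_steinSol_sub_le (z v w : ℝ) : |steinSol z w - steinSol z v| ≤ 2 * |w - v| := by
  have key : ∀ v w, v ≤ w → (z ≤ v ∨ w ≤ z) → |steinSol z w - steinSol z v| ≤ 2 * (w - v) := by
    intro v w hvw h
    rcases hvw.eq_or_lt with rfl | hvw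
    · simp
    obtain ⟨ξ, -, he⟩ := steinSol_mean_value hvw h
    rw [he, abs_mul, abs_of_pos (sub_pos.mpr hvw), mul_comm]
    exact mul_le_mul_of_nonneg_right (abs_steinDeriv_le z ξ) (sub_pos.mpr hvw).le
  have key2 : ∀ v w, v ≤ w → |steinSol z w - steinSol z v| ≤ 2 * (w - v) := by
    intro v w hvw
    rcases le_total z v with h | h
    · exact key v w hvw (Or.inl h)
    rcases le_total w z with h' | h'
    · exact key v w hvw (Or.inr h')
    have h1 := key v z h (Or.inr le_rfl)
    have h2 := key z w h' (Or.inl le_rfl)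
    calc _ ≤ |steinSol z w - steinSol z z| + |steinSol z z - steinSol z v| := abs_sub_le _ _ _
      _ ≤ _ := by linarith
  rcases le_total v w with h | h
  · rw [abs_of_nonneg (sub_nonneg.mpr h)]
    exact key2 v w h
  · rw [abs_sub_comm, abs_sub_comm w, abs_of_nonneg (sub_nonneg.mpr h)]
    exact key2 w v h

/-- First-order Taylor bound for `steinSol z`, with a jump term near `z`. -/
lemma abs_steinSol_taylor_le (z w u δ : ℝ) (hu : |u| ≤ δ) :
    |steinSol z w - steinSol z (w - u) - u * steinDeriv z w|
      ≤ δ * (δ * (5 + 2 * |w|)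
        + 4 * window (z - δ) (z + δ) w) := by
  have hδ : 0 ≤ δ := (abs_nonneg u).trans hu
  have hdw := abs_steinDeriv_le z w
  -- Within `δ` of `z` the segment may cross the jump, and only the Lipschitz bound `2` and `|f'| ≤
  -- 2` are available. Elsewhere the mean value theorem applies and `f'` itself is compared at two
  -- points.
  by_cases hz : z - δ ≤ w ∧ w ≤ z + δ
  · rw [window, if_pos hz]
    have h1 := abs_steinSol_sub_le z (w - u) w
    have h2 : |u * steinDeriv z w| ≤ |u| * 2 := by rw [abs_mul]; gcongr
    calc _ ≤ |steinSol z w - steinSol z (w - u)| + |u * steinDeriv z w| := abs_sub _ _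
      _ ≤ 2 * |u| + |u| * 2 := by
        rw [sub_sub_cancel] at h1
        linarith
      _ ≤ δ * 4 := by linarith
      _ ≤ _ := by
        have : 0 ≤ δ * (5 + 2 * |w|) := by positivity
        nlinarith
  · rw [window, if_neg hz, mul_zero, add_zero]
    have hz' : z < w - δ ∨ w + δ < z := by
      by_contra hcon
      push Not at hcon
      exact hz ⟨by linarith [hcon.2], by linarith [hcon.1]⟩
    obtain ⟨hu1, hu2⟩ := abs_le.mp hu
    have hξ : ∃ ξ, |ξ - w| ≤ δ ∧ ((ξ ≤ z) ↔ (w ≤ z)) ∧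
        steinSol z w - steinSol z (w - u) = u * steinDeriv z ξ := by
      rcases lt_trichotomy u 0 with h | h | h
      · obtain ⟨ξ, hξ, he⟩ := steinSol_mean_value (z := z) (v := w) (w := w - u) (by linarith) (by
          rcases hz' with h' | h'
          · left; linarith
          · right; linarith)
        refine ⟨ξ, ?_, ?_, by linarith⟩
        · rw [abs_le]; constructor <;> linarith [hξ.1, hξ.2]
        · rcases hz' with h' | h' <;> constructor <;> intro <;> linarith [hξ.1, hξ.2]
      · subst h
        exact ⟨w, by simpa using hδ, Iff.rfl, by simp⟩
      · obtain ⟨ξ, hξ, he⟩ := steinSol_mean_value (z := z) (v := w - u) (w := w) (by linarith) (by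
          rcases hz' with h' | h'
          · left; linarith
          · right; linarith)
        refine ⟨ξ, ?_, ?_, by linarith⟩
        · rw [abs_le]; constructor <;> linarith [hξ.1, hξ.2]
        · rcases hz' with h' | h' <;> constructor <;> intro <;> linarith [hξ.1, hξ.2]
    obtain ⟨ξ, hξ1, hξ2, he⟩ := hξ
    have hdiff : |steinDeriv z ξ - steinDeriv z w| ≤ δ * (5 + 2 * |w|) := by
      -- Since `ξ` and `w` lie on the same side of `z`, the indicators in Stein's equation cancel.
      have : steinDeriv z ξ - steinDeriv z w
          = (ξ - w) * steinSol z ξ + w * (steinSol z ξ - steinSol z w) := by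
        unfold steinDeriv
        simp only [hξ2]
        ring
      rw [this]
      calc _ ≤ |(ξ - w) * steinSol z ξ| + |w * (steinSol z ξ - steinSol z w)| := abs_add_le _ _
        _ ≤ δ * 5 + |w| * (2 * δ) := by
          rw [abs_mul, abs_mul]
          gcongr
          · exact abs_steinSol_le z ξ
          · exact (abs_steinSol_sub_le z w ξ).trans (by linarith)
        _ = _ := by ring
    rw [he, ← mul_sub, abs_mul]
    gcongr

/-! ### Bounded functions measurable with respect to a sub-σ-algebra -/

section BoundedMeasurable

variable {Ω : Type*}

/-- `f` is bounded and measurable with respect to `𝓕`. -/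
structure BddMeas (𝓕 : MeasurableSpace Ω) (f : Ω → ℝ) : Prop where
  meas : Measurable[𝓕] f
  bdd : ∃ C, ∀ ω, |f ω| ≤ C

namespace BddMeas

variable {𝓕 𝓖 : MeasurableSpace Ω} {f g : Ω → ℝ}

lemma const (c : ℝ) : BddMeas 𝓕 (fun _ => c) := ⟨measurable_const, |c|, fun _ => le_rfl⟩

lemma of_le (hf : Measurable[𝓕] f) (C : ℝ) (h : ∀ ω, |f ω| ≤ C) : BddMeas 𝓕 f := ⟨hf, C, h⟩

lemma mono (h : 𝓕 ≤ 𝓖) (hf : BddMeas 𝓕 f) : BddMeas 𝓖 f := ⟨hf.meas.mono h le_rfl, hf.bdd⟩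

lemma add (hf : BddMeas 𝓕 f) (hg : BddMeas 𝓕 g) : BddMeas 𝓕 (fun ω => f ω + g ω) := by
  obtain ⟨C, hC⟩ := hf.bdd
  obtain ⟨C', hC'⟩ := hg.bdd
  exact ⟨hf.meas.add hg.meas, C + C', fun ω =>
    (abs_add_le _ _).trans (add_le_add (hC ω) (hC' ω))⟩

lemma mul (hf : BddMeas 𝓕 f) (hg : BddMeas 𝓕 g) : BddMeas 𝓕 (fun ω => f ω * g ω) := by
  obtain ⟨C, hC⟩ := hf.bdd
  obtain ⟨C', hC'⟩ := hg.bdd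
  refine ⟨hf.meas.mul hg.meas, C * C', fun ω => ?_⟩
  rw [abs_mul]
  exact mul_le_mul (hC ω) (hC' ω) (abs_nonneg _) ((abs_nonneg _).trans (hC ω))

lemma neg (hf : BddMeas 𝓕 f) : BddMeas 𝓕 (fun ω => -f ω) := by
  obtain ⟨C, hC⟩ := hf.bdd
  exact ⟨hf.meas.neg, C, fun ω => by rw [abs_neg]; exact hC ω⟩

lemma sub (hf : BddMeas 𝓕 f) (hg : BddMeas 𝓕 g) : BddMeas 𝓕 (fun ω => f ω - g ω) := by
  simpa only [sub_eq_add_neg] using hf.add hg.neg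

lemma pow (hf : BddMeas 𝓕 f) (n : ℕ) : BddMeas 𝓕 (fun ω => f ω ^ n) := by
  obtain ⟨C, hC⟩ := hf.bdd
  refine ⟨hf.meas.pow_const n, C ^ n, fun ω => ?_⟩
  rw [abs_pow]
  exact pow_le_pow_left₀ (abs_nonneg _) (hC ω) n

lemma abs (hf : BddMeas 𝓕 f) : BddMeas 𝓕 (fun ω => |f ω|) := by
  obtain ⟨C, hC⟩ := hf.bdd
  exact ⟨_root_.measurable_norm.comp hf.meas, C, fun ω => by rw [abs_abs]; exact hC ω⟩

lemma sum {ι : Type*} {s : Finset ι} {f : ι → Ω → ℝ} (hf : ∀ i ∈ s, BddMeas 𝓕 (f i)) :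
    BddMeas 𝓕 (fun ω => ∑ i ∈ s, f i ω) := by
  classical
  induction s using Finset.induction_on with
  | empty => simpa using const 0
  | insert a s ha ih =>
    simp only [Finset.sum_insert ha]
    exact (hf a (Finset.mem_insert_self a s)).add
      (ih fun i hi => hf i (Finset.mem_insert_of_mem hi))

lemma integrable [mΩ : MeasurableSpace Ω] {μ : Measure Ω} [IsFiniteMeasure μ] (hf : BddMeas mΩ f) :
    Integrable f μ := by
  obtain ⟨C, hC⟩ := hf.bdd
  exact Integrable.of_bound hf.meas.aestronglyMeasurable C (Filter.Eventually.of_forall hC)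

end BddMeas

end BoundedMeasurable

/-! ### Bounded local fields and their deterministic estimates -/

section Field

variable {ι Ω : Type*} [Fintype ι] [DecidableEq ι]

/-- The ball of radius `k m` around `i`. -/
def distBall (dist : ι → ι → ℕ) (m k : ℕ) (i : ι) : Finset ι :=
  Finset.univ.filter fun j => dist i j ≤ k * m

/-- The `σ`-algebra generated by the coordinates of `x` in `A`. -/
@[reducible] def coordSigma (x : Ω → ι → ℝ) (A : Finset ι) : MeasurableSpace Ω :=
  MeasurableSpace.comap (fun ω (i : A) => x ω i) inferInstance

/-- A finite field of random variables that is `m`-dependent for the distance `dist`, bounded by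
`D⁻¹`, where `D` bounds the size of the balls of radius `5 m`. -/
structure LocalField [MeasurableSpace Ω] (μ : Measure Ω) (x : Ω → ι → ℝ) (dist : ι → ι → ℕ)
    (m : ℕ) (D : ℝ) : Prop where
  dist_self : ∀ i, dist i i = 0
  dist_comm : ∀ i j, dist i j = dist j i
  dist_triangle : ∀ i j k, dist i k ≤ dist i j + dist j k
  one_le : 1 ≤ D
  card_ball : ∀ i, ((distBall dist m 5 i).card : ℝ) ≤ D
  meas : ∀ i, Measurable fun ω => x ω i
  abs_le : ∀ ω i, |x ω i| ≤ D⁻¹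
  indep : ∀ A B : Finset ι, (∀ i ∈ A, ∀ j ∈ B, m < dist i j) →
    Indep (coordSigma x A) (coordSigma x B) μ

/-- The sum of all coordinates. -/
def vecSum (v : ι → ℝ) : ℝ := ∑ i, v i

/-- The sum of the coordinates in the ball of radius `m` around `i`. -/
def nearSum (dist : ι → ι → ℕ) (m : ℕ) (v : ι → ℝ) (i : ι) : ℝ := ∑ j ∈ distBall dist m 1 i, v j

/-- The sum of the absolute values of the coordinates in the ball of radius `2 m` around `i`. -/
def absNear (dist : ι → ι → ℕ) (m : ℕ) (v : ι → ℝ) (i : ι) : ℝ := ∑ j ∈ distBall dist m 2 i, |v j|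

/-- The quadratic form `∑ v_i v_j` over pairs at distance at most `m`. -/
def vecQuad (dist : ι → ι → ℕ) (m : ℕ) (v : ι → ℝ) : ℝ := ∑ i, v i * nearSum dist m v i

/-- The sum of the coordinates outside the ball of radius `m` around `i`. -/
def sumOff (dist : ι → ι → ℕ) (m : ℕ) (v : ι → ℝ) (i : ι) : ℝ := ∑ j ∈ (distBall dist m 1 i)ᶜ, v j

/-- The quadratic form `vecQuad` without the coordinates in the ball of radius `m` around `i`. -/
def quadOff (dist : ι → ι → ℕ) (m : ℕ) (v : ι → ℝ) (i : ι) : ℝ :=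
  ∑ j ∈ (distBall dist m 1 i)ᶜ, v j * ∑ k ∈ distBall dist m 1 j \ distBall dist m 1 i, v k

lemma mem_distBall {dist : ι → ι → ℕ} {m k : ℕ} {i j : ι} :
    j ∈ distBall dist m k i ↔ dist i j ≤ k * m := by
  simp [distBall]

lemma distBall_mono (dist : ι → ι → ℕ) (m : ℕ) {k l : ℕ} (h : k ≤ l) (i : ι) :
    distBall dist m k i ⊆ distBall dist m l i := fun j hj => by
  rw [mem_distBall] at *
  exact hj.trans (Nat.mul_le_mul_right m h)

lemma vecSum_eq_add (dist : ι → ι → ℕ) (m : ℕ) (v : ι → ℝ) (i : ι) :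
    vecSum v = nearSum dist m v i + sumOff dist m v i :=
  (Finset.sum_add_sum_compl _ _).symm

lemma absNear_nonneg (dist : ι → ι → ℕ) (m : ℕ) (v : ι → ℝ) (i : ι) : 0 ≤ absNear dist m v i :=
  Finset.sum_nonneg fun _ _ => abs_nonneg _

lemma abs_nearSum_le (dist : ι → ι → ℕ) (m : ℕ) (v : ι → ℝ) (i : ι) :
    |nearSum dist m v i| ≤ absNear dist m v i :=
  (Finset.abs_sum_le_sum_abs _ _).trans
    (Finset.sum_le_sum_of_subset_of_nonneg (distBall_mono dist m (by norm_num) i)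
      fun _ _ _ => abs_nonneg _)

lemma coordSigma_mono (x : Ω → ι → ℝ) {A B : Finset ι} (h : A ⊆ B) :
    coordSigma x A ≤ coordSigma x B := by
  have : (fun ω (i : A) => x ω i) = (fun (w : B → ℝ) (i : A) => w ⟨i, h i.2⟩) ∘
    fun ω (i : B) => x ω i := rfl
  rw [coordSigma, coordSigma, this, ← MeasurableSpace.comap_comp]
  apply MeasurableSpace.comap_mono
  rw [← measurable_iff_comap_le]
  fun_prop

lemma measurable_coord (x : Ω → ι → ℝ) {A : Finset ι} {i : ι} (h : i ∈ A) :
    Measurable[coordSigma x A] fun ω => x ω i := by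
  have h1 : Measurable[coordSigma x A] (fun ω (i : A) => x ω i) := comap_measurable _
  exact (measurable_pi_apply (⟨i, h⟩ : A)).comp h1

namespace LocalField

variable [mΩ : MeasurableSpace Ω] {μ : Measure Ω} [IsProbabilityMeasure μ] {x : Ω → ι → ℝ}
  {dist : ι → ι → ℕ} {m : ℕ} {D : ℝ}

section Det

lemma pos (h : LocalField μ x dist m D) : 0 < D := zero_lt_one.trans_le h.one_le

lemma card_ball_le (h : LocalField μ x dist m D)
    {k : ℕ} (hk : k ≤ 5) (i : ι) : ((distBall dist m k i).card : ℝ) ≤ D :=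
  le_trans (by exact_mod_cast Finset.card_le_card (distBall_mono dist m hk i)) (h.card_ball i)

/-- This is the purpose of the level `D⁻¹`: a ball has at most `D` points, so every local sum is at
most `1`. The radius `5 m` is the reach of dependence between two functions that each live on a ball
of radius `2 m`: `2 + 1 + 2`. -/
lemma sum_ball_abs_le (h : LocalField μ x dist m D) {k : ℕ} (hk : k ≤ 5) (ω : Ω) (i : ι) :
    ∑ j ∈ distBall dist m k i, |x ω j| ≤ 1 := by
  have hD := h.pos
  calc _ ≤ ∑ _j ∈ distBall dist m k i, D⁻¹ := Finset.sum_le_sum fun j _ => h.abs_le ω j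
    _ = (distBall dist m k i).card * D⁻¹ := by rw [Finset.sum_const, nsmul_eq_mul]
    _ ≤ D * D⁻¹ := by gcongr; exact h.card_ball_le hk i
    _ = 1 := mul_inv_cancel₀ hD.ne'

lemma absNear_le_one (h : LocalField μ x dist m D)
    (ω : Ω) (i : ι) : absNear dist m (x ω) i ≤ 1 := h.sum_ball_abs_le (by norm_num) ω i

lemma mem_distBall_comm (h : LocalField μ x dist m D)
    {k : ℕ} {i j : ι} : j ∈ distBall dist m k i ↔ i ∈ distBall dist m k j := by
  rw [mem_distBall, mem_distBall, h.dist_comm]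

lemma mem_distBall_self (h : LocalField μ x dist m D)
    (k : ℕ) (i : ι) : i ∈ distBall dist m k i := by
  rw [mem_distBall, h.dist_self]
  exact Nat.zero_le _

lemma mem_distBall_trans (h : LocalField μ x dist m D)
    {k l : ℕ} {i j a : ι} (h1 : j ∈ distBall dist m k i)
    (h2 : a ∈ distBall dist m l j) : a ∈ distBall dist m (k + l) i := by
  rw [mem_distBall] at *
  have := h.dist_triangle i j a
  rw [add_mul]
  omega

lemma sum_sum_ball_comm (h : LocalField μ x dist m D) (k : ℕ) (F : ι → ι → ℝ) :
    ∑ i, ∑ j ∈ distBall dist m k i, F i j = ∑ j, ∑ i ∈ distBall dist m k j, F i j := by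
  apply Finset.sum_comm'
  intro i j
  simp [h.mem_distBall_comm (i := i) (j := j)]

lemma sum_sum_ball_le (h : LocalField μ x dist m D)
    {k : ℕ} (hk : k ≤ 5) (b : ι → ℝ) (hb : ∀ i, 0 ≤ b i) :
    ∑ i, ∑ j ∈ distBall dist m k i, b j ≤ D * ∑ i, b i := by
  rw [h.sum_sum_ball_comm k fun _ j => b j, Finset.mul_sum]
  refine Finset.sum_le_sum fun j _ => ?_
  rw [Finset.sum_const, nsmul_eq_mul]
  exact mul_le_mul_of_nonneg_right (h.card_ball_le hk j) (hb j)

/-- The deleted pairs have an index in the ball `B` of radius `m`. Their other index is within `2 m`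
of `i`, which is why `absNear` uses radius `2 m`. Pairs with first index in `B`, and pairs with only
the second index there, contribute at most `T²` each. -/
lemma abs_vecQuad_sub_quadOff_le (h : LocalField μ x dist m D) (v : ι → ℝ) (i : ι) :
    |vecQuad dist m v - quadOff dist m v i| ≤ 2 * absNear dist m v i ^ 2 := by
  set B := distBall dist m 1 i with hB
  set T := absNear dist m v i with hT
  have hT0 : 0 ≤ T := absNear_nonneg _ _ _ _
  have hBT : ∑ j ∈ B, |v j| ≤ T := Finset.sum_le_sum_of_subset_of_nonneg
    (distBall_mono dist m (by norm_num) i) fun _ _ _ => abs_nonneg _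
  have hin : ∀ j ∈ B, ∑ k ∈ distBall dist m 1 j, |v k| ≤ T := fun j hj =>
    Finset.sum_le_sum_of_subset_of_nonneg (fun k hk => h.mem_distBall_trans hj hk)
      fun _ _ _ => abs_nonneg _
  have hsplit : vecQuad dist m v - quadOff dist m v i
      = ∑ j ∈ B, v j * nearSum dist m v j
        + ∑ j ∈ Bᶜ, v j * ∑ k ∈ distBall dist m 1 j ∩ B, v k := by
    rw [vecQuad, quadOff, ← Finset.sum_add_sum_compl B]
    rw [add_sub_assoc, ← Finset.sum_sub_distrib]
    congr 1
    refine Finset.sum_congr rfl fun j _ => ?_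
    rw [← mul_sub, nearSum]
    congr 1
    rw [sub_eq_iff_eq_add, ← Finset.sum_inter_add_sum_sdiff (distBall dist m 1 j) B]
  have h1 : |∑ j ∈ B, v j * nearSum dist m v j| ≤ T * T := by
    calc _ ≤ ∑ j ∈ B, |v j| * T := by
          refine (Finset.abs_sum_le_sum_abs _ _).trans (Finset.sum_le_sum fun j hj => ?_)
          rw [abs_mul]
          gcongr
          exact (Finset.abs_sum_le_sum_abs _ _).trans (hin j hj)
      _ = (∑ j ∈ B, |v j|) * T := by rw [Finset.sum_mul]
      _ ≤ T * T := by gcongr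
  have h2 : |∑ j ∈ Bᶜ, v j * ∑ k ∈ distBall dist m 1 j ∩ B, v k| ≤ T * T := by
    calc _ ≤ ∑ j ∈ Bᶜ, ∑ k ∈ distBall dist m 1 j ∩ B, |v j| * |v k| := by
          refine (Finset.abs_sum_le_sum_abs _ _).trans (Finset.sum_le_sum fun j hj => ?_)
          rw [abs_mul, ← Finset.mul_sum]
          gcongr
          exact Finset.abs_sum_le_sum_abs _ _
      _ = ∑ k ∈ B, ∑ j ∈ distBall dist m 1 k ∩ Bᶜ, |v j| * |v k| := by
          apply Finset.sum_comm'
          intro j k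
          simp only [Finset.mem_inter, h.mem_distBall_comm (i := j) (j := k)]
          tauto
      _ ≤ ∑ k ∈ B, T * |v k| := by
          refine Finset.sum_le_sum fun k hk => ?_
          rw [← Finset.sum_mul]
          gcongr
          exact (Finset.sum_le_sum_of_subset_of_nonneg Finset.inter_subset_left
            fun _ _ _ => abs_nonneg _).trans (hin k hk)
      _ = T * ∑ k ∈ B, |v k| := by rw [Finset.mul_sum]
      _ ≤ T * T := by gcongr
  rw [hsplit]
  calc _ ≤ _ := abs_add_le _ _
    _ ≤ T * T + T * T := add_le_add h1 h2
    _ = _ := by ring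

end Det

/-! ### Independence and moment bounds for local fields -/

section Prob

lemma coordSigma_le (h : LocalField μ x dist m D) (A : Finset ι) : coordSigma x A ≤ mΩ := by
  rw [coordSigma, ← measurable_iff_comap_le]
  exact measurable_pi_lambda _ fun i => h.meas i

lemma bddMeas_coord (h : LocalField μ x dist m D) {A : Finset ι} {i : ι} (hi : i ∈ A) :
    BddMeas (coordSigma x A) fun ω => x ω i :=
  .of_le (measurable_coord x hi) D⁻¹ fun ω => h.abs_le ω i

lemma bddMeas_of_coord (h : LocalField μ x dist m D)
    {A : Finset ι} {f : Ω → ℝ} (hf : BddMeas (coordSigma x A) f) :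
    BddMeas mΩ f := hf.mono (h.coordSigma_le A)

lemma bddMeas (h : LocalField μ x dist m D) (i : ι) : BddMeas mΩ fun ω => x ω i :=
  h.bddMeas_of_coord (h.bddMeas_coord (Finset.mem_singleton_self i))

lemma bddMeas_nearSum (h : LocalField μ x dist m D)
    {A : Finset ι} {i : ι} (hA : distBall dist m 1 i ⊆ A) :
    BddMeas (coordSigma x A) fun ω => nearSum dist m (x ω) i :=
  .sum fun _ hj => h.bddMeas_coord (hA hj)

lemma bddMeas_absNear (h : LocalField μ x dist m D)
    {A : Finset ι} {i : ι} (hA : distBall dist m 2 i ⊆ A) :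
    BddMeas (coordSigma x A) fun ω => absNear dist m (x ω) i :=
  .sum fun _ hj => (h.bddMeas_coord (hA hj)).abs

lemma bddMeas_vecSum (h : LocalField μ x dist m D)
    : BddMeas mΩ fun ω => vecSum (x ω) := .sum fun j _ => h.bddMeas j

lemma bddMeas_vecQuad (h : LocalField μ x dist m D) : BddMeas mΩ fun ω => vecQuad dist m (x ω) :=
  .sum fun j _ => (h.bddMeas j).mul (.sum fun k _ => h.bddMeas k)

lemma bddMeas_sumOff (h : LocalField μ x dist m D)
    {A : Finset ι} {i : ι} (hA : (distBall dist m 1 i)ᶜ ⊆ A) :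
    BddMeas (coordSigma x A) fun ω => sumOff dist m (x ω) i :=
  .sum fun _ hj => h.bddMeas_coord (hA hj)

lemma bddMeas_quadOff (h : LocalField μ x dist m D)
    {A : Finset ι} {i : ι} (hA : (distBall dist m 1 i)ᶜ ⊆ A) :
    BddMeas (coordSigma x A) fun ω => quadOff dist m (x ω) i :=
  .sum fun _ hj => (h.bddMeas_coord (hA hj)).mul (.sum fun k hk => h.bddMeas_coord (hA (by
    rw [Finset.mem_compl]
    exact (Finset.mem_sdiff.mp hk).2)))

lemma integral_mul_of_separated (h : LocalField μ x dist m D)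
    {A B : Finset ι} (hAB : ∀ i ∈ A, ∀ j ∈ B, m < dist i j)
    {f g : Ω → ℝ} (hf : BddMeas (coordSigma x A) f) (hg : BddMeas (coordSigma x B) g) :
    ∫ ω, f ω * g ω ∂μ = (∫ ω, f ω ∂μ) * ∫ ω, g ω ∂μ := by
  have hi : IndepFun f g μ := by
    rw [IndepFun_iff_Indep]
    exact indep_of_indep_of_le_left (indep_of_indep_of_le_right (h.indep A B hAB)
      hg.meas.comap_le) hf.meas.comap_le
  exact hi.integral_fun_mul_eq_mul_integral
    (h.bddMeas_of_coord hf).meas.aestronglyMeasurable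
    (h.bddMeas_of_coord hg).meas.aestronglyMeasurable

lemma integral_abs_mul_absNear_sq_le (h : LocalField μ x dist m D) :
    ∑ i, ∫ ω, |x ω i| * absNear dist m (x ω) i ^ 2 ∂μ ≤ D ^ 2 * ∑ i, ∫ ω, |x ω i| ^ 3 ∂μ := by
  have hint : ∀ i, Integrable (fun ω => |x ω i| ^ 3) μ :=
    fun i => ((h.bddMeas i).abs.pow 3).integrable
  have hint3 : ∀ i j k, Integrable (fun ω => (|x ω i| ^ 3 + |x ω j| ^ 3 + |x ω k| ^ 3) / 3) μ :=
    fun i j k => ((((h.bddMeas i).abs.pow 3).add ((h.bddMeas j).abs.pow 3)).add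
      ((h.bddMeas k).abs.pow 3)).integrable.div_const 3
  have hpt : ∀ ω i, |x ω i| * absNear dist m (x ω) i ^ 2
      ≤ ∑ j ∈ distBall dist m 2 i, ∑ k ∈ distBall dist m 2 i,
        (|x ω i| ^ 3 + |x ω j| ^ 3 + |x ω k| ^ 3) / 3 := by
    intro ω i
    rw [absNear, sq, Finset.sum_mul_sum, Finset.mul_sum]
    refine Finset.sum_le_sum fun j _ => ?_
    rw [Finset.mul_sum]
    refine Finset.sum_le_sum fun k _ => ?_
    have ha := abs_nonneg (x ω i)
    have hb := abs_nonneg (x ω j)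
    have hc := abs_nonneg (x ω k)
    generalize |x ω i| = a at *
    generalize |x ω j| = b at *
    generalize |x ω k| = c at *
    -- This is the arithmetic-geometric mean inequality `a b c ≤ (a³ + b³ + c³) / 3`.
    nlinarith [mul_nonneg ha (sq_nonneg (b - c)), mul_nonneg hb (sq_nonneg (a - c)),
      mul_nonneg hc (sq_nonneg (b - a)), mul_nonneg (add_nonneg ha hb) (sq_nonneg (a - b)),
      mul_nonneg (add_nonneg ha hc) (sq_nonneg (a - c)),
      mul_nonneg (add_nonneg hb hc) (sq_nonneg (b - c))]
  set G : ι → ℝ := fun i => ∫ ω, |x ω i| ^ 3 ∂μ with hG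
  have hG0 : ∀ i, 0 ≤ G i := fun i => integral_nonneg fun ω => by positivity
  have hD := h.pos
  calc _ ≤ ∑ i, ∑ j ∈ distBall dist m 2 i, ∑ k ∈ distBall dist m 2 i, (G i + G j + G k) / 3 := by
        refine Finset.sum_le_sum fun i _ => ?_
        have := integral_mono (μ := μ) (f := fun ω => |x ω i| * absNear dist m (x ω) i ^ 2)
          (((h.bddMeas i).abs.mul ((h.bddMeas_of_coord
            (h.bddMeas_absNear Finset.Subset.rfl)).pow 2)).integrable)
          (integrable_finsetSum _ fun j _ => integrable_finsetSum _ fun k _ => hint3 i j k) (fun ω => hpt ω i)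
        refine this.trans (le_of_eq ?_)
        rw [integral_finsetSum _ fun j _ => integrable_finsetSum _ fun k _ =>
          hint3 i j k]
        refine Finset.sum_congr rfl fun j _ => ?_
        rw [integral_finsetSum _ fun k _ => hint3 i j k]
        refine Finset.sum_congr rfl fun k _ => ?_
        have := integral_add ((hint i).add (hint j)) (hint k)
        have h2 := integral_add (hint i) (hint j)
        simp only [Pi.add_apply] at this h2
        rw [integral_div, this, h2]
    _ ≤ ∑ i, (D * D * G i + 2 * D * ∑ j ∈ distBall dist m 2 i, G j) / 3 := by
        refine Finset.sum_le_sum fun i _ => ?_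
        have hc := h.card_ball_le (k := 2) (by norm_num) i
        have hs : 0 ≤ ∑ j ∈ distBall dist m 2 i, G j := Finset.sum_nonneg fun j _ => hG0 j
        simp only [← Finset.sum_div, Finset.sum_add_distrib, Finset.sum_const, nsmul_eq_mul,
          ← Finset.mul_sum]
        set N : ℝ := ((distBall dist m 2 i).card : ℝ)
        have hN : 0 ≤ N := Nat.cast_nonneg _
        have h1 : N * (N * G i) ≤ D * D * G i := by
          rw [← mul_assoc]
          exact mul_le_mul_of_nonneg_right (mul_le_mul hc hc hN hD.le) (hG0 i)
        have h2 := mul_le_mul_of_nonneg_right hc hs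
        linarith
    _ ≤ _ := by
        rw [← Finset.sum_div, Finset.sum_add_distrib, ← Finset.mul_sum, ← Finset.mul_sum]
        have := h.sum_sum_ball_le (k := 2) (by norm_num) G hG0
        have h3 := mul_le_mul_of_nonneg_left this hD.le
        linarith

lemma integral_abs_mul_absNear_le_sum (h : LocalField μ x dist m D) (i : ι) :
    ∫ ω, |x ω i| * absNear dist m (x ω) i ∂μ
      ≤ ∑ j ∈ distBall dist m 2 i, (∫ ω, x ω i ^ 2 ∂μ + ∫ ω, x ω j ^ 2 ∂μ) / 2 := by
  have hint : ∀ i, Integrable (fun ω => x ω i ^ 2) μ := fun i => ((h.bddMeas i).pow 2).integrable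
  have hint2 : ∀ j, Integrable (fun ω => (x ω i ^ 2 + x ω j ^ 2) / 2) μ := fun j =>
    (((h.bddMeas i).pow 2).add ((h.bddMeas j).pow 2)).integrable.div_const 2
  have := integral_mono (μ := μ) (f := fun ω => |x ω i| * absNear dist m (x ω) i)
    (g := fun ω => ∑ j ∈ distBall dist m 2 i, (x ω i ^ 2 + x ω j ^ 2) / 2)
    (((h.bddMeas i).abs.mul (h.bddMeas_of_coord
      (h.bddMeas_absNear Finset.Subset.rfl))).integrable)
    (integrable_finsetSum _ fun j _ => hint2 j) (fun ω => by
      simp only [absNear, Finset.mul_sum]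
      refine Finset.sum_le_sum fun j _ => ?_
      have := two_mul_le_add_sq |x ω i| |x ω j|
      rw [sq_abs, sq_abs] at this
      linarith)
  refine this.trans (le_of_eq ?_)
  rw [integral_finsetSum _ fun j _ => hint2 j]
  refine Finset.sum_congr rfl fun j _ => ?_
  rw [integral_div, ← integral_add (hint i) (hint j)]

lemma sum_integral_abs_mul_absNear_le (h : LocalField μ x dist m D) :
    ∑ i, ∫ ω, |x ω i| * absNear dist m (x ω) i ∂μ ≤ D * ∑ i, ∫ ω, x ω i ^ 2 ∂μ := by
  have h0 : ∀ i, 0 ≤ ∫ ω, x ω i ^ 2 ∂μ := fun i => integral_nonneg fun ω => by positivity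
  calc _ ≤ ∑ i, ∑ j ∈ distBall dist m 2 i, (∫ ω, x ω i ^ 2 ∂μ + ∫ ω, x ω j ^ 2 ∂μ) / 2 :=
        Finset.sum_le_sum fun i _ => h.integral_abs_mul_absNear_le_sum i
    _ ≤ ∑ i, (D * ∫ ω, x ω i ^ 2 ∂μ + ∑ j ∈ distBall dist m 2 i, ∫ ω, x ω j ^ 2 ∂μ) / 2 := by
        refine Finset.sum_le_sum fun i _ => ?_
        rw [← Finset.sum_div, Finset.sum_add_distrib, Finset.sum_const, nsmul_eq_mul]
        have := mul_le_mul_of_nonneg_right (h.card_ball_le (k := 2) (by norm_num) i) (h0 i)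
        linarith
    _ ≤ _ := by
        rw [← Finset.sum_div, Finset.sum_add_distrib, ← Finset.mul_sum]
        have := h.sum_sum_ball_le (k := 2) (by norm_num) _ h0
        linarith

/-- The local first-order mass in a ball is small. -/
lemma sum_ball_integral_abs_mul_absNear_le (h : LocalField μ x dist m D) {θ : ℝ} (hθ : 0 < θ)
    (hΓ : D ^ 3 * ∑ i, ∫ ω, |x ω i| ^ 3 ∂μ ≤ θ ^ 3) (i : ι) :
    ∑ j ∈ distBall dist m 5 i, ∫ ω, |x ω j| * absNear dist m (x ω) j ∂μ ≤ 2 * θ ^ 2 := by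
  have hD := h.pos
  have hG0 : ∀ i, 0 ≤ ∫ ω, |x ω i| ^ 3 ∂μ := fun i => integral_nonneg fun ω => by positivity
  have hsq : ∀ k, ∫ ω, x ω k ^ 2 ∂μ ≤ 2 * θ ^ 2 / D ^ 2 := by
    intro k
    have h1 : ∫ ω, |x ω k| ^ 3 ∂μ ≤ ∑ i, ∫ ω, |x ω i| ^ 3 ∂μ :=
      Finset.single_le_sum (f := fun i => ∫ ω, |x ω i| ^ 3 ∂μ) (fun i _ => hG0 i)
        (Finset.mem_univ k)
    -- The inequality `a² ≤ (D / θ) a³ + (θ / D)²` follows by splitting at `a = θ / D`. At this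
    -- level the hypothesis on third moments makes both terms integrate to at most `θ² / D²`.
    have h2 := integral_mono (μ := μ) (f := fun ω => x ω k ^ 2)
      (g := fun ω => D / θ * |x ω k| ^ 3 + (θ / D) ^ 2) ((h.bddMeas k).pow 2).integrable
      (((h.bddMeas k).abs.pow 3).integrable.const_mul _ |>.add (integrable_const _)) (fun ω => by
        simp only
        rw [← sq_abs]
        have ha := abs_nonneg (x ω k)
        generalize |x ω k| = a at ha ⊢
        rcases le_total a (θ / D) with hle | hle
        · have : a ^ 2 ≤ (θ / D) ^ 2 := by gcongr
          have : 0 ≤ D / θ * a ^ 3 := by positivity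
          linarith
        · have h3 : 1 ≤ D / θ * a := by
            rw [div_le_iff₀ hD] at hle
            rw [div_mul_eq_mul_div, le_div_iff₀ hθ]
            linarith
          have : 0 ≤ (θ / D) ^ 2 := by positivity
          have : a ^ 2 * 1 ≤ a ^ 2 * (D / θ * a) := by gcongr
          nlinarith)
    rw [integral_add (((h.bddMeas k).abs.pow 3).integrable.const_mul _) (integrable_const _),
      integral_const_mul, integral_const, probReal_univ, one_smul] at h2
    refine h2.trans ?_
    have h3 : D ^ 3 * ∫ ω, |x ω k| ^ 3 ∂μ ≤ θ ^ 3 := le_trans (by gcongr) hΓ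
    have h4 : D / θ * ∫ ω, |x ω k| ^ 3 ∂μ ≤ θ ^ 2 / D ^ 2 := by
      rw [le_div_iff₀ (by positivity)]
      calc _ = D ^ 3 * (∫ ω, |x ω k| ^ 3 ∂μ) / θ := by ring
        _ ≤ θ ^ 3 / θ := by gcongr
        _ = θ ^ 2 := by field_simp
    calc _ ≤ θ ^ 2 / D ^ 2 + (θ / D) ^ 2 := by gcongr
      _ = _ := by ring
  have hj : ∀ j, ∫ ω, |x ω j| * absNear dist m (x ω) j ∂μ ≤ D * (2 * θ ^ 2 / D ^ 2) := by
    intro j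
    calc _ ≤ ∑ _k ∈ distBall dist m 2 j, 2 * θ ^ 2 / D ^ 2 :=
          (h.integral_abs_mul_absNear_le_sum j).trans (Finset.sum_le_sum fun k _ => by
            linarith [hsq j, hsq k])
      _ = (distBall dist m 2 j).card * (2 * θ ^ 2 / D ^ 2) := by
          rw [Finset.sum_const, nsmul_eq_mul]
      _ ≤ _ := by gcongr; exact h.card_ball_le (by norm_num) j
  calc _ ≤ ∑ _j ∈ distBall dist m 5 i, D * (2 * θ ^ 2 / D ^ 2) := Finset.sum_le_sum fun j _ => hj j
    _ = (distBall dist m 5 i).card * (D * (2 * θ ^ 2 / D ^ 2)) := by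
        rw [Finset.sum_const, nsmul_eq_mul]
    _ ≤ D * (D * (2 * θ ^ 2 / D ^ 2)) := by gcongr; exact h.card_ball i
    _ = 2 * θ ^ 2 := by field_simp

/-- Variance bound for a sum of local functions. -/
lemma integral_sq_sum_sub_le (h : LocalField μ x dist m D) {u : ι → Ω → ℝ}
    (hu : ∀ j, BddMeas (coordSigma x (distBall dist m 2 j)) (u j)) (B : Finset ι) :
    ∫ ω, (∑ j ∈ B, u j ω - ∑ j ∈ B, ∫ ω, u j ω ∂μ) ^ 2 ∂μ ≤ D * ∑ j, ∫ ω, u j ω ^ 2 ∂μ := by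
  have hD := h.pos
  set w : ι → Ω → ℝ := fun j ω => u j ω - ∫ ω, u j ω ∂μ with hw
  have hwl : ∀ j, BddMeas (coordSigma x (distBall dist m 2 j)) (w j) := fun j =>
    (hu j).sub (.const _)
  have hwm : ∀ j, BddMeas mΩ (w j) := fun j => h.bddMeas_of_coord (hwl j)
  have hw0 : ∀ j, ∫ ω, w j ω ∂μ = 0 := fun j => by
    rw [hw]
    simp only
    rw [integral_sub (h.bddMeas_of_coord (hu j)).integrable (integrable_const _)]
    simp
  have hw2 : ∀ j, ∫ ω, w j ω ^ 2 ∂μ ≤ ∫ ω, u j ω ^ 2 ∂μ := fun j => by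
    have h1 : ∀ ω, w j ω ^ 2 = u j ω ^ 2 - 2 * (∫ ω, u j ω ∂μ) * w j ω - (∫ ω, u j ω ∂μ) ^ 2 :=
      fun ω => by simp only [hw]; ring
    simp_rw [h1]
    have hu2 : Integrable (fun ω => u j ω ^ 2) μ := ((h.bddMeas_of_coord (hu j)).pow 2).integrable
    have hwi : Integrable (fun ω => 2 * (∫ ω, u j ω ∂μ) * w j ω) μ :=
      (hwm j).integrable.const_mul _
    have hsub : Integrable (fun ω => u j ω ^ 2 - 2 * (∫ ω, u j ω ∂μ) * w j ω) μ := hu2.sub hwi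
    rw [integral_sub hsub (integrable_const _), integral_sub hu2 hwi, integral_const_mul,
      hw0]
    simp only [mul_zero, sub_zero, integral_const, probReal_univ, smul_eq_mul, one_mul]
    have := sq_nonneg (∫ ω, u j ω ∂μ)
    linarith
  have hw20 : ∀ j, 0 ≤ ∫ ω, w j ω ^ 2 ∂μ := fun j => integral_nonneg fun ω => by positivity
  -- The covariance vanishes unless the balls of radius `2 m` come within distance `m` of each
  -- other, that is, unless `k` is within `5 m` of `j`.
  have hprod : ∀ j k, ∫ ω, w j ω * w k ω ∂μ ≤ if k ∈ distBall dist m 5 j then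
      (∫ ω, w j ω ^ 2 ∂μ + ∫ ω, w k ω ^ 2 ∂μ) / 2 else 0 := by
    intro j k
    split_ifs with hk
    · rw [← integral_add ((hwm j).pow 2).integrable ((hwm k).pow 2).integrable, ← integral_div]
      refine integral_mono ((hwm j).mul (hwm k)).integrable
        ((((hwm j).pow 2).add ((hwm k).pow 2)).integrable.div_const 2) fun ω => ?_
      have := two_mul_le_add_sq (w j ω) (w k ω)
      simp only
      linarith
    · rw [h.integral_mul_of_separated ?_ (hwl j) (hwl k), hw0, zero_mul]
      intro a ha b hb
      by_contra hcon
      push Not at hcon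
      have hb' : b ∈ distBall dist m 1 a := by rw [mem_distBall]; omega
      exact hk (h.mem_distBall_trans (h.mem_distBall_trans ha hb')
        (h.mem_distBall_comm.mp hb))
  have hexp : ∀ ω, (∑ j ∈ B, u j ω - ∑ j ∈ B, ∫ ω, u j ω ∂μ) ^ 2
      = ∑ j ∈ B, ∑ k ∈ B, w j ω * w k ω := fun ω => by
    rw [← Finset.sum_sub_distrib, sq, Finset.sum_mul_sum]
  simp_rw [hexp]
  rw [integral_finsetSum _ fun j _ => integrable_finsetSum _ fun k _ =>
    ((hwm j).mul (hwm k)).integrable]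
  have hin : ∀ j, 0 ≤ ∑ k, if k ∈ distBall dist m 5 j then
      (∫ ω, w j ω ^ 2 ∂μ + ∫ ω, w k ω ^ 2 ∂μ) / 2 else 0 := fun j =>
    Finset.sum_nonneg fun k _ => by
      have := hw20 j
      have := hw20 k
      split_ifs <;> positivity
  calc _ = ∑ j ∈ B, ∑ k ∈ B, ∫ ω, w j ω * w k ω ∂μ := by
        refine Finset.sum_congr rfl fun j _ => ?_
        rw [integral_finsetSum _ fun k _ => ((hwm j).mul (hwm k)).integrable]
    _ ≤ ∑ j ∈ B, ∑ k ∈ B, if k ∈ distBall dist m 5 j then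
          (∫ ω, w j ω ^ 2 ∂μ + ∫ ω, w k ω ^ 2 ∂μ) / 2 else 0 :=
        Finset.sum_le_sum fun j _ => Finset.sum_le_sum fun k _ => hprod j k
    _ ≤ ∑ j, ∑ k, if k ∈ distBall dist m 5 j then
          (∫ ω, w j ω ^ 2 ∂μ + ∫ ω, w k ω ^ 2 ∂μ) / 2 else 0 := by
        refine (Finset.sum_le_sum fun j _ => Finset.sum_le_univ_sum_of_nonneg fun k => ?_).trans
          (Finset.sum_le_univ_sum_of_nonneg hin)
        have := hw20 j
        have := hw20 k
        split_ifs <;> positivity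
    _ = ∑ j, ∑ k ∈ distBall dist m 5 j, (∫ ω, w j ω ^ 2 ∂μ + ∫ ω, w k ω ^ 2 ∂μ) / 2 := by
        refine Finset.sum_congr rfl fun j _ => ?_
        rw [Finset.sum_ite_mem, Finset.univ_inter]
    _ ≤ ∑ j, (D * ∫ ω, w j ω ^ 2 ∂μ + ∑ k ∈ distBall dist m 5 j, ∫ ω, w k ω ^ 2 ∂μ) / 2 := by
        refine Finset.sum_le_sum fun j _ => ?_
        rw [← Finset.sum_div, Finset.sum_add_distrib, Finset.sum_const, nsmul_eq_mul]
        have := mul_le_mul_of_nonneg_right (h.card_ball j) (hw20 j)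
        linarith
    _ ≤ D * ∑ j, ∫ ω, w j ω ^ 2 ∂μ := by
        rw [← Finset.sum_div, Finset.sum_add_distrib, ← Finset.mul_sum]
        have := h.sum_sum_ball_le (k := 5) le_rfl _ hw20
        linarith
    _ ≤ _ := mul_le_mul_of_nonneg_left (Finset.sum_le_sum fun j _ => hw2 j) hD.le

/-- The general variance bound would need fourth moments; truncation supplies `D |x_j| ≤ 1`, so that
`D (x_j y_j)² ≤ |x_j| y_j²` and third moments suffice. The set `B` is arbitrary because the
concentration step uses the form away from a finite set. -/
lemma integral_sq_sum_mul_nearSum_sub_le (h : LocalField μ x dist m D) (B : Finset ι) :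
    ∫ ω, (∑ j ∈ B, x ω j * nearSum dist m (x ω) j
        - ∑ j ∈ B, ∫ ω, x ω j * nearSum dist m (x ω) j ∂μ) ^ 2 ∂μ
      ≤ D ^ 2 * ∑ i, ∫ ω, |x ω i| ^ 3 ∂μ := by
  have hD := h.pos
  refine (h.integral_sq_sum_sub_le (u := fun j ω => x ω j * nearSum dist m (x ω) j)
    (fun j => (h.bddMeas_coord (h.mem_distBall_self _ _)).mul
      (h.bddMeas_nearSum (distBall_mono dist m (by norm_num) j))) B).trans ?_
  refine le_trans ?_ h.integral_abs_mul_absNear_sq_le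
  rw [Finset.mul_sum]
  refine Finset.sum_le_sum fun j _ => ?_
  rw [← integral_const_mul]
  have hT : BddMeas mΩ fun ω => absNear dist m (x ω) j :=
    h.bddMeas_of_coord (h.bddMeas_absNear Finset.Subset.rfl)
  have hy : BddMeas mΩ fun ω => nearSum dist m (x ω) j :=
    h.bddMeas_of_coord (h.bddMeas_nearSum Finset.Subset.rfl)
  refine integral_mono ((((h.bddMeas j).mul hy).pow 2).integrable.const_mul _)
    ((h.bddMeas j).abs.mul (hT.pow 2)).integrable fun ω => ?_
  simp only
  have h1 := abs_nearSum_le dist m (x ω) j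
  have h2 : D * |x ω j| ≤ 1 := by
    calc _ ≤ D * D⁻¹ := by gcongr; exact h.abs_le ω j
      _ = 1 := mul_inv_cancel₀ hD.ne'
  calc D * (x ω j * nearSum dist m (x ω) j) ^ 2
      = (D * |x ω j|) * (|x ω j| * |nearSum dist m (x ω) j| ^ 2) := by
        rw [mul_pow, ← sq_abs (x ω j), ← sq_abs (nearSum dist m (x ω) j)]
        ring
    _ ≤ 1 * (|x ω j| * absNear dist m (x ω) j ^ 2) := by gcongr
    _ = _ := one_mul _

/-- Second moment of the total sum. -/
lemma integral_vecSum_sq_le (h : LocalField μ x dist m D) :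
    ∫ ω, vecSum (x ω) ^ 2 ∂μ ≤ ∫ ω, vecQuad dist m (x ω) ∂μ + (∑ i, |∫ ω, x ω i ∂μ|) ^ 2 := by
  have hexp : ∀ ω, vecSum (x ω) ^ 2 = vecQuad dist m (x ω)
      + ∑ j, ∑ k ∈ (distBall dist m 1 j)ᶜ, x ω j * x ω k := fun ω => by
    rw [sq, vecQuad, vecSum, Finset.sum_mul, ← Finset.sum_add_distrib]
    refine Finset.sum_congr rfl fun j _ => ?_
    rw [nearSum, ← Finset.mul_sum, ← mul_add, Finset.sum_add_sum_compl]
  simp_rw [hexp]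
  have hi : ∀ j k, Integrable (fun ω => x ω j * x ω k) μ := fun j k =>
    ((h.bddMeas j).mul (h.bddMeas k)).integrable
  rw [integral_add h.bddMeas_vecQuad.integrable (integrable_finsetSum _ fun j _ =>
    integrable_finsetSum _ fun k _ => hi j k)]
  gcongr
  rw [integral_finsetSum _ fun j _ => integrable_finsetSum _ fun k _ => hi j k, sq,
    Finset.sum_mul]
  refine Finset.sum_le_sum fun j _ => ?_
  rw [integral_finsetSum _ fun k _ => hi j k, Finset.mul_sum]
  refine le_trans (Finset.sum_le_sum fun k hk => ?_)
    (Finset.sum_le_univ_sum_of_nonneg fun k => by positivity)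
  -- Pairs farther apart than `m` leave the product of their means, which truncation may have made
  -- nonzero.
  rw [h.integral_mul_of_separated (A := {j}) (B := {k}) ?_
    (h.bddMeas_coord (Finset.mem_singleton_self j)) (h.bddMeas_coord (Finset.mem_singleton_self k)),
    ← abs_mul]
  · exact le_abs_self _
  · simp only [Finset.mem_singleton, forall_eq]
    rw [Finset.mem_compl, mem_distBall] at hk
    omega

end Prob

end LocalField

end Field

lemma measurable_window {Ω : Type*} {𝓕 : MeasurableSpace Ω} {a b w : Ω → ℝ} (ha : Measurable[𝓕] a)
    (hb : Measurable[𝓕] b) (hw : Measurable[𝓕] w) :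
    Measurable[𝓕] fun ω => window (a ω) (b ω) (w ω) := by
  unfold window
  exact Measurable.ite ((measurableSet_le ha hw).inter (measurableSet_le hw hb))
    measurable_const measurable_const

lemma abs_window_le (a b w : ℝ) : |window a b w| ≤ 1 := by
  rw [abs_of_nonneg (window_nonneg a b w)]
  exact window_le_one a b w

/-! ### Smoothed test functions for the concentration inequality -/

section Ramp

/-- A `C^{1,1}` ramp, equal to `0` on `(-∞, -η]` and to `u + η / 2` on `[0, ∞)`. -/
noncomputable def ramp (η u : ℝ) : ℝ := (max (u + η) 0 ^ 2 - max u 0 ^ 2) / (2 * η)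

/-- The derivative of `ramp η`. -/
noncomputable def rampDeriv (η u : ℝ) : ℝ := (max (u + η) 0 - max u 0) / η

variable {η : ℝ}

lemma rampDeriv_nonneg (hη : 0 < η) (u : ℝ) : 0 ≤ rampDeriv η u :=
  div_nonneg (sub_nonneg.mpr (max_le_max_right 0 (by linarith))) hη.le

lemma rampDeriv_le_one (hη : 0 < η) (u : ℝ) : rampDeriv η u ≤ 1 := by
  rw [rampDeriv, div_le_one hη]
  rcases max_cases (u + η) 0 with h1 | h1 <;> rcases max_cases u 0 with h2 | h2 <;> linarith

lemma rampDeriv_of_nonneg (hη : 0 < η) {u : ℝ} (hu : 0 ≤ u) : rampDeriv η u = 1 := by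
  rw [rampDeriv, max_eq_left hu, max_eq_left (by linarith), add_sub_cancel_left, div_self hη.ne']

lemma rampDeriv_of_le (hη : 0 < η) {u : ℝ} (hu : u ≤ -η) : rampDeriv η u = 0 := by
  rw [rampDeriv, max_eq_right (by linarith), max_eq_right (by linarith), sub_zero, zero_div]

lemma rampDeriv_mono (hη : 0 < η) {u v : ℝ} (h : u ≤ v) : rampDeriv η u ≤ rampDeriv η v := by
  unfold rampDeriv
  gcongr ?_ / _
  rcases max_cases (u + η) 0 with h1 | h1 <;> rcases max_cases u 0 with h2 | h2 <;>
  rcases max_cases (v + η) 0 with h3 | h3 <;> rcases max_cases v 0 with h4 | h4 <;> linarith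

lemma ramp_sub_bounds (hη : 0 < η)
    {a b : ℝ} (h : b ≤ a) : 0 ≤ ramp η a - ramp η b ∧ ramp η a - ramp η b ≤ a - b := by
  have h2 : (0 : ℝ) < 2 * η := by linarith
  rw [ramp, ramp, ← sub_div, div_le_iff₀ h2]
  refine ⟨div_nonneg ?_ h2.le, ?_⟩
  all_goals
    rcases le_total 0 b with hb | hb
    · rw [max_eq_left hb, max_eq_left (show 0 ≤ b + η by linarith), max_eq_left (show 0 ≤ a by linarith),
        max_eq_left (show 0 ≤ a + η by linarith)]
      nlinarith
    rw [max_eq_right hb]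
    rcases le_total 0 a with ha | ha
    · rw [max_eq_left ha, max_eq_left (show 0 ≤ a + η by linarith)]
      rcases le_total 0 (b + η) with hb' | hb'
      · rw [max_eq_left hb']
        nlinarith
      · rw [max_eq_right hb']
        nlinarith
    rw [max_eq_right ha]
    rcases le_total 0 (a + η) with ha' | ha'
    · rw [max_eq_left ha']
      rcases le_total 0 (b + η) with hb' | hb'
      · rw [max_eq_left hb']
        nlinarith
      · rw [max_eq_right hb']
        nlinarith
    · rw [max_eq_right ha', max_eq_right (show b + η ≤ 0 by linarith)]
      nlinarith

/-- The factor `min 1 (δ / η)` combines the Lipschitz bound with the second-order bound. It is what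
lets the recursion close: against a window of length `2 δ + η`, whose probability is of order `δ +
η`, the error is of order `δ²` whichever of `δ`, `η` is larger. -/
lemma abs_ramp_taylor_le (hη : 0 < η) (a u δ : ℝ) (hu : |u| ≤ δ) :
    |ramp η a - ramp η (a - u) - u * rampDeriv η a|
      ≤ δ * min 1 (δ / η) * window (-η - δ) δ a := by
  have hδ : 0 ≤ δ := (abs_nonneg u).trans hu
  obtain ⟨hu1, hu2⟩ := abs_le.mp hu
  by_cases hw : -η - δ ≤ a ∧ a ≤ δ
  · rw [window, if_pos hw, mul_one]
    have h1 : |ramp η a - ramp η (a - u) - u * rampDeriv η a| ≤ δ := by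
      have hd0 := rampDeriv_nonneg hη a
      have hd1 := rampDeriv_le_one hη a
      rcases le_total 0 u with h | h
      · have := ramp_sub_bounds hη (a := a) (b := a - u) (by linarith)
        rw [abs_le]
        constructor <;> nlinarith
      · have := ramp_sub_bounds hη (a := a - u) (b := a) (by linarith)
        rw [abs_le]
        constructor <;> nlinarith
    -- The squared positive part has derivative `2 max s 0` and a Taylor remainder in `[-u², 0]`.
    -- The ramp is a difference of two such functions over `2 η`, so these remainders partly cancel
    -- and stay within `±u²`.
    have hsq : ∀ s : ℝ, -(u ^ 2) ≤ max s 0 ^ 2 - max (s - u) 0 ^ 2 - 2 * u * max s 0 ∧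
        max s 0 ^ 2 - max (s - u) 0 ^ 2 - 2 * u * max s 0 ≤ 0 := by
      intro s
      rcases max_cases s 0 with ⟨h1, h1'⟩ | ⟨h1, h1'⟩ <;>
      rcases max_cases (s - u) 0 with ⟨h2, h2'⟩ | ⟨h2, h2'⟩ <;> rw [h1, h2] <;>
      constructor <;> nlinarith [sq_nonneg (s - u), sq_nonneg s, sq_nonneg u]
    have h2 : |ramp η a - ramp η (a - u) - u * rampDeriv η a| ≤ δ * (δ / η) := by
      have he : ramp η a - ramp η (a - u) - u * rampDeriv η a =
          ((max (a + η) 0 ^ 2 - max (a + η - u) 0 ^ 2 - 2 * u * max (a + η) 0)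
            - (max a 0 ^ 2 - max (a - u) 0 ^ 2 - 2 * u * max a 0)) / (2 * η) := by
        rw [ramp, ramp, rampDeriv, show a - u + η = a + η - u by ring]
        field_simp
        ring
      rw [he, abs_div, abs_of_pos (show 0 < 2 * η by linarith), mul_div_assoc', div_le_div_iff₀
        (by linarith) hη]
      have hA := hsq (a + η)
      have hB := hsq a
      have hu3 : u ^ 2 ≤ δ * δ := by nlinarith
      have : |(max (a + η) 0 ^ 2 - max (a + η - u) 0 ^ 2 - 2 * u * max (a + η) 0)
            - (max a 0 ^ 2 - max (a - u) 0 ^ 2 - 2 * u * max a 0)| ≤ δ * δ := by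
        rw [abs_le]
        constructor <;> linarith [hA.1, hA.2, hB.1, hB.2]
      nlinarith [mul_nonneg hδ hδ, mul_nonneg (mul_nonneg hδ hδ) hη.le]
    rcases min_choice 1 (δ / η) with h | h <;> rw [h]
    · linarith
    · exact h2
  · rw [window, if_neg hw, mul_zero]
    have hcase : a < -η - δ ∨ δ < a := by
      by_contra hcon
      push Not at hcon
      exact hw hcon
    refine le_of_eq ?_
    rw [abs_eq_zero]
    rcases hcase with hc | hc
    · rw [ramp, ramp, rampDeriv, max_eq_right (show a + η ≤ 0 by linarith),
        max_eq_right (show a ≤ 0 by linarith), max_eq_right (show a - u + η ≤ 0 by linarith),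
        max_eq_right (show a - u ≤ 0 by linarith)]
      simp
    · rw [ramp, ramp, rampDeriv, max_eq_left (show 0 ≤ a + η by linarith),
        max_eq_left (show 0 ≤ a by linarith), max_eq_left (show 0 ≤ a - u + η by linarith),
        max_eq_left (show 0 ≤ a - u by linarith)]
      field_simp
      ring

lemma continuous_ramp (η : ℝ) : Continuous (ramp η) := by
  unfold ramp
  fun_prop

/-- A nondecreasing function whose derivative is a trapezoid above `[Z, Z + R]`. -/
noncomputable def doubleRamp (η Z R w : ℝ) : ℝ := ramp η (w - Z) - ramp η (w - Z - (R + η))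

/-- The derivative of `doubleRamp`. -/
noncomputable def doubleRampDeriv (η Z R w : ℝ) : ℝ :=
  rampDeriv η (w - Z) - rampDeriv η (w - Z - (R + η))

lemma doubleRamp_bounds (hη : 0 < η) {R : ℝ} (hR : 0 ≤ R) (Z w : ℝ) :
    0 ≤ doubleRamp η Z R w ∧ doubleRamp η Z R w ≤ R + η := by
  have := ramp_sub_bounds hη (a := w - Z) (b := w - Z - (R + η)) (by linarith)
  unfold doubleRamp
  constructor <;> linarith [this.1, this.2]

/-- The two ramps have slopes between `0` and `1`, so their difference is still `1`-Lipschitz. -/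
lemma abs_doubleRamp_sub_le (hη : 0 < η) (Z R v w : ℝ) :
    |doubleRamp η Z R w - doubleRamp η Z R v| ≤ |w - v| := by
  have key : ∀ v w, v ≤ w → |doubleRamp η Z R w - doubleRamp η Z R v| ≤ w - v := by
    intro v w h
    have h1 := ramp_sub_bounds hη (a := w - Z) (b := v - Z) (by linarith)
    have h2 := ramp_sub_bounds hη (a := w - Z - (R + η)) (b := v - Z - (R + η)) (by linarith)
    unfold doubleRamp
    rw [abs_le]
    constructor <;> linarith [h1.1, h1.2, h2.1, h2.2]
  rcases le_total v w with h | h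
  · rw [abs_of_nonneg (sub_nonneg.mpr h)]
    exact key v w h
  · rw [abs_sub_comm, abs_sub_comm w, abs_of_nonneg (sub_nonneg.mpr h)]
    exact key w v h

lemma doubleRampDeriv_le_one (hη : 0 < η) (Z R w : ℝ) : doubleRampDeriv η Z R w ≤ 1 := by
  have h1 := rampDeriv_le_one hη (w - Z)
  have h2 := rampDeriv_nonneg hη (w - Z - (R + η))
  unfold doubleRampDeriv
  linarith

lemma window_le_doubleRampDeriv (hη : 0 < η) {R : ℝ} (hR : 0 ≤ R) (Z w : ℝ) :
    window Z (Z + R) w ≤ doubleRampDeriv η Z R w := by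
  unfold window doubleRampDeriv
  split_ifs with h
  · rw [rampDeriv_of_nonneg hη (by linarith [h.1]), rampDeriv_of_le hη (by linarith [h.2])]
    norm_num
  · exact sub_nonneg.mpr (rampDeriv_mono hη (by linarith))

lemma abs_doubleRamp_taylor_le (hη : 0 < η) (Z R w u δ : ℝ) (hu : |u| ≤ δ) :
    |doubleRamp η Z R w - doubleRamp η Z R (w - u) - u * doubleRampDeriv η Z R w|
      ≤ δ * min 1 (δ / η) * (window (Z - η - δ) (Z - η - δ + (2 * δ + η)) w
        + window (Z + R - δ) (Z + R - δ + (2 * δ + η)) w) := by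
  have h1 := abs_ramp_taylor_le hη (w - Z) u δ hu
  have h2 := abs_ramp_taylor_le hη (w - Z - (R + η)) u δ hu
  have e1 : window (-η - δ) δ (w - Z) = window (Z - η - δ) (Z - η - δ + (2 * δ + η)) w := by
    unfold window
    congr 1
    apply propext
    constructor <;> rintro ⟨ha, hb⟩ <;> constructor <;> linarith
  have e2 : window (-η - δ) δ (w - Z - (R + η))
      = window (Z + R - δ) (Z + R - δ + (2 * δ + η)) w := by
    unfold window
    congr 1
    apply propext
    constructor <;> rintro ⟨ha, hb⟩ <;> constructor <;> linarith
  rw [e1] at h1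
  rw [e2] at h2
  have : doubleRamp η Z R w - doubleRamp η Z R (w - u) - u * doubleRampDeriv η Z R w
      = (ramp η (w - Z) - ramp η (w - Z - u) - u * rampDeriv η (w - Z))
        - (ramp η (w - Z - (R + η)) - ramp η (w - Z - (R + η) - u)
          - u * rampDeriv η (w - Z - (R + η))) := by
    unfold doubleRamp doubleRampDeriv
    rw [show w - u - Z = w - Z - u by ring, show w - Z - u - (R + η) = w - Z - (R + η) - u by ring]
    ring
  rw [this, mul_add]
  exact (abs_sub _ _).trans (add_le_add h1 h2)

end Ramp

/-! ### The truncated normalizer -/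

section InvRoot

/-- `(q + c)^(-1/2)`, with `q + c` truncated to `[1/2, 2]`. -/
noncomputable def invRoot (c q : ℝ) : ℝ := (Real.sqrt (max (1 / 2) (min (q + c) 2)))⁻¹

lemma clip_bounds (c q : ℝ) :
    1 / 2 ≤ max (1 / 2) (min (q + c) 2) ∧ max (1 / 2) (min (q + c) 2) ≤ 2 :=
  ⟨le_max_left _ _, max_le (by norm_num) (min_le_right _ _)⟩

lemma invRoot_sq (c q : ℝ) : invRoot c q ^ 2 = (max (1 / 2) (min (q + c) 2))⁻¹ := by
  rw [invRoot, inv_pow, Real.sq_sqrt (by linarith [(clip_bounds c q).1])]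

lemma invRoot_pos (c q : ℝ) : 0 < invRoot c q := by
  have := (clip_bounds c q).1
  exact inv_pos.mpr (Real.sqrt_pos.mpr (by linarith))

lemma half_le_invRoot_sq (c q : ℝ) : 1 / 2 ≤ invRoot c q ^ 2 := by
  have := clip_bounds c q
  have h2 := inv_anti₀ (by linarith) this.2
  rw [invRoot_sq]
  linarith

lemma invRoot_sq_le (c q : ℝ) : invRoot c q ^ 2 ≤ 2 := by
  have := clip_bounds c q
  rw [invRoot_sq, inv_le_comm₀ (by linarith) (by norm_num)]
  linarith

lemma invRoot_le (c q : ℝ) : invRoot c q ≤ 2 := by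
  have := invRoot_sq_le c q
  have := invRoot_pos c q
  nlinarith

lemma abs_invRoot_le (c q : ℝ) : |invRoot c q| ≤ 2 :=
  (abs_of_pos (invRoot_pos c q)).trans_le (invRoot_le c q)

/-- With `a`, `b` the clipped arguments and `s`, `t` the inverse roots, `s² a = t² b = 1` gives `(s
- t)(s + t) = s² t² (b - a)`. Here `s t ≤ 2` and `s t ≤ s + t`, and clipping does not increase
distances. -/
lemma abs_invRoot_sub_le (c p q : ℝ) : |invRoot c p - invRoot c q| ≤ 2 * |p - q| := by
  have hp := clip_bounds c p
  have hq := clip_bounds c q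
  have hlip : |max (1 / 2) (min (p + c) 2) - max (1 / 2) (min (q + c) 2)| ≤ |p - q| := by
    refine (abs_max_sub_max_le_max _ _ _ _).trans ?_
    rw [sub_self, abs_zero, max_eq_right (abs_nonneg _)]
    refine (abs_min_sub_min_le_max _ _ _ _).trans ?_
    rw [sub_self, abs_zero, max_eq_left (abs_nonneg _), add_sub_add_right_eq_sub]
  have gp := invRoot_pos c p
  have gq := invRoot_pos c q
  have gp2 := invRoot_sq_le c p
  have gq2 := invRoot_sq_le c q
  have gp1 := half_le_invRoot_sq c p
  have gq1 := half_le_invRoot_sq c q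
  have ep : invRoot c p ^ 2 * max (1 / 2) (min (p + c) 2) = 1 := by
    rw [invRoot_sq, inv_mul_cancel₀ (by linarith)]
  have eq : invRoot c q ^ 2 * max (1 / 2) (min (q + c) 2) = 1 := by
    rw [invRoot_sq, inv_mul_cancel₀ (by linarith)]
  set a := max (1 / 2) (min (p + c) 2)
  set b := max (1 / 2) (min (q + c) 2)
  set s := invRoot c p
  set t := invRoot c q
  have hs : 1 / 2 ≤ s := by nlinarith
  have ht : 1 / 2 ≤ t := by nlinarith
  have h1 : (s - t) * (s + t) = s ^ 2 * t ^ 2 * (b - a) := by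
    linear_combination (-s ^ 2) * eq + t ^ 2 * ep
  have h2 : |s - t| * (s + t) = s ^ 2 * t ^ 2 * |a - b| := by
    rw [abs_sub_comm a b, ← abs_of_pos (show 0 < s + t by linarith), ← abs_mul,
      ← abs_of_pos (show 0 < s ^ 2 * t ^ 2 by positivity), ← abs_mul, h1]
  have h3 : s ^ 2 * t ^ 2 ≤ 2 * (s + t) := by
    have h4 : s * t ≤ 2 := by nlinarith [sq_nonneg (s - t)]
    have h5 : s * t ≤ s + t := by nlinarith [mul_pos gp gq, sq_nonneg (s - t)]
    nlinarith [mul_pos gp gq]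
  have h6 : |s - t| * (s + t) ≤ 2 * |a - b| * (s + t) := by
    rw [h2]
    nlinarith [abs_nonneg (a - b)]
  have h7 := le_of_mul_le_mul_right h6 (by linarith)
  linarith

lemma continuous_invRoot (c : ℝ) : Continuous (invRoot c) := by
  unfold invRoot
  refine Continuous.inv₀ (by fun_prop) fun q => ?_
  have := (clip_bounds c q).1
  exact (Real.sqrt_pos.mpr (by linarith)).ne'

end InvRoot

/-! ### Leave-one-neighbourhood-out expansion and conditional moments -/

section Field

variable {ι Ω : Type*} [Fintype ι] [DecidableEq ι]

/-- The self-normalized sum, with the truncated normalizer `invRoot c`. -/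
noncomputable def normSum (dist : ι → ι → ℕ) (m : ℕ) (c : ℝ) (v : ι → ℝ) : ℝ :=
  vecSum v * invRoot c (vecQuad dist m v)

/-- The normalized sum without the coordinates in the ball of radius `m` around `i`. -/
noncomputable def normSumOff (dist : ι → ι → ℕ) (m : ℕ) (c : ℝ) (v : ι → ℝ) (i : ι) : ℝ :=
  sumOff dist m v i * invRoot c (quadOff dist m v i)

/-- The union of the balls of radius `k m` around the points of `I`. -/
def ballUnion (dist : ι → ι → ℕ) (m k : ℕ) (I : Finset ι) : Finset ι := I.biUnion (distBall dist m k)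

lemma mem_ballUnion {dist : ι → ι → ℕ} {m k : ℕ} {I : Finset ι} {j : ι} :
    j ∈ ballUnion dist m k I ↔ ∃ i ∈ I, j ∈ distBall dist m k i := by
  simp [ballUnion]

lemma sum_ballUnion_le (dist : ι → ι → ℕ) (m k : ℕ) (I : Finset ι) (b : ι → ℝ)
    (hb : ∀ i, 0 ≤ b i) :
    ∑ j ∈ ballUnion dist m k I, b j ≤ ∑ i ∈ I, ∑ j ∈ distBall dist m k i, b j := by
  unfold ballUnion
  induction I using Finset.induction_on with
  | empty => simp
  | insert a s ha ih =>
    rw [Finset.biUnion_insert, Finset.sum_insert ha]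
    refine le_trans ?_ (add_le_add_right ih _)
    rw [← Finset.sum_union_inter]
    exact le_add_of_nonneg_right (Finset.sum_nonneg fun i _ => hb i)

/-- A concentration inequality for `W`, conditional on the coordinates near `I`. -/
def ConcBound [MeasurableSpace Ω] (μ : Measure Ω) (x : Ω → ι → ℝ) (dist : ι → ι → ℕ) (m : ℕ)
    (W : Ω → ℝ) (η k : ℝ) (I : Finset ι) : Prop :=
  ∀ ζ Z R : Ω → ℝ, BddMeas (coordSigma x (ballUnion dist m 2 I)) ζ → (∀ ω, 0 ≤ ζ ω) →
    Measurable[coordSigma x (ballUnion dist m 2 I)] Z →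
    BddMeas (coordSigma x (ballUnion dist m 2 I)) R → (∀ ω, 0 ≤ R ω) →
    ∫ ω, ζ ω * window (Z ω) (Z ω + R ω) (W ω) ∂μ ≤ k * ∫ ω, ζ ω * (R ω + η) ∂μ

namespace LocalField

variable [mΩ : MeasurableSpace Ω] {μ : Measure Ω} [IsProbabilityMeasure μ] {x : Ω → ι → ℝ}
  {dist : ι → ι → ℕ} {m : ℕ} {D : ℝ}

/-- The deleted near sum is at most `1`, so remainders can be stated with the full sum `S` only,
whose conditional moments are available. -/
lemma abs_sumOff_le (h : LocalField μ x dist m D)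
    (ω : Ω) (i : ι) : |sumOff dist m (x ω) i| ≤ |vecSum (x ω)| + 1 := by
  have h1 := vecSum_eq_add dist m (x ω) i
  have h2 := (abs_nearSum_le dist m (x ω) i).trans (h.absNear_le_one ω i)
  have h3 : sumOff dist m (x ω) i = vecSum (x ω) - nearSum dist m (x ω) i := by linarith
  rw [h3]
  exact (abs_sub _ _).trans (by linarith)

/-- Expansion of `g f(S g)` around its value without the coordinates near `i`. -/
lemma abs_expansion_le (h : LocalField μ x dist m D)
    (c : ℝ) (ω : Ω) (i : ι) (f : ℝ → ℝ) (M L φ r : ℝ) (hM : ∀ w, |f w| ≤ M)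
    (hL0 : 0 ≤ L) (hL : ∀ v w, |f w - f v| ≤ L * |w - v|)
    (hr : |f (normSum dist m c (x ω)) - f (normSum dist m c (x ω)
        - nearSum dist m (x ω) i * invRoot c (vecQuad dist m (x ω)))
        - nearSum dist m (x ω) i * invRoot c (vecQuad dist m (x ω)) * φ| ≤ r) :
    |invRoot c (vecQuad dist m (x ω)) * f (normSum dist m c (x ω))
      - invRoot c (quadOff dist m (x ω) i) * f (normSumOff dist m c (x ω) i)
      - nearSum dist m (x ω) i * invRoot c (vecQuad dist m (x ω)) ^ 2 * φ|
      ≤ absNear dist m (x ω) i ^ 2 * (4 * M + 8 * L * (|vecSum (x ω)| + 1)) + 2 * r := by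
  have hS := vecSum_eq_add dist m (x ω) i
  have hoff := h.abs_sumOff_le ω i
  have hg := abs_invRoot_sub_le c (vecQuad dist m (x ω)) (quadOff dist m (x ω) i)
  have hQ := h.abs_vecQuad_sub_quadOff_le (x ω) i
  have hg2 := invRoot_le c (vecQuad dist m (x ω))
  have hg0 := invRoot_pos c (vecQuad dist m (x ω))
  unfold normSum normSumOff at *
  have hW : vecSum (x ω) * invRoot c (vecQuad dist m (x ω))
      - nearSum dist m (x ω) i * invRoot c (vecQuad dist m (x ω))
      = sumOff dist m (x ω) i * invRoot c (vecQuad dist m (x ω)) := by rw [hS]; ring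
  rw [hW] at hr
  set g := invRoot c (vecQuad dist m (x ω))
  set g' := invRoot c (quadOff dist m (x ω) i)
  set s := vecSum (x ω)
  set s' := sumOff dist m (x ω) i
  set y := nearSum dist m (x ω) i
  set T := absNear dist m (x ω) i
  have hgg : |g - g'| ≤ 4 * T ^ 2 := by linarith
  -- Three changes are separated: the sum inside `f` at fixed normalizer, which gives the Taylor
  -- remainder `r`; the normalizer inside `f`, by the Lipschitz bound; and the prefactor, by the sup
  -- bound. The last two use `|g - g'| ≤ 4 T²`.
  have e : g * f (s * g) - g' * f (s' * g') - y * g ^ 2 * φ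
      = g * (f (s * g) - f (s' * g) - y * g * φ) + (g * (f (s' * g) - f (s' * g'))
        + (g - g') * f (s' * g')) := by ring
  rw [e]
  have h1 : |g * (f (s * g) - f (s' * g) - y * g * φ)| ≤ 2 * r := by
    rw [abs_mul, abs_of_pos hg0]
    exact mul_le_mul hg2 hr (abs_nonneg _) (by norm_num)
  have h2 : |g * (f (s' * g) - f (s' * g'))| ≤ 2 * (L * ((|s| + 1) * (4 * T ^ 2))) := by
    rw [abs_mul, abs_of_pos hg0]
    refine mul_le_mul hg2 ((hL _ _).trans ?_) (abs_nonneg _) (by norm_num)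
    rw [← mul_sub, abs_mul]
    gcongr
  have h3 : |(g - g') * f (s' * g')| ≤ 4 * T ^ 2 * M := by
    rw [abs_mul]
    exact mul_le_mul hgg (hM _) (abs_nonneg _) (by positivity)
  calc _ ≤ 2 * r + (2 * (L * ((|s| + 1) * (4 * T ^ 2))) + 4 * T ^ 2 * M) :=
        (abs_add_le _ _).trans (add_le_add h1 ((abs_add_le _ _).trans (add_le_add h2 h3)))
    _ = _ := by ring

lemma bddMeas_normSum (h : LocalField μ x dist m D)
    (c : ℝ) : BddMeas mΩ fun ω => normSum dist m c (x ω) :=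
  h.bddMeas_vecSum.mul (.of_le ((continuous_invRoot c).measurable.comp h.bddMeas_vecQuad.meas) 2
    fun _ => abs_invRoot_le _ _)

lemma bddMeas_invRoot_quadOff (h : LocalField μ x dist m D)
    (c : ℝ) {A : Finset ι} {i : ι} (hA : (distBall dist m 1 i)ᶜ ⊆ A) :
    BddMeas (coordSigma x A) fun ω => invRoot c (quadOff dist m (x ω) i) :=
  .of_le ((continuous_invRoot c).measurable.comp (h.bddMeas_quadOff hA).meas) 2 fun _ =>
    abs_invRoot_le _ _

lemma bddMeas_normSumOff (h : LocalField μ x dist m D)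
    (c : ℝ) {A : Finset ι} {i : ι} (hA : (distBall dist m 1 i)ᶜ ⊆ A) :
    BddMeas (coordSigma x A) fun ω => normSumOff dist m c (x ω) i :=
  (h.bddMeas_sumOff hA).mul (h.bddMeas_invRoot_quadOff c hA)

lemma abs_sum_ballUnion_le (h : LocalField μ x dist m D) (ω : Ω) (I : Finset ι) :
    |∑ j ∈ ballUnion dist m 5 I, x ω j| ≤ I.card := by
  calc _ ≤ ∑ j ∈ ballUnion dist m 5 I, |x ω j| := Finset.abs_sum_le_sum_abs _ _
    _ ≤ ∑ i ∈ I, ∑ j ∈ distBall dist m 5 i, |x ω j| :=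
        sum_ballUnion_le _ _ _ _ _ fun _ => abs_nonneg _
    _ ≤ ∑ _i ∈ I, 1 := Finset.sum_le_sum fun i _ => h.sum_ball_abs_le le_rfl ω i
    _ = I.card := by simp

/-- If the two sets came within `m`, then `j` would lie within `(k + 1 + l) m ≤ 5 m` of a point of
`I`. -/
lemma separated_ballUnion (h : LocalField μ x dist m D)
    {k l : ℕ} (hkl : k + l ≤ 4) {I : Finset ι} {j : ι}
    (hj : j ∉ ballUnion dist m 5 I) :
    ∀ a ∈ ballUnion dist m k I, ∀ b ∈ distBall dist m l j, m < dist a b := by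
  intro a ha b hb
  by_contra hcon
  push Not at hcon
  obtain ⟨i, hi, hai⟩ := mem_ballUnion.mp ha
  have hab : b ∈ distBall dist m 1 a := by rw [mem_distBall]; omega
  exact hj (mem_ballUnion.mpr ⟨i, hi, distBall_mono dist m (by omega) i
    (h.mem_distBall_trans (h.mem_distBall_trans hai hab) (h.mem_distBall_comm.mp hb))⟩)

/-- Conditional moment bound for the total sum, given the coordinates near `I`. -/
lemma integral_mul_abs_vecSum_le (h : LocalField μ x dist m D)
    (hS : ∫ ω, vecSum (x ω) ^ 2 ∂μ ≤ 3) (I : Finset ι) {ζ : Ω → ℝ}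
    (hζ : BddMeas (coordSigma x (ballUnion dist m 2 I)) ζ) (hζ0 : ∀ ω, 0 ≤ ζ ω) :
    ∫ ω, ζ ω * (|vecSum (x ω)| + 1) ∂μ ≤ 14 * ((I.card : ℝ) + 1) ^ 2 * ∫ ω, ζ ω ∂μ := by
  set r : ℝ := (I.card : ℝ)
  have hr : 0 ≤ r := Nat.cast_nonneg _
  set B := ballUnion dist m 5 I with hB
  set far : Ω → ℝ := fun ω => ∑ j ∈ Bᶜ, x ω j with hfar
  have hfl : BddMeas (coordSigma x Bᶜ) far := .sum fun j hj => h.bddMeas_coord hj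
  have hfm := h.bddMeas_of_coord hfl
  have hζm := h.bddMeas_of_coord hζ
  have hsplit : ∀ ω, vecSum (x ω) = ∑ j ∈ B, x ω j + far ω := fun ω =>
    (Finset.sum_add_sum_compl _ _).symm
  have hnear : ∀ ω, (∑ j ∈ B, x ω j) ^ 2 ≤ r ^ 2 := fun ω =>
    sq_le_sq.mpr (by rw [abs_of_nonneg hr]; exact h.abs_sum_ballUnion_le ω I)
  have hf2 : ∫ ω, far ω ^ 2 ∂μ ≤ 6 + 2 * r ^ 2 := by
    calc _ ≤ ∫ ω, (2 * vecSum (x ω) ^ 2 + 2 * r ^ 2) ∂μ := by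
          refine integral_mono (hfm.pow 2).integrable (((BddMeas.const 2).mul
            (h.bddMeas_vecSum.pow 2)).add (.const _)).integrable fun ω => ?_
          have := hnear ω
          have h2 := hsplit ω
          have h3 : far ω = vecSum (x ω) - ∑ j ∈ B, x ω j := by linarith
          simp only [h3]
          nlinarith [sq_nonneg (vecSum (x ω) + ∑ j ∈ B, x ω j)]
      _ = 2 * ∫ ω, vecSum (x ω) ^ 2 ∂μ + 2 * r ^ 2 := by
          rw [integral_add ((h.bddMeas_vecSum.pow 2).integrable.const_mul 2) (integrable_const _),
            integral_const_mul, integral_const, probReal_univ, one_smul]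
      _ ≤ _ := by linarith
  -- The weight sees only the `2 m`-neighbourhood of `I`, hence is independent of the sum outside
  -- the `5 m`-neighbourhood. The remaining coordinates sum to at most `|I|` in absolute value.
  have hind : ∫ ω, ζ ω * far ω ^ 2 ∂μ = (∫ ω, ζ ω ∂μ) * ∫ ω, far ω ^ 2 ∂μ := by
    refine h.integral_mul_of_separated ?_ hζ (hfl.pow 2)
    intro a ha b hb
    rw [Finset.mem_compl] at hb
    exact h.separated_ballUnion (k := 2) (l := 0) (by norm_num) hb a ha b (h.mem_distBall_self _ _)
  have hζi : 0 ≤ ∫ ω, ζ ω ∂μ := integral_nonneg hζ0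
  calc _ ≤ ∫ ω, ((2 + 2 * r ^ 2) * ζ ω + 2 * (ζ ω * far ω ^ 2)) ∂μ := by
        refine integral_mono (hζm.mul (h.bddMeas_vecSum.abs.add (.const 1))).integrable
          (((BddMeas.const _).mul hζm).add ((BddMeas.const _).mul
            (hζm.mul (hfm.pow 2)))).integrable fun ω => ?_
        have h1 := hnear ω
        have h2 := hsplit ω
        have h3 : vecSum (x ω) ^ 2 ≤ 2 * r ^ 2 + 2 * far ω ^ 2 := by
          rw [h2]
          nlinarith [sq_nonneg (∑ j ∈ B, x ω j - far ω)]
        have h4 : |vecSum (x ω)| + 1 ≤ 2 + 2 * r ^ 2 + 2 * far ω ^ 2 := by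
          rw [← sq_abs] at h3
          nlinarith [sq_nonneg (|vecSum (x ω)| - 1)]
        simp only
        calc _ ≤ ζ ω * (2 + 2 * r ^ 2 + 2 * far ω ^ 2) :=
              mul_le_mul_of_nonneg_left h4 (hζ0 ω)
          _ = _ := by ring
    _ = (2 + 2 * r ^ 2) * ∫ ω, ζ ω ∂μ + 2 * ((∫ ω, ζ ω ∂μ) * ∫ ω, far ω ^ 2 ∂μ) := by
        rw [integral_add (hζm.integrable.const_mul _)
          ((hζm.mul (hfm.pow 2)).integrable.const_mul _), integral_const_mul, integral_const_mul,
          hind]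
    _ ≤ (2 + 2 * r ^ 2) * ∫ ω, ζ ω ∂μ + 2 * ((∫ ω, ζ ω ∂μ) * (6 + 2 * r ^ 2)) := by gcongr
    _ = (14 + 6 * r ^ 2) * ∫ ω, ζ ω ∂μ := by ring
    _ ≤ _ := by
        gcongr
        nlinarith

end LocalField

end Field

/-! ### The recursion step of the concentration inequality -/

section Field

variable {ι Ω : Type*} [Fintype ι] [DecidableEq ι]

namespace LocalField

variable [mΩ : MeasurableSpace Ω] {μ : Measure Ω} [IsProbabilityMeasure μ] {x : Ω → ι → ℝ}
  {dist : ι → ι → ℕ} {m : ℕ} {D : ℝ}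

lemma bddMeas_doubleRamp (_h : LocalField μ x dist m D)
    {𝓕 : MeasurableSpace Ω} {η : ℝ} (hη : 0 < η) {Z R w : Ω → ℝ}
    (hZ : Measurable[𝓕] Z) (hR : BddMeas 𝓕 R) (hR0 : ∀ ω, 0 ≤ R ω) (hw : Measurable[𝓕] w) :
    BddMeas 𝓕 fun ω => doubleRamp η (Z ω) (R ω) (w ω) := by
  obtain ⟨C, hC⟩ := hR.bdd
  refine .of_le ?_ (C + η) fun ω => ?_
  · unfold doubleRamp
    exact ((continuous_ramp η).measurable.comp (hw.sub hZ)).sub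
      ((continuous_ramp η).measurable.comp ((hw.sub hZ).sub (hR.meas.add_const η)))
  · have := doubleRamp_bounds hη (hR0 ω) (Z ω) (w ω)
    rw [abs_of_nonneg this.1]
    linarith [this.2, le_abs_self (R ω), hC ω]

lemma distBall_subset_ballUnion_insert (_h : LocalField μ x dist m D)
    (k : ℕ) (i : ι) (I : Finset ι) :
    distBall dist m k i ⊆ ballUnion dist m k (insert i I) := fun _ hj =>
  mem_ballUnion.mpr ⟨i, Finset.mem_insert_self i I, hj⟩

lemma ballUnion_subset_insert (_h : LocalField μ x dist m D) (k : ℕ) (i : ι) (I : Finset ι) :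
    ballUnion dist m k I ⊆ ballUnion dist m k (insert i I) :=
  Finset.biUnion_subset_biUnion_of_subset_left _ (Finset.subset_insert i I)

/-- Mean of a coordinate times a function of coordinates that are far from it. -/
lemma abs_integral_coord_mul_le (h : LocalField μ x dist m D)
    {A : Finset ι} {i : ι} (hA : ∀ a ∈ A, m < dist i a) {f b : Ω → ℝ}
    (hf : BddMeas (coordSigma x A) f) (hb : Integrable b μ) (hfb : ∀ ω, |f ω| ≤ b ω) :
    |∫ ω, x ω i * f ω ∂μ| ≤ |∫ ω, x ω i ∂μ| * ∫ ω, b ω ∂μ := by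
  rw [h.integral_mul_of_separated (A := {i}) (by simpa using hA)
    (h.bddMeas_coord (Finset.mem_singleton_self i)) hf, abs_mul]
  gcongr
  exact (abs_integral_le_integral_abs).trans
    (integral_mono (h.bddMeas_of_coord hf).abs.integrable hb hfb)

lemma lt_dist_of_mem_compl (_h : LocalField μ x dist m D)
    (i : ι) : ∀ a ∈ (distBall dist m 1 i)ᶜ, m < dist i a := by
  intro a ha
  rw [Finset.mem_compl, mem_distBall] at ha
  omega

/-- The pointwise inequality behind the concentration inequality: the sum of the coordinates far
from `I`, times a trapezoidal primitive of the window, is expanded around its values without the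
neighbourhoods of single coordinates. -/
lemma window_mul_le (h : LocalField μ x dist m D)
    {η : ℝ} (hη : 0 < η) (c : ℝ) (I : Finset ι) {mean : ℝ} (hQ : 3 / 4 ≤ mean)
    (ω : Ω) {ζ : ℝ} (hζ : 0 ≤ ζ) (Z : ℝ) {R : ℝ} (hR : 0 ≤ R) :
    ζ * window Z (Z + R) (normSum dist m c (x ω))
      ≤ 4 * (8 * (ζ * (∑ j ∈ (ballUnion dist m 5 I)ᶜ, x ω j * nearSum dist m (x ω) j - mean) ^ 2)
        + (∑ j ∈ (ballUnion dist m 5 I)ᶜ,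
          (4 * ((ζ * (R + η)) * (|x ω j| * absNear dist m (x ω) j ^ 2))
          + 8 * ((ζ * (|x ω j| * absNear dist m (x ω) j ^ 2)) * (|vecSum (x ω)| + 1))
          + ζ * (|x ω j| * (4 * absNear dist m (x ω) j
            * min 1 (2 * absNear dist m (x ω) j / η)))
            * window (Z - η - 2 * absNear dist m (x ω) j)
            (Z - η - 2 * absNear dist m (x ω) j + (2 * (2 * absNear dist m (x ω) j) + η))
            (normSum dist m c (x ω))
          + ζ * (|x ω j| * (4 * absNear dist m (x ω) j
            * min 1 (2 * absNear dist m (x ω) j / η)))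
            * window (Z + R - 2 * absNear dist m (x ω) j)
            (Z + R - 2 * absNear dist m (x ω) j + (2 * (2 * absNear dist m (x ω) j) + η))
            (normSum dist m c (x ω))
          - x ω j * (ζ * (invRoot c (quadOff dist m (x ω) j)
            * doubleRamp η Z R (normSumOff dist m c (x ω) j))))
        + (2 * (ζ * (R + η) * (|vecSum (x ω)| + 1)) + 2 * (I.card : ℝ) * (ζ * (R + η))))) := by
  set B := (ballUnion dist m 5 I)ᶜ with hB
  set d := ∑ j ∈ B, x ω j * nearSum dist m (x ω) j - mean with hd
  set err : ι → ℝ := fun j => (4 * ((ζ * (R + η)) * (|x ω j| * absNear dist m (x ω) j ^ 2))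
          + 8 * ((ζ * (|x ω j| * absNear dist m (x ω) j ^ 2)) * (|vecSum (x ω)| + 1))
          + ζ * (|x ω j| * (4 * absNear dist m (x ω) j
            * min 1 (2 * absNear dist m (x ω) j / η)))
            * window (Z - η - 2 * absNear dist m (x ω) j)
            (Z - η - 2 * absNear dist m (x ω) j + (2 * (2 * absNear dist m (x ω) j) + η))
            (normSum dist m c (x ω))
          + ζ * (|x ω j| * (4 * absNear dist m (x ω) j
            * min 1 (2 * absNear dist m (x ω) j / η)))
            * window (Z + R - 2 * absNear dist m (x ω) j)
            (Z + R - 2 * absNear dist m (x ω) j + (2 * (2 * absNear dist m (x ω) j) + η))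
            (normSum dist m c (x ω))
          - x ω j * (ζ * (invRoot c (quadOff dist m (x ω) j)
            * doubleRamp η Z R (normSumOff dist m c (x ω) j)))) with herr
  set g := invRoot c (vecQuad dist m (x ω)) with hg
  set W := normSum dist m c (x ω)
  set F := doubleRamp η Z R W
  set φ := doubleRampDeriv η Z R W
  have hφw := window_le_doubleRampDeriv hη hR Z W
  have hw0 := window_nonneg Z (Z + R) W
  have hφ1 : φ ≤ 1 := doubleRampDeriv_le_one hη Z R W
  have hφ0 : 0 ≤ φ := hw0.trans hφw
  have hg2 := invRoot_sq_le c (vecQuad dist m (x ω))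
  have hg1 := half_le_invRoot_sq c (vecQuad dist m (x ω))
  have hg0 := invRoot_pos c (vecQuad dist m (x ω))
  have hgle := invRoot_le c (vecQuad dist m (x ω))
  rw [← hg] at hg2 hg1 hg0 hgle
  have hF := doubleRamp_bounds hη hR Z W
  have hterm : ∀ j ∈ B, ζ * (x ω j * nearSum dist m (x ω) j) * (g ^ 2 * φ)
      ≤ ζ * x ω j * (g * F) + err j := by
    intro j _
    have hT0 := absNear_nonneg dist m (x ω) j
    have hyT := abs_nearSum_le dist m (x ω) j
    have hu : |nearSum dist m (x ω) j * g| ≤ 2 * absNear dist m (x ω) j := by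
      rw [abs_mul, abs_of_pos hg0, mul_comm]
      exact mul_le_mul hgle hyT (abs_nonneg _) (by norm_num)
    have htay := abs_doubleRamp_taylor_le hη Z R W _ _ hu
    have hexp := h.abs_expansion_le c ω j (doubleRamp η Z R) (R + η) 1 φ _
      (fun w => by
        have := doubleRamp_bounds hη hR Z w
        rw [abs_of_nonneg this.1]
        exact this.2) zero_le_one (fun v w => by
        rw [one_mul]
        exact abs_doubleRamp_sub_le hη _ _ _ _) htay
    have h1 := mul_le_mul_of_nonneg_left hexp (mul_nonneg hζ (abs_nonneg (x ω j)))
    have hz : |ζ * x ω j| = ζ * |x ω j| := by rw [abs_mul, abs_of_nonneg hζ]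
    rw [← hz, ← abs_mul, hz] at h1
    have h2 := (neg_le_abs _).trans h1
    simp only [herr]
    linarith
  have hsumt := Finset.sum_le_sum hterm
  rw [← Finset.sum_mul, ← Finset.mul_sum, Finset.sum_add_distrib, ← Finset.sum_mul,
    ← Finset.mul_sum] at hsumt
  have hSB : |∑ j ∈ B, x ω j| ≤ |vecSum (x ω)| + 1 + (I.card : ℝ) := by
    have h1 : vecSum (x ω) = ∑ j ∈ ballUnion dist m 5 I, x ω j + ∑ j ∈ B, x ω j :=
      (Finset.sum_add_sum_compl _ _).symm
    have h2 := h.abs_sum_ballUnion_le ω I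
    have h3 : ∑ j ∈ B, x ω j = vecSum (x ω) - ∑ j ∈ ballUnion dist m 5 I, x ω j := by linarith
    rw [h3]
    exact (abs_sub _ _).trans (by linarith)
  have hup : ζ * (∑ j ∈ B, x ω j) * (g * F)
      ≤ 2 * (ζ * (R + η) * (|vecSum (x ω)| + 1)) + 2 * (I.card : ℝ) * (ζ * (R + η)) := by
    calc _ ≤ ζ * (|vecSum (x ω)| + 1 + (I.card : ℝ)) * (2 * (R + η)) := by
          refine mul_le_mul (mul_le_mul_of_nonneg_left ((le_abs_self _).trans hSB) hζ)
            (mul_le_mul hgle hF.2 hF.1 (by norm_num)) (mul_nonneg hg0.le hF.1)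
            (mul_nonneg hζ (by positivity))
      _ = _ := by ring
  -- A quadratic bound `3 / 4 + d ≥ 1 / 2 - 4 d²` replaces a case distinction on whether the form is
  -- close to its mean, so that only the variance of the form is needed afterwards.
  have hQB : 1 / 2 - 4 * d ^ 2 ≤ ∑ j ∈ B, x ω j * nearSum dist m (x ω) j := by
    have : ∑ j ∈ B, x ω j * nearSum dist m (x ω) j = mean + d := by
      rw [hd]; ring
    rw [this]
    nlinarith [sq_nonneg (4 * d + 1 / 2)]
  have hlow : 1 / 4 * window Z (Z + R) W - 8 * d ^ 2
      ≤ (∑ j ∈ B, x ω j * nearSum dist m (x ω) j) * (g ^ 2 * φ) := by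
    have h1 : (1 / 2 - 4 * d ^ 2) * (g ^ 2 * φ)
        ≤ (∑ j ∈ B, x ω j * nearSum dist m (x ω) j) * (g ^ 2 * φ) :=
      mul_le_mul_of_nonneg_right hQB (by positivity)
    -- The trapezoid dominates the window and `g² ≥ 1 / 2`; this is how the window appears on the
    -- small side of the expansion.
    have h2 : 1 / 2 * window Z (Z + R) W ≤ g ^ 2 * φ :=
      mul_le_mul hg1 hφw hw0 (by positivity)
    have h3 : g ^ 2 * φ ≤ 2 * 1 := mul_le_mul hg2 hφ1 hφ0 (by norm_num)
    nlinarith [sq_nonneg (d)]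
  have hlow' := mul_le_mul_of_nonneg_left hlow hζ
  linarith

set_option maxHeartbeats 1000000 in
/-- One step of the recursion for the conditional concentration inequality. -/
lemma concBound_step (h : LocalField μ x dist m D)
    {η k : ℝ} (hη : 0 < η) (hη1 : η ≤ 1) (hk : 0 ≤ k) (c : ℝ)
    (hS : ∫ ω, vecSum (x ω) ^ 2 ∂μ ≤ 3) (he : ∑ i, |∫ ω, x ω i ∂μ| ≤ 1)
    (hΓ : 4096 * (D ^ 2 * ∑ i, ∫ ω, |x ω i| ^ 3 ∂μ) ≤ η) (I : Finset ι)
    (hQ : 3 / 4 ≤ ∑ j ∈ (ballUnion dist m 5 I)ᶜ, ∫ ω, x ω j * nearSum dist m (x ω) j ∂μ)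
    (hrec : ∀ j ∉ ballUnion dist m 5 I,
      ConcBound μ x dist m (fun ω => normSum dist m c (x ω)) η k (insert j I)) :
    ConcBound μ x dist m (fun ω => normSum dist m c (x ω)) η
      (200 * ((I.card : ℝ) + 2) ^ 2 + k / 16) I := by
  intro ζ Z R hζ hζ0 hZ hR hR0
  set r : ℝ := (I.card : ℝ) with hr_def
  have hr : 0 ≤ r := Nat.cast_nonneg _
  set β : ℝ := D ^ 2 * ∑ i, ∫ ω, |x ω i| ^ 3 ∂μ with hβ_def
  set B := (ballUnion dist m 5 I)ᶜ with hB_def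
  set mean := ∑ j ∈ B, ∫ ω, x ω j * nearSum dist m (x ω) j ∂μ with hmean
  have hζm : BddMeas mΩ ζ := h.bddMeas_of_coord hζ
  have hH : BddMeas (coordSigma x (ballUnion dist m 2 I)) fun ω => R ω + η := hR.add (.const η)
  have hζH : BddMeas (coordSigma x (ballUnion dist m 2 I)) fun ω => ζ ω * (R ω + η) := hζ.mul hH
  have hζHm := h.bddMeas_of_coord hζH
  have hζH0 : ∀ ω, 0 ≤ ζ ω * (R ω + η) := fun ω =>
    mul_nonneg (hζ0 ω) (add_nonneg (hR0 ω) hη.le)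
  have hy : ∀ j, BddMeas mΩ fun ω => nearSum dist m (x ω) j := fun j =>
    h.bddMeas_of_coord (h.bddMeas_nearSum Finset.Subset.rfl)
  have hTl : ∀ j, BddMeas (coordSigma x (distBall dist m 2 j)) fun ω => absNear dist m (x ω) j :=
    fun j => h.bddMeas_absNear Finset.Subset.rfl
  have hT : ∀ j, BddMeas mΩ fun ω => absNear dist m (x ω) j := fun j => h.bddMeas_of_coord (hTl j)
  have hxT : ∀ j, BddMeas (coordSigma x (distBall dist m 2 j))
      fun ω => |x ω j| * absNear dist m (x ω) j ^ 2 := fun j =>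
    (h.bddMeas_coord (h.mem_distBall_self 2 j)).abs.mul ((hTl j).pow 2)
  have hxTm := fun j => h.bddMeas_of_coord (hxT j)
  have hxT0 : ∀ j, 0 ≤ ∫ ω, |x ω j| * absNear dist m (x ω) j ^ 2 ∂μ := fun j =>
    integral_nonneg fun ω => by positivity
  have hsum : ∑ j ∈ B, ∫ ω, |x ω j| * absNear dist m (x ω) j ^ 2 ∂μ ≤ β :=
    (Finset.sum_le_univ_sum_of_nonneg hxT0).trans h.integral_abs_mul_absNear_sq_le
  have hW := h.bddMeas_normSum c
  have hnotin : ∀ j ∈ B, j ∉ ballUnion dist m 5 I := fun j hj => Finset.mem_compl.mp hj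
  -- the error terms
  set d : Ω → ℝ := fun ω => ∑ j ∈ B, x ω j * nearSum dist m (x ω) j - mean with hd
  have hdl : BddMeas (coordSigma x (B.biUnion (distBall dist m 1))) d :=
    (BddMeas.sum fun j hj => (h.bddMeas_coord (Finset.mem_biUnion.mpr
      ⟨j, hj, h.mem_distBall_self 1 j⟩)).mul
      (h.bddMeas_nearSum (Finset.subset_biUnion_of_mem _ hj))).sub (.const _)
  have hdm := h.bddMeas_of_coord hdl
  -- The deviation `d` lives on the `m`-neighbourhood of `B`, still farther than `m` from the
  -- support of `ζ`, so the variance bound holds conditionally.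
  have hd2 : ∫ ω, ζ ω * d ω ^ 2 ∂μ ≤ β * ∫ ω, ζ ω ∂μ := by
    rw [h.integral_mul_of_separated ?_ hζ (hdl.pow 2), mul_comm]
    · exact mul_le_mul_of_nonneg_right (h.integral_sq_sum_mul_nearSum_sub_le B)
        (integral_nonneg hζ0)
    · intro a ha b hb
      obtain ⟨j, hj, hbj⟩ := Finset.mem_biUnion.mp hb
      exact h.separated_ballUnion (by norm_num) (hnotin j hj) a ha b hbj
  set A1 : ι → Ω → ℝ := fun j ω => (ζ ω * (R ω + η)) * (|x ω j| * absNear dist m (x ω) j ^ 2)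
    with hA1
  set A2 : ι → Ω → ℝ := fun j ω => (ζ ω * (|x ω j| * absNear dist m (x ω) j ^ 2))
    * (|vecSum (x ω)| + 1) with hA2
  -- `A3` and `A4` are the windows over the two slopes of the trapezoid. Their weight `ξ j` and
  -- endpoints depend on coordinates near `insert j I`, so the assumed bound for that larger set
  -- applies to them.
  set ξ : ι → Ω → ℝ := fun j ω => ζ ω * (|x ω j| * (4 * absNear dist m (x ω) j
    * min 1 (2 * absNear dist m (x ω) j / η))) with hξ
  set A3 : ι → Ω → ℝ := fun j ω => ξ j ω * window (Z ω - η - 2 * absNear dist m (x ω) j)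
    (Z ω - η - 2 * absNear dist m (x ω) j + (2 * (2 * absNear dist m (x ω) j) + η))
    (normSum dist m c (x ω)) with hA3
  set A4 : ι → Ω → ℝ := fun j ω => ξ j ω * window (Z ω + R ω - 2 * absNear dist m (x ω) j)
    (Z ω + R ω - 2 * absNear dist m (x ω) j + (2 * (2 * absNear dist m (x ω) j) + η))
    (normSum dist m c (x ω)) with hA4
  set E : ι → Ω → ℝ := fun j ω => ζ ω * (invRoot c (quadOff dist m (x ω) j)
    * doubleRamp η (Z ω) (R ω) (normSumOff dist m c (x ω) j)) with hE
  set A5 : ι → Ω → ℝ := fun j ω => x ω j * E j ω with hA5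
  have bA1 : ∀ j, BddMeas mΩ (A1 j) := fun j => hζHm.mul (hxTm j)
  have bA2 : ∀ j, BddMeas mΩ (A2 j) := fun j =>
    (hζm.mul (hxTm j)).mul (h.bddMeas_vecSum.abs.add (.const 1))
  have hminl : ∀ j, BddMeas (coordSigma x (distBall dist m 2 j))
      fun ω => min 1 (2 * absNear dist m (x ω) j / η) := fun j =>
    .of_le (measurable_const.min (((hTl j).meas.const_mul 2).div_const η)) 1 fun ω => by
      have : 0 ≤ 2 * absNear dist m (x ω) j / η :=
        div_nonneg (mul_nonneg (by norm_num) (absNear_nonneg _ _ _ _)) hη.le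
      rw [abs_of_nonneg (le_min zero_le_one this)]
      exact min_le_left _ _
  have hmin0 : ∀ j ω, 0 ≤ min 1 (2 * absNear dist m (x ω) j / η) := fun j ω =>
    le_min zero_le_one (div_nonneg (mul_nonneg (by norm_num) (absNear_nonneg _ _ _ _)) hη.le)
  have hins : ∀ j, coordSigma x (distBall dist m 2 j)
      ≤ coordSigma x (ballUnion dist m 2 (insert j I)) := fun j =>
    coordSigma_mono x (h.distBall_subset_ballUnion_insert 2 j I)
  have hins' : ∀ j, coordSigma x (ballUnion dist m 2 I) ≤ coordSigma x (ballUnion dist m 2 (insert j I)) := fun j =>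
    coordSigma_mono x (h.ballUnion_subset_insert 2 j I)
  have bξ : ∀ j, BddMeas (coordSigma x (ballUnion dist m 2 (insert j I))) (ξ j) := fun j =>
    (hζ.mono (hins' j)).mul (((h.bddMeas_coord (h.mem_distBall_self 2 j)).abs.mul
      (((BddMeas.const 4).mul (hTl j)).mul (hminl j))).mono (hins j))
  have hξ0 : ∀ j ω, 0 ≤ ξ j ω := fun j ω => by
    have := hmin0 j ω
    have := absNear_nonneg dist m (x ω) j
    have := hζ0 ω
    simp only [hξ]
    positivity
  have bA3 : ∀ j, BddMeas mΩ (A3 j) := fun j => by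
    have hZm := hZ.mono (h.coordSigma_le _) le_rfl
    refine (h.bddMeas_of_coord (bξ j)).mul (.of_le (measurable_window ?_ ?_ hW.meas) 1
      fun ω => abs_window_le _ _ _)
    · exact (hZm.sub_const η).sub ((hT j).meas.const_mul 2)
    · exact ((hZm.sub_const η).sub ((hT j).meas.const_mul 2)).add
        ((((hT j).meas.const_mul 2).const_mul 2).add_const η)
  have bA4 : ∀ j, BddMeas mΩ (A4 j) := fun j => by
    have hZm := hZ.mono (h.coordSigma_le _) le_rfl
    have hRm := (h.bddMeas_of_coord hR).meas
    refine (h.bddMeas_of_coord (bξ j)).mul (.of_le (measurable_window ?_ ?_ hW.meas) 1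
      fun ω => abs_window_le _ _ _)
    · exact (hZm.add hRm).sub ((hT j).meas.const_mul 2)
    · exact ((hZm.add hRm).sub ((hT j).meas.const_mul 2)).add
        ((((hT j).meas.const_mul 2).const_mul 2).add_const η)
  have bE : ∀ j, BddMeas (coordSigma x (ballUnion dist m 2 I ∪ (distBall dist m 1 j)ᶜ)) (E j) :=
    fun j => by
      have hm1 : coordSigma x (ballUnion dist m 2 I)
          ≤ coordSigma x (ballUnion dist m 2 I ∪ (distBall dist m 1 j)ᶜ) :=
        coordSigma_mono x Finset.subset_union_left
      exact (hζ.mono hm1).mul ((h.bddMeas_invRoot_quadOff c Finset.subset_union_right).mul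
        (h.bddMeas_doubleRamp hη (hZ.mono hm1 le_rfl) (hR.mono hm1) hR0
          (h.bddMeas_normSumOff c Finset.subset_union_right).meas))
  have bA5 : ∀ j, BddMeas mΩ (A5 j) := fun j => (h.bddMeas j).mul (h.bddMeas_of_coord (bE j))
  -- their integrals
  have iA1 : ∀ j ∈ B, ∫ ω, A1 j ω ∂μ
      = (∫ ω, ζ ω * (R ω + η) ∂μ) * ∫ ω, |x ω j| * absNear dist m (x ω) j ^ 2 ∂μ := fun j hj =>
    h.integral_mul_of_separated (h.separated_ballUnion (by norm_num) (hnotin j hj)) hζH (hxT j)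
  have iζ : ∀ j ∈ B, ∫ ω, ζ ω * (|x ω j| * absNear dist m (x ω) j ^ 2) ∂μ
      = (∫ ω, ζ ω ∂μ) * ∫ ω, |x ω j| * absNear dist m (x ω) j ^ 2 ∂μ := fun j hj =>
    h.integral_mul_of_separated (h.separated_ballUnion (by norm_num) (hnotin j hj)) hζ (hxT j)
  have iA2 : ∀ j ∈ B, ∫ ω, A2 j ω ∂μ ≤ 14 * (r + 2) ^ 2
      * ((∫ ω, ζ ω ∂μ) * ∫ ω, |x ω j| * absNear dist m (x ω) j ^ 2 ∂μ) := fun j hj => by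
    have h1 := h.integral_mul_abs_vecSum_le hS (insert j I)
      (ζ := fun ω => ζ ω * (|x ω j| * absNear dist m (x ω) j ^ 2))
      ((hζ.mono (hins' j)).mul ((hxT j).mono (hins j)))
      (fun ω => mul_nonneg (hζ0 ω) (by positivity))
    rw [iζ j hj] at h1
    refine h1.trans ?_
    have h2 : ((insert j I).card : ℝ) ≤ r + 1 := by
      rw [hr_def]
      exact_mod_cast Finset.card_insert_le j I
    have h3 : 0 ≤ (∫ ω, ζ ω ∂μ) * ∫ ω, |x ω j| * absNear dist m (x ω) j ^ 2 ∂μ :=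
      mul_nonneg (integral_nonneg hζ0) (hxT0 j)
    have h4 : ((insert j I).card : ℝ) + 1 ≤ r + 2 := by linarith
    gcongr
  have hξint : ∀ j ∈ B, ∫ ω, ξ j ω * ((2 * (2 * absNear dist m (x ω) j) + η) + η) ∂μ
      ≤ 32 * ((∫ ω, ζ ω ∂μ) * ∫ ω, |x ω j| * absNear dist m (x ω) j ^ 2 ∂μ) := fun j hj => by
    rw [← iζ j hj, ← integral_const_mul]
    refine integral_mono ((h.bddMeas_of_coord (bξ j)).mul ((((BddMeas.const 2).mul
      ((BddMeas.const 2).mul (hT j))).add (.const η)).add (.const η))).integrable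
      ((BddMeas.const 32).mul (hζm.mul (hxTm j))).integrable fun ω => ?_
    have hT0 := absNear_nonneg dist m (x ω) j
    simp only [hξ]
    set T := absNear dist m (x ω) j
    -- For `2 T ≤ η` the factor `2 T / η` absorbs `η`; otherwise `η ≤ 2 T` and the factor `1` is
    -- enough.
    have key : 4 * T * min 1 (2 * T / η) * ((2 * (2 * T) + η) + η) ≤ 32 * T ^ 2 := by
      rcases le_total (2 * T) η with hle | hle
      · calc _ ≤ 4 * T * (2 * T / η) * ((2 * η + η) + η) := by
              gcongr
              exact min_le_right _ _
          _ = 32 * T ^ 2 := by field_simp; ring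
      · calc _ ≤ 4 * T * 1 * ((2 * (2 * T) + 2 * T) + 2 * T) := by
              gcongr
              exact min_le_left _ _
          _ = 32 * T ^ 2 := by ring
    calc _ = ζ ω * |x ω j| * (4 * T * min 1 (2 * T / η) * ((2 * (2 * T) + η) + η)) := by ring
      _ ≤ ζ ω * |x ω j| * (32 * T ^ 2) :=
          mul_le_mul_of_nonneg_left key (mul_nonneg (hζ0 ω) (abs_nonneg _))
      _ = _ := by ring
  have hRl : ∀ j, BddMeas (coordSigma x (ballUnion dist m 2 (insert j I)))
      fun ω => 2 * (2 * absNear dist m (x ω) j) + η := fun j =>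
    ((BddMeas.const 2).mul ((BddMeas.const 2).mul ((hTl j).mono (hins j)))).add (.const η)
  have hRl0 : ∀ j ω, 0 ≤ 2 * (2 * absNear dist m (x ω) j) + η := fun j ω => by
    have := absNear_nonneg dist m (x ω) j
    positivity
  have iA3 : ∀ j ∈ B, ∫ ω, A3 j ω ∂μ
      ≤ k * (32 * ((∫ ω, ζ ω ∂μ) * ∫ ω, |x ω j| * absNear dist m (x ω) j ^ 2 ∂μ)) := fun j hj =>
    (hrec j (hnotin j hj) (ξ j) (fun ω => Z ω - η - 2 * absNear dist m (x ω) j) _ (bξ j) (hξ0 j)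
      (((hZ.mono (hins' j) le_rfl).sub_const η).sub
        (((hTl j).mono (hins j)).meas.const_mul 2)) (hRl j) (hRl0 j)).trans
      (mul_le_mul_of_nonneg_left (hξint j hj) hk)
  have iA4 : ∀ j ∈ B, ∫ ω, A4 j ω ∂μ
      ≤ k * (32 * ((∫ ω, ζ ω ∂μ) * ∫ ω, |x ω j| * absNear dist m (x ω) j ^ 2 ∂μ)) := fun j hj =>
    (hrec j (hnotin j hj) (ξ j) (fun ω => Z ω + R ω - 2 * absNear dist m (x ω) j) _ (bξ j) (hξ0 j)
      (((hZ.mono (hins' j) le_rfl).add (hR.mono (hins' j)).meas).sub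
        (((hTl j).mono (hins j)).meas.const_mul 2)) (hRl j) (hRl0 j)).trans
      (mul_le_mul_of_nonneg_left (hξint j hj) hk)
  have iA5 : ∀ j ∈ B, -∫ ω, A5 j ω ∂μ
      ≤ |∫ ω, x ω j ∂μ| * (2 * ∫ ω, ζ ω * (R ω + η) ∂μ) := fun j hj => by
    rw [← integral_const_mul]
    refine (neg_le_abs _).trans (h.abs_integral_coord_mul_le ?_ (bE j)
      ((BddMeas.const 2).mul hζHm).integrable fun ω => ?_)
    -- The function `E j` avoids everything within `m` of `j`: the coordinates near `I` because `j`
    -- is outside the `5 m`-neighbourhood, the others by deletion. Only the mean of `x_j` remains.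
    · intro a ha
      rcases Finset.mem_union.mp ha with ha | ha
      · rw [h.dist_comm]
        exact h.separated_ballUnion (k := 2) (l := 0) (by norm_num) (hnotin j hj) a ha j
          (h.mem_distBall_self _ _)
      · exact h.lt_dist_of_mem_compl j a ha
    · have h1 := doubleRamp_bounds hη (hR0 ω) (Z ω) (normSumOff dist m c (x ω) j)
      have h2 := invRoot_pos c (quadOff dist m (x ω) j)
      have h3 := invRoot_le c (quadOff dist m (x ω) j)
      have h4 := hζ0 ω
      rw [abs_of_nonneg (mul_nonneg h4 (mul_nonneg h2.le h1.1))]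
      calc _ ≤ ζ ω * (2 * (R ω + η)) := mul_le_mul_of_nonneg_left
            (mul_le_mul h3 h1.2 h1.1 (by norm_num)) h4
        _ = _ := by ring
  have iS := h.integral_mul_abs_vecSum_le hS I hζH hζH0
  have hpt : ∀ ω, ζ ω * window (Z ω) (Z ω + R ω) (normSum dist m c (x ω))
      ≤ 4 * (8 * (ζ ω * d ω ^ 2)
        + (∑ j ∈ B, (4 * A1 j ω + 8 * A2 j ω + A3 j ω + A4 j ω - A5 j ω)
        + (2 * (ζ ω * (R ω + η) * (|vecSum (x ω)| + 1)) + 2 * r * (ζ ω * (R ω + η))))) := fun ω =>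
    h.window_mul_le hη c I hQ ω (hζ0 ω) (Z ω) (hR0 ω)
  have bsum : BddMeas mΩ fun ω =>
      ∑ j ∈ B, (4 * A1 j ω + 8 * A2 j ω + A3 j ω + A4 j ω - A5 j ω) :=
    .sum fun j _ => (((((BddMeas.const 4).mul (bA1 j)).add ((BddMeas.const 8).mul (bA2 j))).add
      (bA3 j)).add (bA4 j)).sub (bA5 j)
  have bSζ : BddMeas mΩ fun ω => ζ ω * (R ω + η) * (|vecSum (x ω)| + 1) :=
    hζHm.mul (h.bddMeas_vecSum.abs.add (.const 1))
  have bwin : BddMeas mΩ fun ω => window (Z ω) (Z ω + R ω) (normSum dist m c (x ω)) := by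
    have hZm := hZ.mono (h.coordSigma_le _) le_rfl
    exact .of_le (measurable_window hZm (hZm.add (h.bddMeas_of_coord hR).meas) hW.meas) 1
      fun ω => abs_window_le _ _ _
  have hmain := integral_mono (hζm.mul bwin).integrable ((BddMeas.const 4).mul
    (((BddMeas.const 8).mul (hζm.mul (hdm.pow 2))).add (bsum.add (((BddMeas.const 2).mul bSζ).add
      ((BddMeas.const (2 * r)).mul hζHm))))).integrable hpt (μ := μ)
  rw [integral_const_mul, integral_add ((BddMeas.const 8).mul (hζm.mul (hdm.pow 2))).integrable
    (bsum.add (((BddMeas.const 2).mul bSζ).add ((BddMeas.const (2 * r)).mul hζHm))).integrable,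
    integral_add bsum.integrable
      (((BddMeas.const 2).mul bSζ).add ((BddMeas.const (2 * r)).mul hζHm)).integrable,
    integral_add ((BddMeas.const 2).mul bSζ).integrable
      ((BddMeas.const (2 * r)).mul hζHm).integrable,
    integral_const_mul, integral_const_mul, integral_const_mul,
    integral_finsetSum _ fun j _ => ((((((BddMeas.const 4).mul (bA1 j)).add
      ((BddMeas.const 8).mul (bA2 j))).add (bA3 j)).add (bA4 j)).sub (bA5 j)).integrable] at hmain
  set Iζ := ∫ ω, ζ ω ∂μ with hIζ
  set IH := ∫ ω, ζ ω * (R ω + η) ∂μ with hIH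
  have hIζ0 : 0 ≤ Iζ := integral_nonneg hζ0
  have hIH0 : 0 ≤ IH := integral_nonneg hζH0
  have hηI : η * Iζ ≤ IH := by
    rw [hIζ, hIH, ← integral_const_mul]
    refine integral_mono (hζm.integrable.const_mul _) hζHm.integrable fun ω => ?_
    have := mul_nonneg (hζ0 ω) (hR0 ω)
    simp only
    linarith
  have hterms : ∑ j ∈ B, ∫ ω, (4 * A1 j ω + 8 * A2 j ω + A3 j ω + A4 j ω - A5 j ω) ∂μ
      ≤ (4 * IH + 112 * (r + 2) ^ 2 * Iζ + 64 * k * Iζ) * β + 2 * IH := by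
    calc _ ≤ ∑ j ∈ B, ((4 * IH + 112 * (r + 2) ^ 2 * Iζ + 64 * k * Iζ)
          * (∫ ω, |x ω j| * absNear dist m (x ω) j ^ 2 ∂μ)
          + |∫ ω, x ω j ∂μ| * (2 * IH)) := by
          refine Finset.sum_le_sum fun j hj => ?_
          rw [integral_sub (((((BddMeas.const 4).mul (bA1 j)).add
            ((BddMeas.const 8).mul (bA2 j))).add (bA3 j)).add (bA4 j)).integrable
            (bA5 j).integrable,
            integral_add ((((BddMeas.const 4).mul (bA1 j)).add
            ((BddMeas.const 8).mul (bA2 j))).add (bA3 j)).integrable (bA4 j).integrable,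
            integral_add (((BddMeas.const 4).mul (bA1 j)).add
            ((BddMeas.const 8).mul (bA2 j))).integrable (bA3 j).integrable,
            integral_add ((BddMeas.const 4).mul (bA1 j)).integrable
            ((BddMeas.const 8).mul (bA2 j)).integrable,
            integral_const_mul, integral_const_mul, iA1 j hj]
          have h2 := iA2 j hj
          have h3 := iA3 j hj
          have h4 := iA4 j hj
          have h5 := iA5 j hj
          linarith
      _ = (4 * IH + 112 * (r + 2) ^ 2 * Iζ + 64 * k * Iζ)
          * (∑ j ∈ B, ∫ ω, |x ω j| * absNear dist m (x ω) j ^ 2 ∂μ)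
          + (∑ j ∈ B, |∫ ω, x ω j ∂μ|) * (2 * IH) := by
          rw [Finset.sum_add_distrib, ← Finset.mul_sum, ← Finset.sum_mul]
      _ ≤ (4 * IH + 112 * (r + 2) ^ 2 * Iζ + 64 * k * Iζ) * β + 1 * (2 * IH) := by
          gcongr
          exact (Finset.sum_le_univ_sum_of_nonneg fun i => abs_nonneg _).trans he
      _ = _ := by ring
  have hβ0 : 0 ≤ β := le_trans (Finset.sum_nonneg fun j _ => hxT0 j) hsum
  -- The recursive terms total `4 * 64 * k * β * Iζ`, and `4096 = 16 * 256` turns this into `k / 16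
  -- * IH`.
  have hβI : 4096 * (β * Iζ) ≤ IH := by
    refine le_trans ?_ hηI
    rw [← mul_assoc]
    exact mul_le_mul_of_nonneg_right hΓ hIζ0
  have hβH : 4096 * (β * IH) ≤ IH := by
    have : 4096 * β ≤ 1 := hΓ.trans hη1
    rw [← mul_assoc]
    exact mul_le_of_le_one_left hIH0 this
  have hkβ := mul_le_mul_of_nonneg_left hβI hk
  have hrβ := mul_le_mul_of_nonneg_left hβI (sq_nonneg (r + 2))
  have hrI : (r + 1) ^ 2 * IH ≤ (r + 2) ^ 2 * IH := by gcongr; linarith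
  have hrI1 : r * IH ≤ (r + 2) ^ 2 * IH := by gcongr; nlinarith
  have hrI2 : 4 * IH ≤ (r + 2) ^ 2 * IH := by gcongr; nlinarith
  calc _ ≤ _ := hmain
    _ ≤ 4 * (8 * (β * Iζ) + (((4 * IH + 112 * (r + 2) ^ 2 * Iζ + 64 * k * Iζ) * β + 2 * IH)
        + (2 * (14 * (r + 1) ^ 2 * IH) + 2 * r * IH))) := by gcongr
    _ ≤ _ := by linarith

end LocalField

end Field

/-- This shows that about `θ⁻¹` reductions by the factor `4` suffice to bring `θ⁻³` down to an
absolute constant. -/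
lemma cube_le_four_pow (n : ℕ) : n ^ 3 ≤ 4 ^ n := by
  match n with
  | 0 => norm_num
  | 1 => norm_num
  | 2 => norm_num
  | k + 3 =>
    induction k with
    | zero => norm_num
    | succ k ih =>
      calc (k + 1 + 3) ^ 3 ≤ 4 * (k + 3) ^ 3 := by ring_nf; nlinarith [sq_nonneg k]
        _ ≤ 4 * 4 ^ (k + 3) := by gcongr
        _ = _ := by ring

/-! ### Iterating the recursion, and Stein's bound -/

section Field

variable {ι Ω : Type*} [Fintype ι] [DecidableEq ι]

namespace LocalField

variable [mΩ : MeasurableSpace Ω] {μ : Measure Ω} [IsProbabilityMeasure μ] {x : Ω → ι → ℝ}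
  {dist : ι → ι → ℕ} {m : ℕ} {D : ℝ}

/-- The window is at most `1`, and `k (R + η) ≥ k η ≥ 1`; this trivial bound starts the recursion.
-/
lemma concBound_inv (h : LocalField μ x dist m D)
    {W : Ω → ℝ} (hW : Measurable W) {η k : ℝ} (hη : 0 < η) (hk : η⁻¹ ≤ k)
    (I : Finset ι) : ConcBound μ x dist m W η k I := by
  intro ζ Z R hζ hζ0 hZ hR hR0
  have hζm := h.bddMeas_of_coord hζ
  have hRm := h.bddMeas_of_coord hR
  have hZm := hZ.mono (h.coordSigma_le _) le_rfl
  rw [← integral_const_mul]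
  refine integral_mono (hζm.mul (.of_le (measurable_window hZm (hZm.add hRm.meas) hW) 1
    fun ω => abs_window_le _ _ _)).integrable
    ((BddMeas.const k).mul (hζm.mul (hRm.add (.const η)))).integrable fun ω => ?_
  have h1 : 1 ≤ k * (R ω + η) := by
    calc 1 = η⁻¹ * η := (inv_mul_cancel₀ hη.ne').symm
      _ ≤ k * (R ω + η) := by
        have := hR0 ω
        have hk0 : 0 ≤ k := (inv_pos.mpr hη).le.trans hk
        gcongr
        linarith
  calc ζ ω * window (Z ω) (Z ω + R ω) (W ω) ≤ ζ ω * (k * (R ω + η)) :=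
        mul_le_mul_of_nonneg_left ((window_le_one _ _ _).trans h1) (hζ0 ω)
    _ = _ := by ring

/-- The mass of the quadratic form far from `I` is close to that of the whole form. -/
lemma sum_compl_integral_ge (h : LocalField μ x dist m D) {θ : ℝ} (hθ : 0 < θ)
    (hΓ : D ^ 3 * ∑ i, ∫ ω, |x ω i| ^ 3 ∂μ ≤ θ ^ 3) (I : Finset ι) :
    ∫ ω, vecQuad dist m (x ω) ∂μ - I.card * (2 * θ ^ 2)
      ≤ ∑ j ∈ (ballUnion dist m 5 I)ᶜ, ∫ ω, x ω j * nearSum dist m (x ω) j ∂μ := by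
  have hy : ∀ j, BddMeas mΩ fun ω => nearSum dist m (x ω) j := fun j =>
    h.bddMeas_of_coord (h.bddMeas_nearSum Finset.Subset.rfl)
  have hT : ∀ j, BddMeas mΩ fun ω => absNear dist m (x ω) j := fun j =>
    h.bddMeas_of_coord (h.bddMeas_absNear Finset.Subset.rfl)
  have hxy := fun j => (h.bddMeas j).mul (hy j)
  have hxT := fun j => (h.bddMeas j).abs.mul (hT j)
  have hQ : ∫ ω, vecQuad dist m (x ω) ∂μ = ∑ j, ∫ ω, x ω j * nearSum dist m (x ω) j ∂μ := by
    unfold vecQuad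
    exact integral_finsetSum _ fun j _ => (hxy j).integrable
  rw [hQ, ← Finset.sum_add_sum_compl (ballUnion dist m 5 I)]
  have hnear : ∑ j ∈ ballUnion dist m 5 I, ∫ ω, x ω j * nearSum dist m (x ω) j ∂μ
      ≤ I.card * (2 * θ ^ 2) := by
    calc _ ≤ ∑ j ∈ ballUnion dist m 5 I, ∫ ω, |x ω j| * absNear dist m (x ω) j ∂μ := by
          refine Finset.sum_le_sum fun j _ => integral_mono (hxy j).integrable
            (hxT j).integrable fun ω => ?_
          refine (le_abs_self _).trans ?_
          rw [abs_mul]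
          exact mul_le_mul_of_nonneg_left (abs_nearSum_le _ _ _ _) (abs_nonneg _)
      _ ≤ ∑ i ∈ I, ∑ j ∈ distBall dist m 5 i, ∫ ω, |x ω j| * absNear dist m (x ω) j ∂μ :=
          sum_ballUnion_le _ _ _ _ _ fun j => integral_nonneg fun ω =>
            mul_nonneg (abs_nonneg _) (absNear_nonneg _ _ _ _)
      _ ≤ ∑ _i ∈ I, 2 * θ ^ 2 :=
          Finset.sum_le_sum fun i _ => h.sum_ball_integral_abs_mul_absNear_le hθ hΓ i
      _ = _ := by rw [Finset.sum_const, nsmul_eq_mul]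
  linarith

/-- The conditional concentration inequality, with an absolute constant. -/
theorem concBound_singleton (h : LocalField μ x dist m D)
    {θ : ℝ} (hθ : 0 < θ) (hθ1 : θ ≤ 1 / 32) (c : ℝ)
    (hΓ : 4096 * (D ^ 3 * ∑ i, ∫ ω, |x ω i| ^ 3 ∂μ) ≤ θ ^ 3)
    (he : ∑ i, |∫ ω, x ω i ∂μ| ≤ 1) (hQ : |∫ ω, vecQuad dist m (x ω) ∂μ - 1| ≤ 1 / 8) (i : ι) :
    ConcBound μ x dist m (fun ω => normSum dist m c (x ω)) (θ ^ 3) 4000 {i} := by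
  have hD := h.one_le
  set Γ : ℝ := ∑ i, ∫ ω, |x ω i| ^ 3 ∂μ
  have hΓ0 : 0 ≤ Γ := Finset.sum_nonneg fun i _ => integral_nonneg fun ω => by positivity
  have hη : 0 < θ ^ 3 := by positivity
  have hη1 : θ ^ 3 ≤ 1 := pow_le_one₀ hθ.le (by linarith)
  have hDΓ : D ^ 3 * Γ ≤ θ ^ 3 := by
    have : 0 ≤ D ^ 3 * Γ := by positivity
    linarith
  have hD2 : 4096 * (D ^ 2 * Γ) ≤ θ ^ 3 := by
    refine le_trans ?_ hΓ
    gcongr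
    norm_num
  have heq := _root_.abs_le.mp hQ
  have hS : ∫ ω, vecSum (x ω) ^ 2 ∂μ ≤ 3 := by
    refine h.integral_vecSum_sq_le.trans ?_
    have : (∑ i, |∫ ω, x ω i ∂μ|) ^ 2 ≤ 1 :=
      pow_le_one₀ (Finset.sum_nonneg fun i _ => abs_nonneg _) he
    linarith [heq.2]
  -- The depth `L` must be large enough that `θ⁻³ ≤ 4 ^ L`, and small enough that the neighbourhoods
  -- of `L` points carry at most `L * 2 θ² ≤ 1 / 8` of the quadratic form, so that at least `7 / 8 -
  -- 1 / 8 = 3 / 4` is left.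
  set L : ℕ := ⌈θ⁻¹⌉₊ with hL
  have hL1 : θ⁻¹ ≤ L := Nat.le_ceil _
  have hL2 : (L : ℝ) ≤ 2 * θ⁻¹ := by
    have h1 := (Nat.ceil_lt_add_one (inv_pos.mpr hθ).le).le
    have h2 : 1 ≤ θ⁻¹ := (one_le_inv₀ hθ).mpr (by linarith)
    linarith
  have hLθ : (L : ℝ) * (2 * θ ^ 2) ≤ 1 / 8 := by
    calc (L : ℝ) * (2 * θ ^ 2) ≤ 2 * θ⁻¹ * (2 * θ ^ 2) := by gcongr
      _ = 4 * θ := by field_simp; ring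
      _ ≤ 1 / 8 := by linarith
  have hLpos : 1 ≤ L := by
    rw [hL, Nat.one_le_ceil_iff]
    exact inv_pos.mpr hθ
  -- Here `n` counts the recursion steps already made. The factor `(|I| + 2)²` matches the
  -- polynomial term of one step.
  have key : ∀ n : ℕ, ∀ I : Finset ι, I.card + n ≤ L →
      ConcBound μ x dist m (fun ω => normSum dist m c (x ω)) (θ ^ 3)
        (((I.card : ℝ) + 2) ^ 2 * (400 + (θ ^ 3)⁻¹ / 4 ^ n)) I := by
    intro n
    induction n with
    | zero =>
      intro I _
      refine h.concBound_inv (h.bddMeas_normSum c).meas hη ?_ I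
      have h1 : (1 : ℝ) ≤ ((I.card : ℝ) + 2) ^ 2 := by
        have : (0 : ℝ) ≤ I.card := Nat.cast_nonneg _
        nlinarith
      have h2 : 0 < (θ ^ 3)⁻¹ := by positivity
      rw [pow_zero, div_one]
      nlinarith
    | succ n ih =>
      intro I hI
      set r : ℝ := (I.card : ℝ) with hr
      have hr0 : 0 ≤ r := Nat.cast_nonneg _
      have hrec : ∀ j ∉ ballUnion dist m 5 I,
          ConcBound μ x dist m (fun ω => normSum dist m c (x ω)) (θ ^ 3)
            ((r + 3) ^ 2 * (400 + (θ ^ 3)⁻¹ / 4 ^ n)) (insert j I) := by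
        intro j hj
        have hjI : j ∉ I := fun hjI => hj (mem_ballUnion.mpr ⟨j, hjI, h.mem_distBall_self 5 j⟩)
        have hc : (insert j I).card = I.card + 1 := Finset.card_insert_of_notMem hjI
        have := ih (insert j I) (by omega)
        rw [hc] at this
        push_cast at this
        rwa [show (I.card : ℝ) + 1 + 2 = r + 3 by rw [hr]; ring] at this
      have hfar : 3 / 4 ≤ ∑ j ∈ (ballUnion dist m 5 I)ᶜ,
          ∫ ω, x ω j * nearSum dist m (x ω) j ∂μ := by
        refine le_trans ?_ (h.sum_compl_integral_ge hθ hDΓ I)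
        have h1 : r * (2 * θ ^ 2) ≤ L * (2 * θ ^ 2) := by
          rw [hr]
          gcongr
          omega
        linarith [heq.1]
      have hstep := h.concBound_step hη hη1 (by positivity) c hS he hD2 I hfar hrec
      intro ζ Z R hζ hζ0 hZ hR hR0
      refine (hstep ζ Z R hζ hζ0 hZ hR hR0).trans ?_
      have hint : 0 ≤ ∫ ω, ζ ω * (R ω + θ ^ 3) ∂μ := integral_nonneg fun ω =>
        mul_nonneg (hζ0 ω) (add_nonneg (hR0 ω) hη.le)
      refine mul_le_mul_of_nonneg_right ?_ hint
      have hb : 0 ≤ (θ ^ 3)⁻¹ / 4 ^ n := by positivity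
      rw [pow_succ (4 : ℝ) n, ← div_div]
      set b := (θ ^ 3)⁻¹ / 4 ^ n
      -- Passing from `I` to `insert j I` costs at most `9 / 4`, so one step contracts by `9 / 64 <
      -- 1 / 4`; moreover `200 + 400 * 9 / 64 ≤ 400`.
      have h1 : (r + 3) ^ 2 ≤ 9 / 4 * (r + 2) ^ 2 := by nlinarith
      have h2 : (r + 3) ^ 2 * (400 + b) ≤ 9 / 4 * (r + 2) ^ 2 * (400 + b) := by gcongr
      have h3 : 0 ≤ (r + 2) ^ 2 * b := by positivity
      have h4 : 0 ≤ (r + 2) ^ 2 := by positivity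
      rw [← hr]
      linarith
  have hfin := key (L - 1) {i} (by rw [Finset.card_singleton]; omega)
  intro ζ Z R hζ hζ0 hZ hR hR0
  refine (hfin ζ Z R hζ hζ0 hZ hR hR0).trans ?_
  have hint : 0 ≤ ∫ ω, ζ ω * (R ω + θ ^ 3) ∂μ := integral_nonneg fun ω =>
    mul_nonneg (hζ0 ω) (add_nonneg (hR0 ω) hη.le)
  refine mul_le_mul_of_nonneg_right ?_ hint
  have hpow : (θ ^ 3)⁻¹ / 4 ^ (L - 1) ≤ 4 := by
    have h1 : (4 : ℝ) ^ L = 4 ^ (L - 1) * 4 := by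
      rw [← pow_succ]
      congr 1
      omega
    have h2 : (θ ^ 3)⁻¹ ≤ 4 ^ L := by
      rw [← inv_pow]
      calc θ⁻¹ ^ 3 ≤ (L : ℝ) ^ 3 := by gcongr
        _ ≤ 4 ^ L := by exact_mod_cast cube_le_four_pow L
    rw [div_le_iff₀ (by positivity)]
    linarith
  rw [Finset.card_singleton]
  push_cast
  -- For a singleton the constant is at most `9 * (400 + 4) = 3636`.
  linarith

/-- If the clipping is inactive, the difference is `c / (q + c)`. If it is active, then `|q - 1| ≥ 3
/ 8`, and the crude bound `1 + 2 |q|` is at most `27 (q - 1)²`. -/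
lemma abs_one_sub_vecQuad_mul_le (_h : LocalField μ x dist m D) {c : ℝ} (hc : |c| ≤ 1 / 8) (q : ℝ) :
    |1 - q * invRoot c q ^ 2| ≤ 2 * |c| + 27 * (q - 1) ^ 2 := by
  have hcb := _root_.abs_le.mp hc
  by_cases hq : 1 / 2 ≤ q + c ∧ q + c ≤ 2
  · have hpos : 0 < q + c := by linarith [hq.1]
    rw [invRoot_sq, min_eq_left hq.2, max_eq_right hq.1]
    have : 1 - q * (q + c)⁻¹ = c / (q + c) := by field_simp; ring
    rw [this, abs_div, abs_of_pos hpos, div_le_iff₀ hpos]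
    have h1 := abs_nonneg c
    nlinarith [sq_nonneg (q - 1), hq.1]
  · have h1 : |1 - q * invRoot c q ^ 2| ≤ 1 + 2 * |q| := by
      refine (abs_sub _ _).trans ?_
      rw [abs_one, abs_mul, abs_of_nonneg (sq_nonneg (invRoot c q)), mul_comm]
      gcongr
      exact invRoot_sq_le c q
    have h2 : |q| ≤ |q - 1| + 1 := by
      have := abs_add_le (q - 1) 1
      rwa [sub_add_cancel, abs_one] at this
    have h3 : 3 / 8 ≤ |q - 1| := by
      by_contra hcon
      push Not at hcon
      have := abs_lt.mp hcon
      exact hq ⟨by linarith [this.1, hcb.1], by linarith [this.2, hcb.2]⟩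
    rw [← sq_abs (q - 1)]
    have h4 := abs_nonneg c
    nlinarith

/-- The pointwise inequality behind the Stein bound. -/
lemma stein_pointwise (h : LocalField μ x dist m D) {c : ℝ} (hc : |c| ≤ 1 / 8) (z : ℝ) (ω : Ω) :
    |steinDeriv z (normSum dist m c (x ω))
      - normSum dist m c (x ω) * steinSol z (normSum dist m c (x ω))
      + ∑ i, x ω i * (invRoot c (quadOff dist m (x ω) i)
        * steinSol z (normSumOff dist m c (x ω) i))|
      ≤ 2 * (2 * |c| + 27 * (vecQuad dist m (x ω) - 1) ^ 2)
        + ∑ i, (76 * (|x ω i| * absNear dist m (x ω) i ^ 2 * (|vecSum (x ω)| + 1))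
          + 16 * (|x ω i| * absNear dist m (x ω) i
            * window (z - 2 * absNear dist m (x ω) i)
              (z - 2 * absNear dist m (x ω) i + 4 * absNear dist m (x ω) i)
              (normSum dist m c (x ω)))) := by
  set g := invRoot c (vecQuad dist m (x ω)) with hg
  set W := normSum dist m c (x ω) with hW
  set f := steinSol z with hf
  set φ := steinDeriv z W
  have hg0 : 0 < g := invRoot_pos _ _
  have hgle : g ≤ 2 := invRoot_le _ _
  have hWS : |W| ≤ 2 * |vecSum (x ω)| := by
    rw [hW, normSum, ← hg, abs_mul, abs_of_pos hg0, mul_comm]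
    gcongr
  -- Since `W f(W) = ∑ x_i g f(W)`, subtracting the deleted versions and the linear terms, which add
  -- up to `Q g² f'(W)`, leaves `f'(W) (1 - Q g²)` and the expansion errors.
  have hid : φ - W * f W + ∑ i, x ω i * (invRoot c (quadOff dist m (x ω) i)
        * f (normSumOff dist m c (x ω) i))
      = φ * (1 - vecQuad dist m (x ω) * g ^ 2)
        - ∑ i, x ω i * (g * f W - invRoot c (quadOff dist m (x ω) i)
          * f (normSumOff dist m c (x ω) i) - nearSum dist m (x ω) i * g ^ 2 * φ) := by
    have h1 : W * f W = ∑ i, x ω i * (g * f W) := by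
      rw [← Finset.sum_mul, hW, normSum, ← hg, vecSum]
      ring
    have h2 : vecQuad dist m (x ω) * g ^ 2 * φ
        = ∑ i, x ω i * (nearSum dist m (x ω) i * g ^ 2 * φ) := by
      rw [vecQuad, Finset.sum_mul, Finset.sum_mul]
      exact Finset.sum_congr rfl fun i _ => by ring
    have h3 : ∑ i, x ω i * (g * f W - invRoot c (quadOff dist m (x ω) i)
          * f (normSumOff dist m c (x ω) i) - nearSum dist m (x ω) i * g ^ 2 * φ)
        = W * f W - ∑ i, x ω i * (invRoot c (quadOff dist m (x ω) i)
          * f (normSumOff dist m c (x ω) i)) - vecQuad dist m (x ω) * g ^ 2 * φ := by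
      rw [h1, h2, ← Finset.sum_sub_distrib, ← Finset.sum_sub_distrib]
      exact Finset.sum_congr rfl fun i _ => by ring
    rw [h3]
    ring
  rw [hid]
  refine (abs_sub _ _).trans (add_le_add ?_ ?_)
  · rw [abs_mul]
    exact mul_le_mul (abs_steinDeriv_le _ _) (h.abs_one_sub_vecQuad_mul_le hc _) (abs_nonneg _)
      (by norm_num)
  · refine (Finset.abs_sum_le_sum_abs _ _).trans (Finset.sum_le_sum fun i _ => ?_)
    rw [abs_mul]
    have hT0 := absNear_nonneg dist m (x ω) i
    have hyT := abs_nearSum_le dist m (x ω) i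
    have hu : |nearSum dist m (x ω) i * g| ≤ 2 * absNear dist m (x ω) i := by
      rw [abs_mul, abs_of_pos hg0, mul_comm]
      exact mul_le_mul hgle hyT (abs_nonneg _) (by norm_num)
    have htay := abs_steinSol_taylor_le z W _ _ hu
    have hexp := h.abs_expansion_le c ω i f 5 2 φ _ (abs_steinSol_le z) (by norm_num)
      (fun v w => abs_steinSol_sub_le z v w) htay
    have hx := abs_nonneg (x ω i)
    refine (mul_le_mul_of_nonneg_left hexp hx).trans ?_
    rw [show z - 2 * absNear dist m (x ω) i + 4 * absNear dist m (x ω) i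
      = z + 2 * absNear dist m (x ω) i by ring]
    set T := absNear dist m (x ω) i
    set w := window (z - 2 * T) (z + 2 * T) W
    have h1 : |x ω i| * T ^ 2 * |W| ≤ |x ω i| * T ^ 2 * (2 * |vecSum (x ω)|) := by gcongr
    have h2 : 0 ≤ |x ω i| * T ^ 2 * |vecSum (x ω)| := by positivity
    linarith

/-- Second moment of the deviation of the quadratic form from `1`. -/
lemma integral_vecQuad_sub_one_sq_le (h : LocalField μ x dist m D)
    (hQ : |∫ ω, vecQuad dist m (x ω) ∂μ - 1| ≤ 1 / 8) :
    ∫ ω, (vecQuad dist m (x ω) - 1) ^ 2 ∂μ ≤ 2 * (D ^ 2 * ∑ i, ∫ ω, |x ω i| ^ 3 ∂μ)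
      + 2 * |∫ ω, vecQuad dist m (x ω) ∂μ - 1| := by
  have hv := h.integral_sq_sum_mul_nearSum_sub_le Finset.univ
  have hy : ∀ j, BddMeas mΩ fun ω => nearSum dist m (x ω) j := fun j =>
    h.bddMeas_of_coord (h.bddMeas_nearSum Finset.Subset.rfl)
  have hmeanQ : ∑ j, ∫ ω, x ω j * nearSum dist m (x ω) j ∂μ = ∫ ω, vecQuad dist m (x ω) ∂μ := by
    unfold vecQuad
    exact (integral_finsetSum _ fun j _ => ((h.bddMeas j).mul (hy j)).integrable).symm
  rw [hmeanQ] at hv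
  change ∫ ω, (vecQuad dist m (x ω) - ∫ ω, vecQuad dist m (x ω) ∂μ) ^ 2 ∂μ ≤ _ at hv
  set M := ∫ ω, vecQuad dist m (x ω) ∂μ
  have bq : BddMeas mΩ fun ω => (vecQuad dist m (x ω) - M) ^ 2 :=
    (h.bddMeas_vecQuad.sub (.const M)).pow 2
  have h1 := integral_mono (μ := μ) ((h.bddMeas_vecQuad.sub (.const 1)).pow 2).integrable
    (((BddMeas.const 2).mul bq).add (.const (2 * (M - 1) ^ 2))).integrable fun ω => by
      simp only
      nlinarith [sq_nonneg (vecQuad dist m (x ω) - M - (M - 1))]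
  rw [integral_add (bq.integrable.const_mul 2) (integrable_const _), integral_const_mul,
    integral_const, probReal_univ, one_smul] at h1
  have h2 : (M - 1) ^ 2 ≤ |M - 1| := by
    rw [← sq_abs]
    nlinarith [abs_nonneg (M - 1)]
  linarith

/-- Normal approximation of the self-normalized sum of a bounded local field. -/
theorem stein_bound (h : LocalField μ x dist m D)
    {θ a c : ℝ} (hθ : 0 < θ) (hθ1 : θ ≤ 1 / 32) (hc : |c| ≤ 1 / 8)
    (hΓ : 4096 * (D ^ 3 * ∑ i, ∫ ω, |x ω i| ^ 3 ∂μ) ≤ θ ^ 3)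
    (ha : ∑ i, ∫ ω, x ω i ^ 2 ∂μ ≤ a)
    (he : ∑ i, |∫ ω, x ω i ∂μ| ≤ 1) (hQ : |∫ ω, vecQuad dist m (x ω) ∂μ - 1| ≤ 1 / 8) (z : ℝ) :
    |μ.real {ω | normSum dist m c (x ω) ≤ z} - stdCdf z|
      ≤ 300000 * (θ ^ 3 * (1 + D * a) + |c| + |∫ ω, vecQuad dist m (x ω) ∂μ - 1|
        + ∑ i, |∫ ω, x ω i ∂μ|) := by
  have hD := h.one_le
  have hη : 0 < θ ^ 3 := by positivity
  have hconc := h.concBound_singleton hθ hθ1 c hΓ he hQ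
  set Γ : ℝ := ∑ i, ∫ ω, |x ω i| ^ 3 ∂μ
  have hΓ0 : 0 ≤ Γ := Finset.sum_nonneg fun i _ => integral_nonneg fun ω => by positivity
  have hβ : D ^ 2 * Γ ≤ θ ^ 3 := by
    have h1 : D ^ 2 * Γ ≤ D ^ 3 * Γ := by
      gcongr
      norm_num [hD]
    have h2 : 0 ≤ D ^ 3 * Γ := by positivity
    linarith
  have heq := _root_.abs_le.mp hQ
  have hS : ∫ ω, vecSum (x ω) ^ 2 ∂μ ≤ 3 := by
    refine h.integral_vecSum_sq_le.trans ?_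
    have : (∑ i, |∫ ω, x ω i ∂μ|) ^ 2 ≤ 1 :=
      pow_le_one₀ (Finset.sum_nonneg fun i _ => abs_nonneg _) he
    linarith [heq.2]
  have hW := h.bddMeas_normSum c
  have hTl : ∀ i, BddMeas (coordSigma x (ballUnion dist m 2 {i}))
      fun ω => absNear dist m (x ω) i :=
    fun i => h.bddMeas_absNear fun j hj => mem_ballUnion.mpr ⟨i, Finset.mem_singleton_self i, hj⟩
  have hT : ∀ i, BddMeas mΩ fun ω => absNear dist m (x ω) i := fun i => h.bddMeas_of_coord (hTl i)
  have hxl : ∀ i, BddMeas (coordSigma x (ballUnion dist m 2 {i})) fun ω => x ω i := fun i =>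
    h.bddMeas_coord (mem_ballUnion.mpr ⟨i, Finset.mem_singleton_self i, h.mem_distBall_self 2 i⟩)
  have hfW : BddMeas mΩ fun ω => steinSol z (normSum dist m c (x ω)) :=
    .of_le ((continuous_steinSol z).measurable.comp hW.meas) 5 fun _ => abs_steinSol_le _ _
  have hdW : BddMeas mΩ fun ω => steinDeriv z (normSum dist m c (x ω)) :=
    .of_le ((measurable_steinDeriv z).comp hW.meas) 2 fun _ => abs_steinDeriv_le _ _
  set E : ι → Ω → ℝ := fun i ω => invRoot c (quadOff dist m (x ω) i)
    * steinSol z (normSumOff dist m c (x ω) i) with hE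
  have bE : ∀ i, BddMeas (coordSigma x (distBall dist m 1 i)ᶜ) (E i) := fun i =>
    (h.bddMeas_invRoot_quadOff c Finset.Subset.rfl).mul
      (.of_le ((continuous_steinSol z).measurable.comp
        (h.bddMeas_normSumOff c Finset.Subset.rfl).meas) 5 fun _ => abs_steinSol_le _ _)
  have iE : ∀ i, |∫ ω, x ω i * E i ω ∂μ| ≤ |∫ ω, x ω i ∂μ| * 10 := fun i => by
    have := h.abs_integral_coord_mul_le (h.lt_dist_of_mem_compl i) (bE i)
      (integrable_const (10 : ℝ)) fun ω => by
        simp only [hE]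
        rw [abs_mul]
        calc _ ≤ 2 * (5 : ℝ) := mul_le_mul (abs_invRoot_le _ _) (abs_steinSol_le _ _)
              (abs_nonneg _) (by norm_num)
          _ = 10 := by norm_num
    simpa using this
  have bxE := fun i => (h.bddMeas i).mul (h.bddMeas_of_coord (bE i))
  -- reduction to Stein's equation
  have hmeas : MeasurableSet {ω | normSum dist m c (x ω) ≤ z} := measurableSet_le hW.meas measurable_const
  -- `steinDeriv` is defined so that Stein's equation holds at `w = z` too; no statement about atoms
  -- of `W` is needed.
  have hstein : μ.real {ω | normSum dist m c (x ω) ≤ z} - stdCdf z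
      = ∫ ω, (steinDeriv z (normSum dist m c (x ω))
        - normSum dist m c (x ω) * steinSol z (normSum dist m c (x ω))) ∂μ := by
    have h1 : ∀ ω, steinDeriv z (normSum dist m c (x ω))
        - normSum dist m c (x ω) * steinSol z (normSum dist m c (x ω))
        = Set.indicator {ω | normSum dist m c (x ω) ≤ z} (fun _ => (1 : ℝ)) ω - stdCdf z := fun ω => by
      simp [steinDeriv, Set.indicator_apply]
    simp_rw [h1]
    rw [integral_sub ((integrable_const (1 : ℝ)).indicator hmeas) (integrable_const _),
      integral_indicator hmeas]
    simp
  rw [hstein]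
  have bdW : BddMeas mΩ fun ω => steinDeriv z (normSum dist m c (x ω))
        - normSum dist m c (x ω) * steinSol z (normSum dist m c (x ω)) := hdW.sub (hW.mul hfW)
  have bsE : BddMeas mΩ fun ω => ∑ i, x ω i * E i ω := .sum fun i _ => bxE i
  set A : ι → Ω → ℝ := fun i ω => |x ω i| * absNear dist m (x ω) i ^ 2 * (|vecSum (x ω)| + 1)
    with hA
  set B : ι → Ω → ℝ := fun i ω => |x ω i| * absNear dist m (x ω) i
            * window (z - 2 * absNear dist m (x ω) i)
              (z - 2 * absNear dist m (x ω) i + 4 * absNear dist m (x ω) i)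
              (normSum dist m c (x ω)) with hB
  have hxT := fun i => (hxl i).abs.mul ((hTl i).pow 2)
  have hxT1 := fun i => (hxl i).abs.mul (hTl i)
  have hxTm := fun i => h.bddMeas_of_coord (hxT i)
  have hxT1m := fun i => h.bddMeas_of_coord (hxT1 i)
  have bA : ∀ i, BddMeas mΩ (A i) := fun i =>
    (hxTm i).mul (h.bddMeas_vecSum.abs.add (.const 1))
  have bB : ∀ i, BddMeas mΩ (B i) := fun i =>
    (hxT1m i).mul (.of_le (measurable_window (((hT i).meas.const_mul 2).const_sub z)
      ((((hT i).meas.const_mul 2).const_sub z).add ((hT i).meas.const_mul 4)) hW.meas) 1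
      fun _ => abs_window_le _ _ _)
  have iA : ∀ i, ∫ ω, A i ω ∂μ ≤ 56 * ∫ ω, |x ω i| * absNear dist m (x ω) i ^ 2 ∂μ := fun i => by
    refine (h.integral_mul_abs_vecSum_le hS {i} (hxT i) fun ω => by positivity).trans (le_of_eq ?_)
    rw [Finset.card_singleton]
    norm_num
  have iB : ∀ i, ∫ ω, B i ω ∂μ ≤ 4000 * (4 * ∫ ω, |x ω i| * absNear dist m (x ω) i ^ 2 ∂μ
      + θ ^ 3 * ∫ ω, |x ω i| * absNear dist m (x ω) i ∂μ) := fun i => by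
    -- The window around `z` has random half-width `2 T_i`; this is why `ConcBound` allows local
    -- random endpoints and weights.
    refine (hconc i (fun ω => |x ω i| * absNear dist m (x ω) i)
      (fun ω => z - 2 * absNear dist m (x ω) i) (fun ω => 4 * absNear dist m (x ω) i) (hxT1 i)
      (fun ω => mul_nonneg (abs_nonneg _) (absNear_nonneg _ _ _ _))
      (((hTl i).meas.const_mul 2).const_sub z) ((BddMeas.const 4).mul (hTl i))
      (fun ω => mul_nonneg (by norm_num) (absNear_nonneg _ _ _ _))).trans (le_of_eq ?_)
    rw [← integral_const_mul 4, ← integral_const_mul (θ ^ 3),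
      ← integral_add ((hxTm i).integrable.const_mul _) ((hxT1m i).integrable.const_mul _)]
    congr 2
    funext ω
    ring
  have hQv := h.integral_vecQuad_sub_one_sq_le hQ
  have bQ : BddMeas mΩ fun ω => (vecQuad dist m (x ω) - 1) ^ 2 :=
    (h.bddMeas_vecQuad.sub (.const 1)).pow 2
  have bAB : BddMeas mΩ fun ω => ∑ i, (76 * A i ω + 16 * B i ω) :=
    .sum fun i _ => ((BddMeas.const 76).mul (bA i)).add ((BddMeas.const 16).mul (bB i))
  have hmain : |∫ ω, ((steinDeriv z (normSum dist m c (x ω))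
        - normSum dist m c (x ω) * steinSol z (normSum dist m c (x ω)))
        + ∑ i, x ω i * E i ω) ∂μ|
      ≤ ∫ ω, (2 * (2 * |c| + 27 * (vecQuad dist m (x ω) - 1) ^ 2)
        + ∑ i, (76 * A i ω + 16 * B i ω)) ∂μ :=
    abs_integral_le_integral_abs.trans (integral_mono (bdW.add bsE).abs.integrable
      (((BddMeas.const 2).mul ((BddMeas.const (2 * |c|)).add
        ((BddMeas.const 27).mul bQ))).add bAB).integrable fun ω => h.stein_pointwise hc z ω)
  rw [integral_add bdW.integrable bsE.integrable,
    integral_add ((BddMeas.const 2).mul ((BddMeas.const (2 * |c|)).add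
        ((BddMeas.const 27).mul bQ))).integrable bAB.integrable, integral_const_mul,
    integral_add (integrable_const _) ((BddMeas.const 27).mul bQ).integrable, integral_const_mul (27 : ℝ),
    integral_const, probReal_univ, one_smul,
    integral_finsetSum _ fun i _ => (((BddMeas.const 76).mul (bA i)).add
      ((BddMeas.const 16).mul (bB i))).integrable,
    integral_finsetSum _ fun i _ => (bxE i).integrable] at hmain
  have hsE : |∑ i, ∫ ω, x ω i * E i ω ∂μ| ≤ (∑ i, |∫ ω, x ω i ∂μ|) * 10 := by
    rw [Finset.sum_mul]
    exact (Finset.abs_sum_le_sum_abs _ _).trans (Finset.sum_le_sum fun i _ => iE i)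
  have hsAB : ∑ i, ∫ ω, (76 * A i ω + 16 * B i ω) ∂μ
      ≤ 260256 * (D ^ 2 * Γ) + 64000 * (θ ^ 3 * (D * a)) := by
    calc _ ≤ ∑ i, (260256 * (∫ ω, |x ω i| * absNear dist m (x ω) i ^ 2 ∂μ)
          + 64000 * (θ ^ 3 * ∫ ω, |x ω i| * absNear dist m (x ω) i ∂μ)) := by
          refine Finset.sum_le_sum fun i _ => ?_
          rw [integral_add ((BddMeas.const 76).mul (bA i)).integrable
            ((BddMeas.const 16).mul (bB i)).integrable, integral_const_mul, integral_const_mul]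
          linarith [iA i, iB i]
      _ = 260256 * (∑ i, ∫ ω, |x ω i| * absNear dist m (x ω) i ^ 2 ∂μ)
          + 64000 * (θ ^ 3 * ∑ i, ∫ ω, |x ω i| * absNear dist m (x ω) i ∂μ) := by
          rw [Finset.sum_add_distrib, ← Finset.mul_sum, ← Finset.mul_sum, ← Finset.mul_sum]
      _ ≤ _ := by
          have h1 := h.integral_abs_mul_absNear_sq_le
          have h2 := h.sum_integral_abs_mul_absNear_le.trans
            (mul_le_mul_of_nonneg_left ha h.pos.le)
          gcongr
  set I0 := ∫ ω, (steinDeriv z (normSum dist m c (x ω))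
        - normSum dist m c (x ω) * steinSol z (normSum dist m c (x ω))) ∂μ
  have htri : |I0| ≤ |I0 + ∑ i, ∫ ω, x ω i * E i ω ∂μ| + |∑ i, ∫ ω, x ω i * E i ω ∂μ| := by
    have := abs_sub (I0 + ∑ i, ∫ ω, x ω i * E i ω ∂μ) (∑ i, ∫ ω, x ω i * E i ω ∂μ)
    rwa [add_sub_cancel_right] at this
  have ha0 : 0 ≤ a := le_trans (Finset.sum_nonneg fun i _ => integral_nonneg fun ω => by
    positivity) ha
  have hDa : 0 ≤ θ ^ 3 * (D * a) := by
    have := h.pos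
    positivity
  have hc0 := abs_nonneg c
  have hM0 := abs_nonneg (∫ ω, vecQuad dist m (x ω) ∂μ - 1)
  have he0 : 0 ≤ ∑ i, |∫ ω, x ω i ∂μ| := Finset.sum_nonneg fun i _ => abs_nonneg _
  linarith

end LocalField

end Field

lemma div_sqrt_le_of_le {s u v z : ℝ} (hu : 0 < u) (huv : u ≤ v) :
    (0 ≤ z → s / Real.sqrt u ≤ z → s / Real.sqrt v ≤ z) ∧
      (z < 0 → s / Real.sqrt v ≤ z → s / Real.sqrt u ≤ z) := by
  have hsu : 0 < Real.sqrt u := Real.sqrt_pos.mpr hu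
  have hsv : Real.sqrt u ≤ Real.sqrt v := Real.sqrt_le_sqrt huv
  constructor
  · intro hz h
    rw [div_le_iff₀ hsu] at h
    rw [div_le_iff₀ (hsu.trans_le hsv)]
    exact h.trans (mul_le_mul_of_nonneg_left hsv hz)
  · intro hz h
    rw [div_le_iff₀ (hsu.trans_le hsv)] at h
    rw [div_le_iff₀ hsu]
    exact h.trans (mul_le_mul_of_nonpos_left hsv hz.le)

/-! ### From the truncated normalizer to the studentized sum -/

section Field

variable {ι Ω : Type*} [Fintype ι] [DecidableEq ι]

/-- The self-normalized sum of a vector, with the correction for centering by sample means. -/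
noncomputable def studentSum (dist : ι → ι → ℕ) (m : ℕ) (v : ι → ℝ) : ℝ :=
  vecSum v / Real.sqrt (max (vecQuad dist m v
    - vecSum v * (∑ i, nearSum dist m v i) / Fintype.card ι) 0)

/-- When `Q` is near `1` no clipping occurs, and the correction lies in `[-δ, δ]`, so the true
normalizer lies between those with shifts `-δ` and `δ`. Enlarging the normalizer enlarges the event
`W ≤ z` for `z ≥ 0` and shrinks it for `z < 0`. -/
lemma studentSum_sandwich {dist : ι → ι → ℕ} {m : ℕ} {v : ι → ℝ} {δ : ℝ} (hδ : δ ≤ 1 / 8)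
    (hQ : |vecQuad dist m v - 1| ≤ 1 / 4)
    (hp : |vecSum v * (∑ i, nearSum dist m v i) / Fintype.card ι| ≤ δ) (z : ℝ) :
    (0 ≤ z → (normSum dist m (-δ) v ≤ z → studentSum dist m v ≤ z) ∧
      (studentSum dist m v ≤ z → normSum dist m δ v ≤ z)) ∧
    (z < 0 → (normSum dist m δ v ≤ z → studentSum dist m v ≤ z) ∧
      (studentSum dist m v ≤ z → normSum dist m (-δ) v ≤ z)) := by
  have hQ' := abs_le.mp hQ
  have hp' := abs_le.mp hp
  have hδ0 : 0 ≤ δ := (abs_nonneg _).trans hp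
  have hn : ∀ c, |c| ≤ δ → normSum dist m c v = vecSum v / Real.sqrt (vecQuad dist m v + c) := by
    intro c hc
    have hc' := abs_le.mp hc
    rw [normSum, invRoot, min_eq_left (by linarith [hQ'.2, hc'.2]),
      max_eq_right (by linarith [hQ'.1, hc'.1]), div_eq_mul_inv]
  rw [hn δ (abs_of_nonneg hδ0).le, hn (-δ) (by rw [abs_neg, abs_of_nonneg hδ0]), studentSum]
  set p := vecSum v * (∑ i, nearSum dist m v i) / Fintype.card ι
  rw [max_eq_left (show 0 ≤ vecQuad dist m v - p by linarith [hQ'.1, hp'.2])]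
  have h1 := div_sqrt_le_of_le (s := vecSum v) (z := z) (u := vecQuad dist m v + -δ)
    (v := vecQuad dist m v - p) (by linarith [hQ'.1]) (by linarith [hp'.2])
  have h2 := div_sqrt_le_of_le (s := vecSum v) (z := z) (u := vecQuad dist m v - p)
    (v := vecQuad dist m v + δ) (by linarith [hQ'.1, hp'.2]) (by linarith [hp'.1])
  exact ⟨fun hz => ⟨h1.1 hz, h2.1 hz⟩, fun hz => ⟨h2.2 hz, h1.2 hz⟩⟩

/-- If two events agree with a third one up to a small event, so do their probabilities. -/
lemma abs_measureReal_sub_le [MeasurableSpace Ω] {μ : Measure Ω} [IsProbabilityMeasure μ]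
    {A B C E : Set Ω} {p r : ℝ} (hBA : B \ E ⊆ A) (hAC : A \ E ⊆ C)
    (hB : |μ.real B - p| ≤ r) (hC : |μ.real C - p| ≤ r) : |μ.real A - p| ≤ r + μ.real E := by
  have h1 : μ.real B ≤ μ.real A + μ.real E :=
    (measureReal_mono (fun ω hω => by
      by_cases h : ω ∈ E
      · exact Or.inr h
      · exact Or.inl (hBA ⟨hω, h⟩))).trans (measureReal_union_le A E)
  have h2 : μ.real A ≤ μ.real C + μ.real E :=
    (measureReal_mono (fun ω hω => by
      by_cases h : ω ∈ E
      · exact Or.inr h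
      · exact Or.inl (hAC ⟨hω, h⟩))).trans (measureReal_union_le C E)
  rw [abs_le] at *
  constructor <;> linarith [hB.1, hC.2]

namespace LocalField

variable [mΩ : MeasurableSpace Ω] {μ : Measure Ω} [IsProbabilityMeasure μ] {x : Ω → ι → ℝ}
  {dist : ι → ι → ℕ} {m : ℕ} {D : ℝ}

lemma bddMeas_nearSum_sum (h : LocalField μ x dist m D)
    : BddMeas mΩ fun ω => ∑ i, nearSum dist m (x ω) i :=
  .sum fun _ _ => h.bddMeas_of_coord (h.bddMeas_nearSum Finset.Subset.rfl)

/-- Second moment of the sum of all local sums. -/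
lemma integral_sum_nearSum_sq_le (h : LocalField μ x dist m D)
    {a : ℝ} (ha : ∑ i, ∫ ω, x ω i ^ 2 ∂μ ≤ a)
    (he : ∑ i, |∫ ω, x ω i ∂μ| ≤ 1) :
    ∫ ω, (∑ i, nearSum dist m (x ω) i) ^ 2 ∂μ ≤ 2 * D ^ 3 * a + 2 * D ^ 2 := by
  have hD := h.pos
  obtain ⟨b, hb⟩ : ∃ b : ι → ℝ, b = fun j => ((distBall dist m 1 j).card : ℝ) := ⟨_, rfl⟩
  have hb0 : ∀ j, 0 ≤ b j := fun j => by rw [hb]; exact Nat.cast_nonneg _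
  have hbD : ∀ j, b j ≤ D := fun j => by rw [hb]; exact h.card_ball_le (by norm_num) j
  -- The sum of local sums is again a weighted sum of the field, with the ball sizes, at most `D`,
  -- as weights.
  have hsum : ∀ ω, ∑ i, nearSum dist m (x ω) i = ∑ j, b j * x ω j := fun ω => by
    unfold nearSum
    rw [h.sum_sum_ball_comm 1 fun _ j => x ω j]
    exact Finset.sum_congr rfl fun j _ => by rw [Finset.sum_const, nsmul_eq_mul, hb]
  have hfun : (fun ω => (∑ i, nearSum dist m (x ω) i) ^ 2) = fun ω => (∑ j, b j * x ω j) ^ 2 :=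
    funext fun ω => by rw [hsum]
  rw [hfun]
  clear hfun hsum
  set M := ∑ j, ∫ ω, b j * x ω j ∂μ with hM
  have hvar := h.integral_sq_sum_sub_le (u := fun j ω => b j * x ω j)
    (fun j => (BddMeas.const _).mul (h.bddMeas_coord (h.mem_distBall_self 2 j))) Finset.univ
  have hM2 : M ^ 2 ≤ D ^ 2 := by
    rw [← sq_abs]
    gcongr
    calc |M| ≤ ∑ j, |∫ ω, b j * x ω j ∂μ| := Finset.abs_sum_le_sum_abs _ _
      _ ≤ ∑ j, D * |∫ ω, x ω j ∂μ| := Finset.sum_le_sum fun j _ => by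
          rw [integral_const_mul, abs_mul, abs_of_nonneg (hb0 j)]
          exact mul_le_mul_of_nonneg_right (hbD j) (abs_nonneg _)
      _ = D * ∑ j, |∫ ω, x ω j ∂μ| := by rw [Finset.mul_sum]
      _ ≤ D * 1 := by gcongr
      _ = D := mul_one D
  have hsq : ∑ j, ∫ ω, (b j * x ω j) ^ 2 ∂μ ≤ D ^ 2 * a := by
    calc _ ≤ ∑ j, D ^ 2 * ∫ ω, x ω j ^ 2 ∂μ := by
          refine Finset.sum_le_sum fun j _ => ?_
          simp_rw [mul_pow]
          rw [integral_const_mul]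
          refine mul_le_mul_of_nonneg_right ?_ (integral_nonneg fun ω => by positivity)
          exact pow_le_pow_left₀ (hb0 j) (hbD j) 2
      _ = D ^ 2 * ∑ j, ∫ ω, x ω j ^ 2 ∂μ := by rw [Finset.mul_sum]
      _ ≤ _ := by gcongr
  have hs : BddMeas mΩ fun ω => ∑ j, b j * x ω j :=
    .sum fun j _ => (BddMeas.const _).mul (h.bddMeas j)
  have h1 := integral_mono (μ := μ) (hs.pow 2).integrable
    (((BddMeas.const 2).mul ((hs.sub (.const M)).pow 2)).add (.const (2 * M ^ 2))).integrable
    fun ω => by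
      simp only
      nlinarith [sq_nonneg (∑ j, b j * x ω j - M - M)]
  rw [integral_add ((BddMeas.const 2).mul ((hs.sub (.const M)).pow 2)).integrable
    (integrable_const _), integral_const_mul, integral_const, probReal_univ, one_smul] at h1
  have h2 := hvar.trans (mul_le_mul_of_nonneg_left hsq hD.le)
  calc _ ≤ _ := h1
    _ ≤ 2 * (D * (D ^ 2 * a)) + 2 * D ^ 2 := by gcongr
    _ = _ := by ring

/-- Normal approximation of the studentized sum of a bounded local field. -/
theorem student_bound (h : LocalField μ x dist m D)
    {θ a δ : ℝ} (hθ : 0 < θ) (hθ1 : θ ≤ 1 / 32) (hδ0 : 0 < δ) (hδ : δ ≤ 1 / 8)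
    (hδn : (Fintype.card ι : ℝ) * δ ^ 2 = 1)
    (hΓ : 4096 * (D ^ 3 * ∑ i, ∫ ω, |x ω i| ^ 3 ∂μ) ≤ θ ^ 3)
    (ha : ∑ i, ∫ ω, x ω i ^ 2 ∂μ ≤ a)
    (he : ∑ i, |∫ ω, x ω i ∂μ| ≤ 1) (hQ : |∫ ω, vecQuad dist m (x ω) ∂μ - 1| ≤ 1 / 8) (z : ℝ) :
    |μ.real {ω | studentSum dist m (x ω) ≤ z} - stdCdf z|
      ≤ 300100 * (θ ^ 3 * (1 + D * a) + (D * (1 + D * a)) * δ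
        + |∫ ω, vecQuad dist m (x ω) ∂μ - 1| + ∑ i, |∫ ω, x ω i ∂μ|) := by
  have hD := h.one_le
  have hD0 := h.pos
  have ha0 : 0 ≤ a := le_trans (Finset.sum_nonneg fun i _ => integral_nonneg fun ω => by
    positivity) ha
  have hcard : (0 : ℝ) < Fintype.card ι := by
    by_contra hcon
    have : (Fintype.card ι : ℝ) = 0 := le_antisymm (not_lt.mp hcon) (Nat.cast_nonneg _)
    rw [this, zero_mul] at hδn
    exact zero_ne_one hδn
  set bad1 : Set Ω := {ω | (1 / 4 : ℝ) ^ 2 ≤ (vecQuad dist m (x ω) - 1) ^ 2} with hbad1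
  set bad2 : Set Ω := {ω | δ ≤ |vecSum (x ω) * (∑ i, nearSum dist m (x ω) i) / Fintype.card ι|}
    with hbad2
  have hpt : ∀ c, |c| ≤ δ → |μ.real {ω | normSum dist m c (x ω) ≤ z} - stdCdf z|
      ≤ 300000 * (θ ^ 3 * (1 + D * a) + δ + |∫ ω, vecQuad dist m (x ω) ∂μ - 1|
        + ∑ i, |∫ ω, x ω i ∂μ|) := fun c hc =>
    (h.stein_bound hθ hθ1 (hc.trans hδ) hΓ ha he hQ z).trans (by gcongr)
  have hgood : ∀ ω ∉ bad1 ∪ bad2, |vecQuad dist m (x ω) - 1| ≤ 1 / 4 ∧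
      |vecSum (x ω) * (∑ i, nearSum dist m (x ω) i) / Fintype.card ι| ≤ δ := by
    intro ω hω
    rw [Set.mem_union, not_or] at hω
    refine ⟨abs_le_of_sq_le_sq (le_of_lt (not_le.mp hω.1)) (by norm_num), (not_le.mp hω.2).le⟩
  have hmid : |μ.real {ω | studentSum dist m (x ω) ≤ z} - stdCdf z|
      ≤ 300000 * (θ ^ 3 * (1 + D * a) + δ + |∫ ω, vecQuad dist m (x ω) ∂μ - 1|
        + ∑ i, |∫ ω, x ω i ∂μ|) + μ.real (bad1 ∪ bad2) := by
    have hp1 : |δ| ≤ δ := (abs_of_pos hδ0).le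
    have hp2 : |-δ| ≤ δ := by rw [abs_neg]; exact hp1
    rcases le_or_gt 0 z with hz | hz
    · refine abs_measureReal_sub_le (B := {ω | normSum dist m (-δ) (x ω) ≤ z})
        (C := {ω | normSum dist m δ (x ω) ≤ z}) ?_ ?_ (hpt _ hp2) (hpt _ hp1)
      · rintro ω ⟨h1, h2⟩
        exact ((studentSum_sandwich hδ (hgood ω h2).1 (hgood ω h2).2 z).1 hz).1 h1
      · rintro ω ⟨h1, h2⟩
        exact ((studentSum_sandwich hδ (hgood ω h2).1 (hgood ω h2).2 z).1 hz).2 h1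
    · refine abs_measureReal_sub_le (B := {ω | normSum dist m δ (x ω) ≤ z})
        (C := {ω | normSum dist m (-δ) (x ω) ≤ z}) ?_ ?_ (hpt _ hp1) (hpt _ hp2)
      · rintro ω ⟨h1, h2⟩
        exact ((studentSum_sandwich hδ (hgood ω h2).1 (hgood ω h2).2 z).2 hz).1 h1
      · rintro ω ⟨h1, h2⟩
        exact ((studentSum_sandwich hδ (hgood ω h2).1 (hgood ω h2).2 z).2 hz).2 h1
  have hΓ0 : 0 ≤ ∑ i, ∫ ω, |x ω i| ^ 3 ∂μ :=
    Finset.sum_nonneg fun i _ => integral_nonneg fun ω => by positivity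
  have hb1 : μ.real bad1 ≤ 16 * (2 * θ ^ 3 + 2 * |∫ ω, vecQuad dist m (x ω) ∂μ - 1|) := by
    have h1 := mul_meas_ge_le_integral_of_nonneg (μ := μ)
      (Filter.Eventually.of_forall fun ω => sq_nonneg (vecQuad dist m (x ω) - 1))
      ((h.bddMeas_vecQuad.sub (.const 1)).pow 2).integrable ((1 / 4) ^ 2)
    have h2 := h.integral_vecQuad_sub_one_sq_le hQ
    have h3 : D ^ 2 * ∑ i, ∫ ω, |x ω i| ^ 3 ∂μ ≤ θ ^ 3 := by
      have h4 : D ^ 2 * ∑ i, ∫ ω, |x ω i| ^ 3 ∂μ ≤ D ^ 3 * ∑ i, ∫ ω, |x ω i| ^ 3 ∂μ := by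
        gcongr
        norm_num [hD]
      have h5 : 0 ≤ D ^ 3 * ∑ i, ∫ ω, |x ω i| ^ 3 ∂μ := by positivity
      linarith
    change (1 / 4 : ℝ) ^ 2 * μ.real bad1 ≤ _ at h1
    linarith
  have hb2 : μ.real bad2 ≤ (5 / 2 * D + D ^ 2 * a) * δ := by
    have hS : ∫ ω, vecSum (x ω) ^ 2 ∂μ ≤ 3 := by
      refine h.integral_vecSum_sq_le.trans ?_
      have : (∑ i, |∫ ω, x ω i ∂μ|) ^ 2 ≤ 1 :=
        pow_le_one₀ (Finset.sum_nonneg fun i _ => abs_nonneg _) he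
      linarith [(_root_.abs_le.mp hQ).2]
    have hT := h.integral_sum_nearSum_sq_le ha he
    have hST := h.bddMeas_vecSum.mul h.bddMeas_nearSum_sum
    have hbm : BddMeas mΩ fun ω =>
        |vecSum (x ω) * (∑ i, nearSum dist m (x ω) i) / Fintype.card ι| := by
      simp only [div_eq_mul_inv]
      exact (hST.mul (.const _)).abs
    have h1 := mul_meas_ge_le_integral_of_nonneg (μ := μ)
      (Filter.Eventually.of_forall fun ω => abs_nonneg
        (vecSum (x ω) * (∑ i, nearSum dist m (x ω) i) / Fintype.card ι)) hbm.integrable δ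
    change δ * μ.real bad2 ≤ _ at h1
    -- Here `δ² = 1 / n`. The weighted inequality `|s t| ≤ (D / 2) s² + t² / (2 D)` balances the two
    -- second moments, the sum of local sums being of order up to `D` times `S`. Markov's inequality
    -- at level `δ` then leaves one factor `δ`.
    have h2 : ∫ ω, |vecSum (x ω) * (∑ i, nearSum dist m (x ω) i) / Fintype.card ι| ∂μ
        ≤ δ ^ 2 * (D / 2 * 3 + 1 / (2 * D) * (2 * D ^ 3 * a + 2 * D ^ 2)) := by
      calc _ ≤ ∫ ω, δ ^ 2 * (D / 2 * vecSum (x ω) ^ 2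
            + 1 / (2 * D) * (∑ i, nearSum dist m (x ω) i) ^ 2) ∂μ := by
            refine integral_mono hbm.integrable ((BddMeas.const _).mul (((BddMeas.const _).mul
              (h.bddMeas_vecSum.pow 2)).add ((BddMeas.const _).mul
              (h.bddMeas_nearSum_sum.pow 2)))).integrable fun ω => ?_
            simp only
            set s := vecSum (x ω)
            set t := ∑ i, nearSum dist m (x ω) i
            have e1 : (Fintype.card ι : ℝ)⁻¹ = δ ^ 2 := by
              field_simp
              linarith
            rw [div_eq_mul_inv, e1, abs_mul, abs_of_pos (show 0 < δ ^ 2 by positivity), mul_comm]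
            gcongr
            have e2 : D / 2 * s ^ 2 + 1 / (2 * D) * t ^ 2 - |s * t|
                = (D * |s| - |t|) ^ 2 / (2 * D) := by
              rw [abs_mul, ← sq_abs s, ← sq_abs t]
              field_simp
              ring
            have e3 : 0 ≤ (D * |s| - |t|) ^ 2 / (2 * D) := by positivity
            linarith
        _ = δ ^ 2 * (D / 2 * ∫ ω, vecSum (x ω) ^ 2 ∂μ
            + 1 / (2 * D) * ∫ ω, (∑ i, nearSum dist m (x ω) i) ^ 2 ∂μ) := by
            rw [integral_const_mul, integral_add
              ((BddMeas.const _).mul (h.bddMeas_vecSum.pow 2)).integrable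
              ((BddMeas.const _).mul (h.bddMeas_nearSum_sum.pow 2)).integrable,
              integral_const_mul, integral_const_mul]
        _ ≤ _ := by gcongr
    have h3 : δ * μ.real bad2 ≤ δ * ((5 / 2 * D + D ^ 2 * a) * δ) := by
      refine h1.trans (h2.trans (le_of_eq ?_))
      field_simp
      ring
    exact le_of_mul_le_mul_left h3 hδ0
  have hbad := measureReal_union_le (μ := μ) bad1 bad2
  have hM0 := abs_nonneg (∫ ω, vecQuad dist m (x ω) ∂μ - 1)
  have he0 : 0 ≤ ∑ i, |∫ ω, x ω i ∂μ| := Finset.sum_nonneg fun i _ => abs_nonneg _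
  have hθ3 : 0 ≤ θ ^ 3 * (D * a) := by positivity
  have hθ4 : 0 ≤ θ ^ 3 := by positivity
  have h1 : δ ≤ D * δ := by nlinarith
  have h2 : 0 ≤ D ^ 2 * a * δ := by positivity
  linarith

end LocalField

end Field

/-! ### Truncation -/

section Cutoff

/-- The truncation of `t` at the level `c`. -/
noncomputable def cutoff (c t : ℝ) : ℝ := if |t| ≤ c then t else 0

lemma measurable_cutoff (c : ℝ) : Measurable (cutoff c) :=
  Measurable.ite (measurableSet_le measurable_norm measurable_const) measurable_id measurable_const

lemma abs_cutoff_le {c : ℝ} (hc : 0 ≤ c) (t : ℝ) : |cutoff c t| ≤ c := by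
  unfold cutoff
  split_ifs with h
  · exact h
  · simpa using hc

lemma abs_cutoff_le_abs (c t : ℝ) : |cutoff c t| ≤ |t| := by
  unfold cutoff
  split_ifs
  · exact le_rfl
  · simp

lemma abs_cutoff_sub_le {c : ℝ} (hc : 0 < c) (t : ℝ) : |cutoff c t - t| ≤ c⁻¹ ^ 2 * |t| ^ 3 := by
  unfold cutoff
  split_ifs with h
  · rw [sub_self, abs_zero]
    positivity
  · rw [zero_sub, abs_neg, inv_pow, ← div_eq_inv_mul, le_div_iff₀ (by positivity)]
    have : c ^ 2 ≤ |t| ^ 2 := pow_le_pow_left₀ hc.le (not_le.mp h).le 2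
    nlinarith [abs_nonneg t]

/-- The two sides of the difference disagree only if the larger of `|s|`, `|t|` exceeds `c`, and
then `|s t| ≤ max² ≤ c⁻¹ max³`. -/
lemma abs_cutoff_mul_sub_le {c : ℝ} (hc : 0 < c) (s t : ℝ) :
    |cutoff c s * cutoff c t - s * t| ≤ c⁻¹ * (|s| ^ 3 + |t| ^ 3) := by
  have key : c ≤ max |s| |t| → |s * t| ≤ c⁻¹ * (|s| ^ 3 + |t| ^ 3) := by
    intro h
    rw [← div_eq_inv_mul, le_div_iff₀ hc, abs_mul]
    have hs := abs_nonneg s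
    have ht := abs_nonneg t
    rcases le_total |s| |t| with hst | hst
    · rw [max_eq_right hst] at h
      have h1 : |s| * |t| ≤ |t| * |t| := by gcongr
      have h2 : |s| * |t| * c ≤ |t| * |t| * |t| := by gcongr
      have h3 : 0 ≤ |s| ^ 3 := by positivity
      linarith [h2, show |t| * |t| * |t| = |t| ^ 3 by ring]
    · rw [max_eq_left hst] at h
      have h2 : |s| * |t| * c ≤ |s| * |s| * |s| := by gcongr
      have h3 : 0 ≤ |t| ^ 3 := by positivity
      linarith [h2, show |s| * |s| * |s| = |s| ^ 3 by ring]
  unfold cutoff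
  split_ifs with h1 h2 h2
  · rw [sub_self, abs_zero]
    positivity
  · rw [mul_zero, zero_sub, abs_neg]
    exact key (le_max_of_le_right (not_le.mp h2).le)
  · rw [zero_mul, zero_sub, abs_neg]
    exact key (le_max_of_le_left (not_le.mp h1).le)
  · rw [zero_mul, zero_sub, abs_neg]
    exact key (le_max_of_le_left (not_le.mp h1).le)

/-- Young's inequality, with equality at `t = s`. With `s = q / p` it gives the Hölder bound
`n^(1/3) Γ^(2/3)` for the sum of second moments. -/
lemma sq_le_cube_add_sq {s t : ℝ} (hs : 0 < s) (ht : 0 ≤ t) :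
    t ^ 2 ≤ 2 / (3 * s) * t ^ 3 + s ^ 2 / 3 := by
  have h : 2 / (3 * s) * t ^ 3 + s ^ 2 / 3 - t ^ 2 = (t - s) ^ 2 * (2 * t + s) / (3 * s) := by
    field_simp
    ring
  have : 0 ≤ (t - s) ^ 2 * (2 * t + s) / (3 * s) := by positivity
  linarith

end Cutoff

section Field

variable {ι Ω : Type*} [Fintype ι] [DecidableEq ι] [mΩ : MeasurableSpace Ω] {μ : Measure Ω}
  [IsProbabilityMeasure μ] {U : Ω → ι → ℝ} {dist : ι → ι → ℕ} {m : ℕ} {D : ℝ}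

lemma localField_cutoff (dist_self : ∀ i, dist i i = 0) (dist_comm : ∀ i j, dist i j = dist j i)
    (dist_triangle : ∀ i j k, dist i k ≤ dist i j + dist j k) (one_le : 1 ≤ D)
    (card_ball : ∀ i, ((distBall dist m 5 i).card : ℝ) ≤ D)
    (meas : ∀ i, Measurable fun ω => U ω i)
    (indep : ∀ A B : Finset ι, (∀ i ∈ A, ∀ j ∈ B, m < dist i j) →
      Indep (coordSigma U A) (coordSigma U B) μ) :
    LocalField μ (fun ω i => cutoff D⁻¹ (U ω i)) dist m D where
  dist_self := dist_self
  dist_comm := dist_comm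
  dist_triangle := dist_triangle
  one_le := one_le
  card_ball := card_ball
  meas i := (measurable_cutoff _).comp (meas i)
  abs_le ω i := abs_cutoff_le (inv_nonneg.mpr (by linarith)) _
  indep A B hAB := by
    have hle : ∀ A : Finset ι,
        coordSigma (fun ω i => cutoff D⁻¹ (U ω i)) A ≤ coordSigma U A := by
      intro A
      have : (fun ω (i : A) => cutoff D⁻¹ (U ω i))
        = (fun (w : A → ℝ) (i : A) => cutoff D⁻¹ (w i)) ∘ fun ω (i : A) => U ω i := rfl
      rw [coordSigma, coordSigma, this, ← MeasurableSpace.comap_comp]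
      apply MeasurableSpace.comap_mono
      rw [← measurable_iff_comap_le]
      exact measurable_pi_lambda _ fun i => (measurable_cutoff _).comp (measurable_pi_apply i)
    exact indep_of_indep_of_le_left (indep_of_indep_of_le_right (indep A B hAB) (hle B)) (hle A)

lemma integrable_of_abs_cube {f : Ω → ℝ} (hf : Measurable f)
    (h3 : Integrable (fun ω => |f ω| ^ 3) μ) : Integrable f μ := by
  refine Integrable.mono' ((integrable_const (1 : ℝ)).add h3) hf.aestronglyMeasurable
    (Filter.Eventually.of_forall fun ω => ?_)
  simp only [Pi.add_apply, Real.norm_eq_abs]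
  have := abs_nonneg (f ω)
  nlinarith [mul_nonneg this (sq_nonneg (|f ω| - 1)), sq_nonneg (|f ω| - 1)]

lemma integrable_mul_of_abs_cube {f g : Ω → ℝ} (hf : Measurable f) (hg : Measurable g)
    (hf3 : Integrable (fun ω => |f ω| ^ 3) μ) (hg3 : Integrable (fun ω => |g ω| ^ 3) μ) :
    Integrable (fun ω => f ω * g ω) μ := by
  refine Integrable.mono' (((integrable_const (1 : ℝ)).add hf3).add hg3)
    (hf.mul hg).aestronglyMeasurable (Filter.Eventually.of_forall fun ω => ?_)
  simp only [Pi.add_apply, Real.norm_eq_abs, abs_mul]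
  have h1 := sq_le_cube_add_sq one_pos (abs_nonneg (f ω))
  have h2 := sq_le_cube_add_sq one_pos (abs_nonneg (g ω))
  have h3 : 0 ≤ |f ω| ^ 3 := by positivity
  have h4 : 0 ≤ |g ω| ^ 3 := by positivity
  nlinarith [sq_nonneg (|f ω| - |g ω|)]

lemma integral_abs_cutoff_cube_le {f : Ω → ℝ} (hf : Measurable f)
    (h3 : Integrable (fun ω => |f ω| ^ 3) μ) (c : ℝ) :
    ∫ ω, |cutoff c (f ω)| ^ 3 ∂μ ≤ ∫ ω, |f ω| ^ 3 ∂μ := by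
  have hle : ∀ ω, |cutoff c (f ω)| ^ 3 ≤ |f ω| ^ 3 := fun ω =>
    pow_le_pow_left₀ (abs_nonneg _) (abs_cutoff_le_abs _ _) 3
  refine integral_mono (h3.mono'
    (((measurable_cutoff c).comp hf).norm.pow_const 3).aestronglyMeasurable
    (Filter.Eventually.of_forall fun ω => ?_)) h3 hle
  rw [Real.norm_eq_abs, abs_of_nonneg (by positivity)]
  exact hle ω

lemma abs_integral_cutoff_le {f : Ω → ℝ} (hf : Measurable f)
    (h3 : Integrable (fun ω => |f ω| ^ 3) μ) (h0 : ∫ ω, f ω ∂μ = 0) {c : ℝ} (hc : 0 < c) :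
    |∫ ω, cutoff c (f ω) ∂μ| ≤ c⁻¹ ^ 2 * ∫ ω, |f ω| ^ 3 ∂μ := by
  have hi : Integrable (fun ω => cutoff c (f ω)) μ :=
    (BddMeas.of_le ((measurable_cutoff c).comp hf) c fun ω => abs_cutoff_le hc.le _).integrable
  have h1 : ∫ ω, cutoff c (f ω) ∂μ = ∫ ω, (cutoff c (f ω) - f ω) ∂μ := by
    rw [integral_sub hi (integrable_of_abs_cube hf h3), h0, sub_zero]
  rw [h1, ← integral_const_mul]
  exact norm_integral_le_of_norm_le (h3.const_mul (c⁻¹ ^ 2))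
    (Filter.Eventually.of_forall fun ω => by
      rw [Real.norm_eq_abs]
      exact abs_cutoff_sub_le hc (f ω))

lemma abs_integral_cutoff_mul_sub_le {f g : Ω → ℝ} (hf : Measurable f) (hg : Measurable g)
    (hf3 : Integrable (fun ω => |f ω| ^ 3) μ) (hg3 : Integrable (fun ω => |g ω| ^ 3) μ)
    {c : ℝ} (hc : 0 < c) :
    |∫ ω, cutoff c (f ω) * cutoff c (g ω) ∂μ - ∫ ω, f ω * g ω ∂μ|
      ≤ c⁻¹ * (∫ ω, |f ω| ^ 3 ∂μ + ∫ ω, |g ω| ^ 3 ∂μ) := by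
  have hi : Integrable (fun ω => cutoff c (f ω) * cutoff c (g ω)) μ :=
    ((BddMeas.of_le ((measurable_cutoff c).comp hf) c fun ω => abs_cutoff_le hc.le _).mul
      (BddMeas.of_le ((measurable_cutoff c).comp hg) c fun ω => abs_cutoff_le hc.le _)).integrable
  rw [← integral_sub hi (integrable_mul_of_abs_cube hf hg hf3 hg3), ← integral_add hf3 hg3,
    ← integral_const_mul]
  exact norm_integral_le_of_norm_le ((hf3.add hg3).const_mul c⁻¹)
    (Filter.Eventually.of_forall fun ω => by
      rw [Real.norm_eq_abs]
      exact abs_cutoff_mul_sub_le hc (f ω) (g ω))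

/-- A Lyapunov type bound for the sum of the second moments. -/
lemma sum_integral_sq_le {x : Ω → ι → ℝ} (hx : ∀ i, BddMeas mΩ fun ω => x ω i) {p q : ℝ}
    (hp : 0 < p) (hq : 0 < q) (hpn : p ^ 3 = Fintype.card ι)
    (hqx : ∑ i, ∫ ω, |x ω i| ^ 3 ∂μ ≤ q ^ 3) : ∑ i, ∫ ω, x ω i ^ 2 ∂μ ≤ p * q ^ 2 := by
  have hs : 0 < q / p := by positivity
  have h1 : ∀ i, ∫ ω, x ω i ^ 2 ∂μ
      ≤ 2 / (3 * (q / p)) * ∫ ω, |x ω i| ^ 3 ∂μ + (q / p) ^ 2 / 3 := by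
    intro i
    have hb := ((BddMeas.const (2 / (3 * (q / p)))).mul ((hx i).abs.pow 3))
    have := integral_mono (μ := μ) ((hx i).pow 2).integrable
      (hb.add (.const ((q / p) ^ 2 / 3))).integrable fun ω => by
        simp only
        rw [← sq_abs]
        exact sq_le_cube_add_sq hs (abs_nonneg _)
    rwa [integral_add hb.integrable (integrable_const _), integral_const_mul, integral_const,
      probReal_univ, one_smul] at this
  calc _ ≤ ∑ i, (2 / (3 * (q / p)) * ∫ ω, |x ω i| ^ 3 ∂μ + (q / p) ^ 2 / 3) :=
        Finset.sum_le_sum fun i _ => h1 i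
    _ = 2 / (3 * (q / p)) * ∑ i, ∫ ω, |x ω i| ^ 3 ∂μ + p ^ 3 * ((q / p) ^ 2 / 3) := by
        rw [Finset.sum_add_distrib, ← Finset.mul_sum, Finset.sum_const, Finset.card_univ,
          nsmul_eq_mul, hpn]
    _ ≤ 2 / (3 * (q / p)) * q ^ 3 + p ^ 3 * ((q / p) ^ 2 / 3) := by gcongr
    _ = p * q ^ 2 := by
        field_simp
        norm_num

lemma measureReal_exists_lt_le
    (int : ∀ i, Integrable (fun ω => |U ω i| ^ 3) μ) {c : ℝ} (hc : 0 < c) :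
    μ.real {ω | ∃ i, c < |U ω i|} ≤ c⁻¹ ^ 3 * ∑ i, ∫ ω, |U ω i| ^ 3 ∂μ := by
  have h1 : {ω | ∃ i, c < |U ω i|} = ⋃ i ∈ (Finset.univ : Finset ι), {ω | c < |U ω i|} := by
    ext
    simp
  rw [h1, Finset.mul_sum]
  refine (measureReal_biUnion_finset_le _ _).trans (Finset.sum_le_sum fun i _ => ?_)
  have h2 := mul_meas_ge_le_integral_of_nonneg (μ := μ)
    (Filter.Eventually.of_forall fun ω => by positivity) (int i) (c ^ 3)
  have h3 : μ.real {ω | c < |U ω i|} ≤ μ.real {ω | c ^ 3 ≤ |U ω i| ^ 3} :=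
    measureReal_mono fun ω hω => pow_le_pow_left₀ hc.le (le_of_lt hω) 3
  rw [inv_pow, ← div_eq_inv_mul, le_div_iff₀ (by positivity), mul_comm]
  exact (mul_le_mul_of_nonneg_left h3 (by positivity)).trans h2

end Field

/-! ### Normal approximation without truncation -/

section Field

variable {ι Ω : Type*} [Fintype ι] [DecidableEq ι] [mΩ : MeasurableSpace Ω] {μ : Measure Ω}
  [IsProbabilityMeasure μ] {U : Ω → ι → ℝ} {dist : ι → ι → ℕ} {m : ℕ} {D : ℝ}

lemma abs_integral_vecQuad_cutoff_sub_one_le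
    (h : LocalField μ (fun ω i => cutoff D⁻¹ (U ω i)) dist m D)
    (meas : ∀ i, Measurable fun ω => U ω i)
    (int : ∀ i, Integrable (fun ω => |U ω i| ^ 3) μ)
    (norm : ∑ i, ∫ ω, U ω i * nearSum dist m (U ω) i ∂μ = 1) :
    |∫ ω, vecQuad dist m (fun i => cutoff D⁻¹ (U ω i)) ∂μ - 1|
      ≤ 2 * D ^ 2 * ∑ i, ∫ ω, |U ω i| ^ 3 ∂μ := by
  have hD := h.pos
  have hc : 0 < D⁻¹ := inv_pos.mpr hD
  have hi : ∀ i j, Integrable (fun ω => U ω i * U ω j) μ := fun i j =>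
    integrable_mul_of_abs_cube (meas i) (meas j) (int i) (int j)
  have hb : ∀ i j, BddMeas mΩ fun ω => cutoff D⁻¹ (U ω i) * cutoff D⁻¹ (U ω j) := fun i j =>
    (h.bddMeas i).mul (h.bddMeas j)
  have e1 : ∫ ω, vecQuad dist m (fun i => cutoff D⁻¹ (U ω i)) ∂μ
      = ∑ i, ∑ j ∈ distBall dist m 1 i, ∫ ω, cutoff D⁻¹ (U ω i) * cutoff D⁻¹ (U ω j) ∂μ := by
    simp only [vecQuad, nearSum, Finset.mul_sum]
    rw [integral_finsetSum _ fun i _ => integrable_finsetSum _ fun j _ => (hb i j).integrable]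
    exact Finset.sum_congr rfl fun i _ => integral_finsetSum _ fun j _ => (hb i j).integrable
  have e2 : (1 : ℝ) = ∑ i, ∑ j ∈ distBall dist m 1 i, ∫ ω, U ω i * U ω j ∂μ := by
    rw [← norm]
    simp only [nearSum, Finset.mul_sum]
    exact Finset.sum_congr rfl fun i _ => integral_finsetSum _ fun j _ => hi i j
  have hg0 : ∀ i, 0 ≤ ∫ ω, |U ω i| ^ 3 ∂μ := fun i => integral_nonneg fun ω => by positivity
  have hball : ∑ i, ∑ _j ∈ distBall dist m 1 i, ∫ ω, |U ω i| ^ 3 ∂μ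
      ≤ D * ∑ i, ∫ ω, |U ω i| ^ 3 ∂μ := by
    rw [Finset.mul_sum]
    refine Finset.sum_le_sum fun i _ => ?_
    rw [Finset.sum_const, nsmul_eq_mul]
    exact mul_le_mul_of_nonneg_right (h.card_ball_le (by norm_num) i) (hg0 i)
  have hball' : ∑ i, ∑ j ∈ distBall dist m 1 i, ∫ ω, |U ω j| ^ 3 ∂μ
      ≤ D * ∑ i, ∫ ω, |U ω i| ^ 3 ∂μ := by
    rw [h.sum_sum_ball_comm 1 fun _ j => ∫ ω, |U ω j| ^ 3 ∂μ]
    exact hball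
  calc _ = |∑ i, ∑ j ∈ distBall dist m 1 i, (∫ ω, cutoff D⁻¹ (U ω i) * cutoff D⁻¹ (U ω j) ∂μ
          - ∫ ω, U ω i * U ω j ∂μ)| := by
        rw [e1]
        nth_rw 1 [e2]
        simp only [Finset.sum_sub_distrib]
    _ ≤ ∑ i, ∑ j ∈ distBall dist m 1 i, |∫ ω, cutoff D⁻¹ (U ω i) * cutoff D⁻¹ (U ω j) ∂μ
          - ∫ ω, U ω i * U ω j ∂μ| :=
        (Finset.abs_sum_le_sum_abs _ _).trans
          (Finset.sum_le_sum fun i _ => Finset.abs_sum_le_sum_abs _ _)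
    _ ≤ ∑ i, ∑ j ∈ distBall dist m 1 i,
          D * (∫ ω, |U ω i| ^ 3 ∂μ + ∫ ω, |U ω j| ^ 3 ∂μ) := by
        refine Finset.sum_le_sum fun i _ => Finset.sum_le_sum fun j _ => ?_
        have := abs_integral_cutoff_mul_sub_le (meas i) (meas j) (int i) (int j) hc
        rwa [inv_inv] at this
    _ = D * (∑ i, ∑ _j ∈ distBall dist m 1 i, ∫ ω, |U ω i| ^ 3 ∂μ
          + ∑ i, ∑ j ∈ distBall dist m 1 i, ∫ ω, |U ω j| ^ 3 ∂μ) := by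
        simp only [← Finset.mul_sum, Finset.sum_add_distrib]
    _ ≤ D * (D * ∑ i, ∫ ω, |U ω i| ^ 3 ∂μ + D * ∑ i, ∫ ω, |U ω i| ^ 3 ∂μ) :=
        mul_le_mul_of_nonneg_left (add_le_add hball hball') hD.le
    _ = _ := by ring

/-- If all third moments vanished, the field would be zero almost surely, against the normalization.
Positivity of `γ` is what allows `θ > 0`. -/
lemma sum_integral_abs_cube_pos
    (int : ∀ i, Integrable (fun ω => |U ω i| ^ 3) μ)
    (norm : ∑ i, ∫ ω, U ω i * nearSum dist m (U ω) i ∂μ = 1) :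
    0 < ∑ i, ∫ ω, |U ω i| ^ 3 ∂μ := by
  have hg0 : ∀ i, 0 ≤ ∫ ω, |U ω i| ^ 3 ∂μ := fun i => integral_nonneg fun ω => by positivity
  refine lt_of_le_of_ne (Finset.sum_nonneg fun i _ => hg0 i) fun h0 => ?_
  have h1 : ∀ i, ∫ ω, U ω i * nearSum dist m (U ω) i ∂μ = 0 := fun i => by
    have h2 := (Finset.sum_eq_zero_iff_of_nonneg fun i _ => hg0 i).mp h0.symm i (Finset.mem_univ i)
    rw [integral_eq_zero_iff_of_nonneg (fun ω => by positivity) (int i)] at h2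
    refine integral_eq_zero_of_ae ?_
    filter_upwards [h2] with ω hω
    have : U ω i = 0 := by simpa using hω
    simp [this]
  rw [Finset.sum_eq_zero fun i _ => h1 i] at norm
  exact zero_ne_one norm

/-- Normal approximation of the studentized sum of a normalized field with third moments. -/
theorem studentSum_normal_approx (dist_self : ∀ i, dist i i = 0)
    (dist_comm : ∀ i j, dist i j = dist j i)
    (dist_triangle : ∀ i j k, dist i k ≤ dist i j + dist j k) (one_le : 1 ≤ D)
    (card_ball : ∀ i, ((distBall dist m 5 i).card : ℝ) ≤ D)
    (meas : ∀ i, Measurable fun ω => U ω i)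
    (int : ∀ i, Integrable (fun ω => |U ω i| ^ 3) μ)
    (mean : ∀ i, ∫ ω, U ω i ∂μ = 0)
    (indep : ∀ A B : Finset ι, (∀ i ∈ A, ∀ j ∈ B, m < dist i j) →
      Indep (coordSigma U A) (coordSigma U B) μ)
    (norm : ∑ i, ∫ ω, U ω i * nearSum dist m (U ω) i ∂μ = 1) {γ : ℝ}
    (hγ : γ = ∑ i, ∫ ω, |U ω i| ^ 3 ∂μ) (z : ℝ) :
    |μ.real {ω | studentSum dist m (U ω) ≤ z} - stdCdf z|
      ≤ 10 ^ 10 * D ^ 3 * (1 + D * ((Fintype.card ι : ℝ) ^ (1 / 3 : ℝ) * γ ^ (2 / 3 : ℝ)))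
        * (γ + (Fintype.card ι : ℝ) ^ (-(1 / 2) : ℝ)) := by
  have h := localField_cutoff dist_self dist_comm dist_triangle one_le card_ball meas indep
  have hD := h.pos
  have hc : 0 < D⁻¹ := inv_pos.mpr hD
  have hγ0 : 0 < γ := hγ ▸ sum_integral_abs_cube_pos int norm
  have hn : (0 : ℝ) < Fintype.card ι := by
    rw [Nat.cast_pos, Fintype.card_pos_iff]
    by_contra hcon
    rw [not_nonempty_iff] at hcon
    rw [Finset.univ_eq_empty, Finset.sum_empty] at norm
    exact zero_ne_one norm
  set n : ℝ := (Fintype.card ι : ℝ)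
  obtain ⟨p, hp⟩ : ∃ p : ℝ, p = n ^ (1 / 3 : ℝ) := ⟨_, rfl⟩
  obtain ⟨q, hq⟩ : ∃ q : ℝ, q = γ ^ (1 / 3 : ℝ) := ⟨_, rfl⟩
  obtain ⟨δ, hδ⟩ : ∃ δ : ℝ, δ = n ^ (-(1 / 2) : ℝ) := ⟨_, rfl⟩
  have hp0 : 0 < p := hp ▸ Real.rpow_pos_of_pos hn _
  have hq0 : 0 < q := hq ▸ Real.rpow_pos_of_pos hγ0 _
  have hδ0 : 0 < δ := hδ ▸ Real.rpow_pos_of_pos hn _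
  have hp3 : p ^ 3 = n := by
    rw [hp, ← Real.rpow_natCast, ← Real.rpow_mul hn.le]
    norm_num
  have hq3 : q ^ 3 = γ := by
    rw [hq, ← Real.rpow_natCast, ← Real.rpow_mul hγ0.le]
    norm_num
  have hq2 : γ ^ (2 / 3 : ℝ) = q ^ 2 := by
    rw [hq, ← Real.rpow_natCast, ← Real.rpow_mul hγ0.le]
    norm_num
  have hδ2 : n * δ ^ 2 = 1 := by
    rw [hδ, ← Real.rpow_natCast, ← Real.rpow_mul hn.le]
    norm_num [Real.rpow_neg_one]
    exact mul_inv_cancel₀ hn.ne'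
  rw [← hp, ← hδ, hq2]
  set a := p * q ^ 2 with ha
  have ha0 : 0 ≤ a := by positivity
  have hD3 : 1 ≤ D ^ 3 := one_le_pow₀ one_le
  have hbig : D ^ 3 * (γ + δ) ≤ D ^ 3 * (1 + D * a) * (γ + δ) := by
    have : 0 ≤ D ^ 3 * (D * a) * (γ + δ) := by positivity
    linarith
  have htriv : |μ.real {ω | studentSum dist m (U ω) ≤ z} - stdCdf z| ≤ 1 := by
    rw [abs_le]
    have h1 : μ.real {ω | studentSum dist m (U ω) ≤ z} ≤ 1 := measureReal_le_one
    have h2 : 0 ≤ μ.real {ω | studentSum dist m (U ω) ≤ z} := measureReal_nonneg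
    constructor <;> linarith [stdCdf_nonneg z, stdCdf_le_one z]
  have hDγ0 : 0 < D ^ 3 * γ := by positivity
  have hDδ0 : δ ≤ D ^ 3 * δ := le_mul_of_one_le_left hδ0.le hD3
  -- Outside this regime the right side exceeds `1`. Inside it, `θ³ = 4096 D³ γ ≤ 2 ^ (-15)`, that
  -- is, `θ ≤ 1 / 32`.
  by_cases hcase : 2 ^ 27 * (D ^ 3 * γ) ≤ 1 ∧ δ ≤ 1 / 8
  swap
  · refine htriv.trans ?_
    rw [not_and_or, not_le, not_le] at hcase
    rcases hcase with hcase | hcase <;> linarith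
  obtain ⟨hc1, hc2⟩ := hcase
  obtain ⟨θ, hθ⟩ : ∃ θ : ℝ, θ = (4096 * (D ^ 3 * γ)) ^ (1 / 3 : ℝ) := ⟨_, rfl⟩
  have hθ0 : 0 < θ := hθ ▸ Real.rpow_pos_of_pos (by positivity) _
  have hθ3 : θ ^ 3 = 4096 * (D ^ 3 * γ) := by
    rw [hθ, ← Real.rpow_natCast, ← Real.rpow_mul (by positivity)]
    norm_num
  have hθ1 : θ ≤ 1 / 32 := by
    refine le_of_pow_le_pow_left₀ (n := 3) (by norm_num) (by norm_num) ?_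
    rw [hθ3]
    linarith
  have hxγ : ∑ i, ∫ ω, |cutoff D⁻¹ (U ω i)| ^ 3 ∂μ ≤ γ := by
    rw [hγ]
    exact Finset.sum_le_sum fun i _ => integral_abs_cutoff_cube_le (meas i) (int i) _
  have hmean : ∑ i, |∫ ω, cutoff D⁻¹ (U ω i) ∂μ| ≤ D ^ 2 * γ := by
    rw [hγ, Finset.mul_sum]
    refine Finset.sum_le_sum fun i _ => ?_
    have := abs_integral_cutoff_le (meas i) (int i) (mean i) hc
    rwa [inv_inv] at this
  have hquad := abs_integral_vecQuad_cutoff_sub_one_le h meas int norm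
  rw [← hγ] at hquad
  have hD23 : D ^ 2 * γ ≤ D ^ 3 * γ := by
    have : D ^ 2 ≤ D ^ 3 := pow_le_pow_right₀ one_le (by norm_num)
    gcongr
  have hmain := h.student_bound hθ0 hθ1 hδ0 hc2 hδ2
    (by rw [hθ3]; gcongr) (a := a)
    (sum_integral_sq_le h.bddMeas hp0 hq0 hp3 (hxγ.trans hq3.ge))
    (by linarith) (by linarith) z
  have hexc := measureReal_exists_lt_le int hc
  rw [inv_inv, ← hγ] at hexc
  have heq : ∀ ω, ω ∉ {ω | ∃ i, D⁻¹ < |U ω i|} → (fun i => cutoff D⁻¹ (U ω i)) = U ω := by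
    intro ω hω
    funext i
    exact if_pos (not_lt.mp fun hlt => hω ⟨i, hlt⟩)
  -- Off the event that some coordinate is truncated, the two statistics coincide; that event has
  -- probability at most `D³ γ`.
  have hfin := abs_measureReal_sub_le (A := {ω | studentSum dist m (U ω) ≤ z})
    (E := {ω | ∃ i, D⁻¹ < |U ω i|})
    (fun ω hω => by
      have h1 := hω.1
      rw [Set.mem_ofPred_eq, heq ω hω.2] at h1
      exact h1)
    (fun ω hω => by
      rw [Set.mem_ofPred_eq, heq ω hω.2]
      exact hω.1) hmain hmain
  have h1 : D * (1 + D * a) * δ ≤ D ^ 3 * (1 + D * a) * δ := by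
    have : D ≤ D ^ 3 := le_self_pow₀ one_le (by norm_num)
    gcongr
  have h2 : 0 ≤ D ^ 3 * (1 + D * a) * δ := by positivity
  have h3 : D ^ 3 * γ ≤ D ^ 3 * (1 + D * a) * γ := by
    have : 0 ≤ D ^ 3 * (D * a) * γ := by positivity
    linarith
  have h4 : θ ^ 3 * (1 + D * a) = 4096 * (D ^ 3 * (1 + D * a) * γ) := by
    rw [hθ3]
    ring
  rw [h4] at hfin
  linarith

end Field

/-! ### Transfer to the lattice -/

section Lattice

variable {d : ℕ}

lemma latticeDist_le_iff {i j : IntLattice d} {r : ℕ} :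
    latticeDist i j ≤ r ↔ ∀ k, (i k - j k).natAbs ≤ r := by
  simp [latticeDist]

lemma latticeDist_self (i : IntLattice d) : latticeDist i i = 0 :=
  Nat.le_zero.mp (latticeDist_le_iff.mpr fun k => by simp)

lemma latticeDist_comm (i j : IntLattice d) : latticeDist i j = latticeDist j i := by
  unfold latticeDist
  exact Finset.sup_congr rfl fun k _ => by omega

lemma latticeDist_triangle (i j l : IntLattice d) :
    latticeDist i l ≤ latticeDist i j + latticeDist j l := by
  refine latticeDist_le_iff.mpr fun k => ?_
  have h1 := latticeDist_le_iff.mp (le_refl (latticeDist i j)) k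
  have h2 := latticeDist_le_iff.mp (le_refl (latticeDist j l)) k
  omega

variable (J : Finset (IntLattice d))

/-- The distance of `ℤ^d` restricted to a finite set. -/
def subDist (i j : J) : ℕ := latticeDist i.1 j.1

lemma card_distBall_subDist_le (m k : ℕ) (i : J) :
    (distBall (subDist J) m k i).card ≤ (2 * (k * m) + 1) ^ d := by
  have h : (Fintype.piFinset fun l => Finset.Icc (i.1 l - (k * m : ℕ)) (i.1 l + (k * m : ℕ))).card
      = (2 * (k * m) + 1) ^ d := by
    rw [Fintype.card_piFinset]
    have : ∀ l, (Finset.Icc (i.1 l - (k * m : ℕ)) (i.1 l + (k * m : ℕ))).card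
        = 2 * (k * m) + 1 := fun l => by
      rw [Int.card_Icc]
      omega
    simp only [this, Finset.prod_const, Finset.card_univ, Fintype.card_fin]
  rw [← h]
  refine Finset.card_le_card_of_injOn Subtype.val (fun j hj => ?_) Subtype.val_injective.injOn
  rw [Finset.mem_coe, mem_distBall] at hj
  rw [Finset.mem_coe, Fintype.mem_piFinset]
  intro l
  have := latticeDist_le_iff.mp hj l
  rw [Finset.mem_Icc]
  omega

lemma sum_distBall_subDist (m : ℕ) (i : J) (f : IntLattice d → ℝ) :
    ∑ j ∈ distBall (subDist J) m 1 i, f j = ∑ j ∈ nbhd J m i, f j := by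
  rw [distBall, nbhd, Finset.sum_filter, Finset.sum_filter, one_mul]
  exact Finset.sum_coe_sort J fun j => if latticeDist i.1 j ≤ m then f j else 0

variable {J} {Ω : Type*} {X : IntLattice d → Ω → ℝ} {m : ℕ}

lemma indep_coordSigma_of_isMDependentField [MeasurableSpace Ω] {μ : Measure Ω}
    (hX : IsMDependentField μ J X m) (s : ℝ) (A B : Finset J)
    (hAB : ∀ i ∈ A, ∀ j ∈ B, m < subDist J i j) :
    Indep (coordSigma (fun ω (i : J) => X i ω / s) A)
      (coordSigma (fun ω (i : J) => X i ω / s) B) μ := by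
  have hsub : ∀ A : Finset J, A.map (Function.Embedding.subtype (· ∈ J)) ⊆ J := fun A i hi => by
    obtain ⟨j, -, rfl⟩ := Finset.mem_map.mp hi
    exact j.2
  have hlt : (m : ℕ∞) < latticeSetDist (A.map (Function.Embedding.subtype (· ∈ J)))
      (B.map (Function.Embedding.subtype (· ∈ J))) := by
    -- The bound by `m + 1` also covers empty sets, for which the infimum is `⊤`.
    refine lt_of_lt_of_le (b := ((m + 1 : ℕ) : ℕ∞)) (by exact_mod_cast Nat.lt_succ_self m) ?_
    refine le_iInf₂ fun i hi => le_iInf₂ fun j hj => ?_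
    obtain ⟨i, hiA, rfl⟩ := Finset.mem_map.mp hi
    obtain ⟨j, hjB, rfl⟩ := Finset.mem_map.mp hj
    exact_mod_cast hAB i hiA j hjB
  have hind := hX _ _ (hsub A) (hsub B) hlt
  have hle : ∀ A : Finset J, coordSigma (fun ω (i : J) => X i ω / s) A
      ≤ MeasurableSpace.comap
        (fun ω (i : A.map (Function.Embedding.subtype (· ∈ J))) => X i ω) inferInstance := by
    intro A
    have : (fun ω (i : A) => X i ω / s)
      = (fun (w : A.map (Function.Embedding.subtype (· ∈ J)) → ℝ) (i : A) =>
          w ⟨i, Finset.mem_map_of_mem _ i.2⟩ / s)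
        ∘ fun ω (i : A.map (Function.Embedding.subtype (· ∈ J))) => X i ω := rfl
    rw [coordSigma, this, ← MeasurableSpace.comap_comp]
    apply MeasurableSpace.comap_mono
    rw [← measurable_iff_comap_le]
    refine measurable_pi_lambda _ fun i => ?_
    have hmeas : Measurable fun w : A.map (Function.Embedding.subtype (· ∈ J)) → ℝ =>
      w ⟨i, Finset.mem_map_of_mem _ i.2⟩ := measurable_pi_apply _
    exact hmeas.div_const s
  exact indep_of_indep_of_le_left (indep_of_indep_of_le_right hind (hle B)) (hle A)

lemma localSum_eq_mul_nearSum {s : ℝ} (hs : s ≠ 0) (i : J) (ω : Ω) :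
    localSum J X m i ω = s * nearSum (subDist J) m (fun j : J => X j ω / s) i := by
  rw [nearSum, sum_distBall_subDist J m i fun j => X j ω / s, ← Finset.sum_div, localSum]
  field_simp

/-- The statistic is invariant under scaling, so division by `σ` is harmless. Where the normalizer
vanishes, both sides are `0` because division by zero gives `0`. -/
lemma selfNormalizedSum_eq_studentSum {s : ℝ} (hs : 0 < s) (hJ : J.Nonempty) (ω : Ω) :
    selfNormalizedSum J X m ω = studentSum (subDist J) m (fun j : J => X j ω / s) := by
  set v : J → ℝ := fun j => X j ω / s with hv
  have hn : (J.card : ℝ) ≠ 0 := Nat.cast_ne_zero.mpr hJ.card_ne_zero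
  have hX : ∀ i : J, X i ω = s * v i := fun i => (mul_div_cancel₀ _ hs.ne').symm
  have hY : ∀ i : J, localSum J X m i ω = s * nearSum (subDist J) m v i :=
    fun i => localSum_eq_mul_nearSum hs.ne' i ω
  have hS : ∑ i ∈ J, X i ω = s * vecSum v := by
    rw [vecSum, Finset.mul_sum, ← Finset.sum_coe_sort J]
    exact Finset.sum_congr rfl fun i _ => hX i
  have hT : ∑ i ∈ J, localSum J X m i ω = s * ∑ i, nearSum (subDist J) m v i := by
    rw [Finset.mul_sum, ← Finset.sum_coe_sort J]
    exact Finset.sum_congr rfl fun i _ => hY i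
  have hQ : ∑ i ∈ J, X i ω * localSum J X m i ω = s ^ 2 * vecQuad (subDist J) m v := by
    rw [vecQuad, Finset.mul_sum, ← Finset.sum_coe_sort J]
    exact Finset.sum_congr rfl fun i _ => by rw [hX, hY]; ring
  have hV : selfNormalizer J X m ω = s * Real.sqrt (max (vecQuad (subDist J) m v
      - vecSum v * (∑ i, nearSum (subDist J) m v i) / Fintype.card J) 0) := by
    have e : ∑ i ∈ J, (X i ω * localSum J X m i ω
        - fieldMean J X ω * fieldMean J (localSum J X m) ω)
        = s ^ 2 * (vecQuad (subDist J) m v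
          - vecSum v * (∑ i, nearSum (subDist J) m v i) / Fintype.card J) := by
      rw [Finset.sum_sub_distrib, hQ, Finset.sum_const, nsmul_eq_mul, fieldMean, fieldMean, hS, hT,
        Fintype.card_coe]
      field_simp
    rw [selfNormalizer, e, ← mul_zero (s ^ 2), ← mul_max_of_nonneg _ _ (sq_nonneg s),
      Real.sqrt_mul (sq_nonneg s), Real.sqrt_sq hs.le, mul_zero]
  rw [selfNormalizedSum, fieldSum, hS, hV, studentSum, mul_div_mul_left _ _ hs.ne']

lemma sum_integral_mul_nearSum_eq_one [MeasurableSpace Ω] {μ : Measure Ω}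
    (hσ : 0 < sigmaSq J X m μ) :
    ∑ i : J, ∫ ω, X i ω / Real.sqrt (sigmaSq J X m μ)
      * nearSum (subDist J) m (fun j : J => X j ω / Real.sqrt (sigmaSq J X m μ)) i ∂μ = 1 := by
  obtain ⟨s, hs⟩ : ∃ s, s = Real.sqrt (sigmaSq J X m μ) := ⟨_, rfl⟩
  have hs0 : 0 < s := hs ▸ Real.sqrt_pos.mpr hσ
  have hs2 : sigmaSq J X m μ = s ^ 2 := by rw [hs, Real.sq_sqrt hσ.le]
  rw [← hs]
  have h1 : ∀ i : J, ∫ ω, X i ω / s * nearSum (subDist J) m (fun j : J => X j ω / s) i ∂μ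
      = (∫ ω, X i ω * localSum J X m i ω ∂μ) / s ^ 2 := fun i => by
    rw [← integral_div]
    refine integral_congr_ae (Filter.Eventually.of_forall fun ω => ?_)
    simp only
    rw [localSum_eq_mul_nearSum hs0.ne' i ω]
    field_simp
  rw [Finset.sum_congr rfl fun i _ => h1 i, ← Finset.sum_div,
    Finset.sum_coe_sort J fun i => ∫ ω, X i ω * localSum J X m i ω ∂μ]
  change sigmaSq J X m μ / s ^ 2 = 1
  rw [hs2, div_self (by positivity)]

lemma gammaRatio_eq_sum [MeasurableSpace Ω] {μ : Measure Ω} :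
    gammaRatio J X m μ = ∑ i : J, ∫ ω, |X i ω / Real.sqrt (sigmaSq J X m μ)| ^ 3 ∂μ := by
  rw [gammaRatio, ← Finset.sum_coe_sort J]
  refine Finset.sum_congr rfl fun i _ => ?_
  rw [← integral_div]
  refine integral_congr_ae (Filter.Eventually.of_forall fun ω => ?_)
  simp only
  rw [abs_div, div_pow, abs_of_nonneg (Real.sqrt_nonneg _)]

end Lattice

theorem theorem3p1 :
    ∃ C : ℝ, 0 < C ∧
      ∀ (d : ℕ), 1 ≤ d →
      ∀ (Ω : Type*) [MeasurableSpace Ω] (μ : Measure Ω) [IsProbabilityMeasure μ]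
        (m : ℕ) (J : Finset (IntLattice d)) (X : IntLattice d → Ω → ℝ),
        (∀ i ∈ J, Measurable (X i)) →
        (∀ i ∈ J, Integrable (fun ω => |X i ω| ^ 3) μ) →
        (∀ i ∈ J, ∫ ω, X i ω ∂μ = 0) →
        IsMDependentField μ J X m →
        0 < sigmaSq J X m μ →
        ⨆ z : ℝ, |μ.real {ω | selfNormalizedSum J X m ω ≤ z} - cdf (gaussianReal 0 1) z|
          ≤ C ^ d * ((m : ℝ) + 1) ^ (3 * d)
            * (1 + ((m : ℝ) + 1) ^ d * (J.card : ℝ) ^ (1 / 3 : ℝ)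
              * gammaRatio J X m μ ^ (2 / 3 : ℝ))
            * (gammaRatio J X m μ + (J.card : ℝ) ^ (-(1 / 2) : ℝ)) := by
  refine ⟨10 ^ 14, by norm_num, ?_⟩
  intro d hd Ω _ μ _ m J X hmeas hint hmean hdep hσ
  refine ciSup_le fun z => ?_
  have hJ : J.Nonempty := by
    rw [Finset.nonempty_iff_ne_empty]
    rintro rfl
    simp [sigmaSq] at hσ
  have hγ := gammaRatio_eq_sum (J := J) (X := X) (m := m) (μ := μ)
  have hnorm := sum_integral_mul_nearSum_eq_one hσ
  have hs0 : 0 < Real.sqrt (sigmaSq J X m μ) := Real.sqrt_pos.mpr hσ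
  obtain ⟨s, hs⟩ : ∃ s, s = Real.sqrt (sigmaSq J X m μ) := ⟨_, rfl⟩
  rw [← hs] at hγ hnorm hs0
  have hM : (1 : ℝ) ≤ (m : ℝ) + 1 := by linarith [Nat.cast_nonneg (α := ℝ) m]
  have hγ0 : 0 ≤ gammaRatio J X m μ :=
    hγ ▸ Finset.sum_nonneg fun i _ => integral_nonneg fun ω => by positivity
  have hmain := studentSum_normal_approx (μ := μ) (U := fun ω (i : J) => X i ω / s)
    -- A ball of radius `5 m` in `ℤ^d` has at most `(10 m + 1) ^ d` points.
    (dist := subDist J) (m := m) (D := (10 * ((m : ℝ) + 1)) ^ d)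
    (fun i => latticeDist_self i.1) (fun i j => latticeDist_comm i.1 j.1)
    (fun i j k => latticeDist_triangle i.1 j.1 k.1) (one_le_pow₀ (by linarith))
    (fun i => by
      have h1 : (((2 * (5 * m) + 1) ^ d : ℕ) : ℝ) ≤ (10 * ((m : ℝ) + 1)) ^ d := by
        push_cast
        refine pow_le_pow_left₀ (by positivity) ?_ d
        linarith
      exact (Nat.cast_le.mpr (card_distBall_subDist_le J m 5 i)).trans h1)
    (fun i => (hmeas i i.2).div_const s)
    (fun i => by
      simp only [abs_div, div_pow]
      exact (hint i i.2).div_const _)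
    (fun i => by rw [integral_div, hmean i i.2, zero_div])
    (indep_coordSigma_of_isMDependentField hdep s) hnorm hγ z
  rw [Fintype.card_coe] at hmain
  simp only [selfNormalizedSum_eq_studentSum hs0 hJ]
  refine hmain.trans ?_
  set b := (J.card : ℝ) ^ (1 / 3 : ℝ) * gammaRatio J X m μ ^ (2 / 3 : ℝ) with hb
  have hb0 : 0 ≤ b := by positivity
  have hδ0 : 0 ≤ (J.card : ℝ) ^ (-(1 / 2) : ℝ) := by positivity
  refine mul_le_mul_of_nonneg_right ?_ (add_nonneg hγ0 hδ0)
  rw [mul_assoc (((m : ℝ) + 1) ^ d), ← hb]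
  set M : ℝ := (m : ℝ) + 1
  have hM0 : 0 < M := by linarith
  have h10 : (1 : ℝ) ≤ 10 ^ d := one_le_pow₀ (by norm_num)
  have h1 : 1 + (10 * M) ^ d * b ≤ 10 ^ d * (1 + M ^ d * b) := by
    rw [mul_pow]
    nlinarith
  -- The factors `10 ^ 10`, `10 ^ (3 d)` and `10 ^ d` are absorbed into `C ^ d` with `C = 10 ^ 14`;
  -- for the first this needs `d ≥ 1`.
  calc 10 ^ 10 * ((10 * M) ^ d) ^ 3 * (1 + (10 * M) ^ d * b)
      ≤ (10 ^ 10) ^ d * ((10 * M) ^ d) ^ 3 * (10 ^ d * (1 + M ^ d * b)) := by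
        have h2 : (10 : ℝ) ^ 10 ≤ (10 ^ 10) ^ d := le_self_pow₀ (by norm_num) (by omega)
        gcongr
    _ = (10 ^ 14) ^ d * M ^ (3 * d) * (1 + M ^ d * b) := by
        rw [show (10 : ℝ) ^ 14 = 10 ^ 10 * (10 ^ 3 * 10) by norm_num, mul_pow, mul_pow, mul_pow,
          mul_pow, ← pow_mul, ← pow_mul, ← pow_mul, ← pow_mul, mul_comm d 3]
        ring
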